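/- For $s>0$ let $\mathbb T(s)$ be the torus obtained by identifying opposite sides of $[0,s]^2$, with the metric $d$ induced by the Euclidean metric. For $0<p<1$, a coloured Poisson process $(Z,\mathrm{col})$ on $\mathbb T(s)$ with parameter $p$ consists of a Poisson process $Z$ of intensity $1$ on $\mathbb T(s)$ and a colouring in which, given $Z$, each point of $Z$ is black with probability $p$, independently of all other points, and white otherwise. A point $x\in\mathbb T(s)$ is black if at least one of the points of $Z$ closest to $x$ is black (i.e. $x$ lies in the closed Voronoi cell of a black point); it is $\delta$-robustly black if the closest black point of $Z$ is at least a distance $\delta$ closer to $x$ than the closest white point is. A path in $\mathbb T(s)$ is black, respectively $\delta$-robustly black, if every point of it is. **Theorem.** Let $0<p_1<p_2<1$ and $\epsilon>0$ be given, and let $\delta=\delta(s)$ be any real function with $\delta(s)\le s^{-\epsilon}$ for all $s>0$. Then for each $s>0$ one may construct on one probability space coloured Poisson processes $(Z_1,\mathrm{col}_1)$ and $(Z_2,\mathrm{col}_2)$ on $\mathbb T(s)$ with parameters $p_1$ and $p_2$ respectively, in such a way that, with probability tending to $1$ as $s\to\infty$, the following holds: for every piecewise-linear path $P_1$ in $\mathbb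 T(s)$ that is black with respect to $(Z_1,\mathrm{col}_1)$ there is a piecewise-linear path $P_2$ in $\mathbb T(s)$ that is $4\delta(s)$-robustly black with respect to $(Z_2,\mathrm{col}_2)$, such that every point of $P_2$ is within distance $(\log s)^2$ of some point of $P_1$, and every point of $P_1$ is within distance $(\log s)^2$ of some point of $P_2$. -/

import Mathlib

open MeasureTheory ProbabilityTheory Filter Topology

noncomputable section

namespace VoronoiTorus

/-- The flat torus obtained by identifying opposite sides of the square `[0, s]²`, with the metric
induced by the Euclidean metric (the `ℓ²` product of two circles of length `s`). -/
abbrev Torus (s : ℝ) : Type := WithLp 2 (AddCircle s × AddCircle s)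

/-- The covering map from the plane to the torus. -/
def proj (s : ℝ) (x : ℝ × ℝ) : Torus s :=
  WithLp.toLp 2 ((x.1 : AddCircle s), (x.2 : AddCircle s))

/-- The area measure on the torus: the image of Lebesgue measure on the fundamental square. -/
def area (s : ℝ) : Measure (Torus s) :=
  Measure.map (proj s)
    ((volume : Measure (ℝ × ℝ)).restrict (Set.Ico 0 s ×ˢ Set.Ico 0 s))

/-- A finite set of points of the torus, each of which is either black or white. -/
structure ColouredPoints (s : ℝ) where
  black : Finset (Torus s)
  white : Finset (Torus s)
  disjoint : Disjoint black white

/-- The underlying set of points, with the colours forgotten. -/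
def ColouredPoints.points {s : ℝ} (c : ColouredPoints s) : Set (Torus s) :=
  (c.black : Set (Torus s)) ∪ (c.white : Set (Torus s))

/-- The number of points of `c`, of either colour, in the set `A`. -/
def ColouredPoints.count {s : ℝ} (c : ColouredPoints s) (A : Set (Torus s)) : ℕ :=
  (c.points ∩ A).ncard

/-- The number of black points of `c` in the set `A`. -/
def ColouredPoints.blackCount {s : ℝ} (c : ColouredPoints s) (A : Set (Torus s)) : ℕ :=
  ((c.black : Set (Torus s)) ∩ A).ncard

/-- `X` is a Poisson process of intensity `1` on the torus in which, given the process, each point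
is coloured black with probability `p`, independently of all other points, and white otherwise.

The process of points has Poisson counts, with mean the area, which are independent for disjoint
sets. The rule for the colours is expressed on all finite families of disjoint measurable sets:
given the numbers of points in these sets, the numbers of black points are independent and
binomially distributed. -/
structure IsColouredPoissonProcess {s : ℝ} {Ω : Type*} [MeasurableSpace Ω] (p : ℝ)
    (P : Measure Ω) (X : Ω → ColouredPoints s) : Prop where
  measurable_count : ∀ A : Set (Torus s), MeasurableSet A →
    Measurable fun ω => (X ω).count A
  measurable_blackCount : ∀ A : Set (Torus s), MeasurableSet A →
    Measurable fun ω => (X ω).blackCount A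
  map_count : ∀ A : Set (Torus s), MeasurableSet A →
    P.map (fun ω => (X ω).count A) = poissonMeasure (area s A).toNNReal
  indep_count : ∀ (m : ℕ) (A : Fin m → Set (Torus s)), (∀ i, MeasurableSet (A i)) →
    Pairwise (fun i j => Disjoint (A i) (A j)) →
    iIndepFun (fun i ω => (X ω).count (A i)) P
  colours : ∀ (m : ℕ) (A : Fin m → Set (Torus s)), (∀ i, MeasurableSet (A i)) →
    Pairwise (fun i j => Disjoint (A i) (A j)) → ∀ n k : Fin m → ℕ,
    P.real {ω | ∀ i, (X ω).count (A i) = n i ∧ (X ω).blackCount (A i) = k i} =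
      P.real {ω | ∀ i, (X ω).count (A i) = n i} *
        ∏ i, ((n i).choose (k i) * p ^ k i * (1 - p) ^ (n i - k i))

/-- The Voronoi cell of `z` with respect to the set `Z`. -/
def voronoiCell {s : ℝ} (Z : Set (Torus s)) (z : Torus s) : Set (Torus s) :=
  {x | ∀ z' ∈ Z, dist x z ≤ dist x z'}

/-- A point of the torus is black if it lies in the Voronoi cell of a black point (so points on
cell boundaries may be both black and white). -/
def IsBlack {s : ℝ} (c : ColouredPoints s) (x : Torus s) : Prop :=
  ∃ z ∈ c.black, x ∈ voronoiCell c.points z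

/-- `x` is `δ`-robustly black: the closest black point is at least `δ` closer to `x` than the
closest white point, i.e. some black point is at least `δ` closer than every white point. -/
def IsRobustlyBlack {s : ℝ} (c : ColouredPoints s) (δ : ℝ) (x : Torus s) : Prop :=
  ∃ b ∈ c.black, ∀ w ∈ c.white, dist x b + δ ≤ dist x w

/-- A piecewise-linear path in the torus: a concatenation of `len + 1` line segments, given by the
successive vertices of a lift to the plane. -/
structure PLPath where
  len : ℕ
  vertex : Fin (len + 2) → ℝ × ℝ

/-- The set of points of the torus `Torus s` that lie on the path. -/
def PLPath.trace (s : ℝ) (γ : PLPath) : Set (Torus s) :=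
  ⋃ i : Fin (γ.len + 1), proj s '' segment ℝ (γ.vertex i.castSucc) (γ.vertex i.succ)

/-- Every piecewise-linear path that is black for `c₁` has a `δ`-robustly black piecewise-linear
path for `c₂` such that every point of either path is within distance `r` of the other path. -/
def BlackPathsShadowed {s : ℝ} (c₁ c₂ : ColouredPoints s) (δ r : ℝ) : Prop :=
  ∀ γ₁ : PLPath, (∀ x ∈ γ₁.trace s, IsBlack c₁ x) →
    ∃ γ₂ : PLPath, (∀ x ∈ γ₂.trace s, IsRobustlyBlack c₂ δ x) ∧
      (∀ y ∈ γ₂.trace s, ∃ x ∈ γ₁.trace s, dist y x ≤ r) ∧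
      (∀ x ∈ γ₁.trace s, ∃ y ∈ γ₂.trace s, dist x y ≤ r)

end VoronoiTorus

end

/-!
The two processes are built on a torus that is cut into square cells of a small constant side. Each
cell contains *ordinary* points, whose marks in `{0, 1, 2}` say that the point is black in both
colourings, white in both, or white in the first and black in the second, and *extra* points, which
behave like those of mark `2`. The law of these data is a product over the cells, and both colourings
of a random configuration are coloured Poisson processes, with parameters `p₁` and `p₂` for suitable
intensities and mark probabilities (`isColouredPoissonProcess_colouring`, `exists_markLaw_of_lt`).

If the same configuration were used for both processes, a path in the first black region could be
pushed slightly so as to become robustly black in the second, except where a white point is nearly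
equidistant, together with two black points, from certain critical points of their bisector
(`Degenerate`). Indeed, the points of the bisector of two neighbouring black sites where both of them
beat every white site by a margin are described by finitely many affine constraints, and
`exists_affine_ge` finds one as soon as no constraint nearly fails where another is tight. A cell in
which a degenerate white point may occur is *bad*. With a margin that is a negative power of `s`,
bad cells are rare, but they do occur in the whole torus.

The bad cells are therefore removed by changing the second configuration without changing its law.
A cell is *good* if, in the whole `9 × 9` block around it, every cell has an extra point, and all
points have mark `2`; given the positions of the ordinary points in the other cells, this has a
probability that decays with a smaller power of `s` than that of being bad. Resampling the cell, and the data of the block other than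
the positions of ordinary points, one can exchange bad with good in a reversible way: every bad cell
becomes good, and a few good cells become bad (`exists_exchange`). The cells are treated one after
the other (`exists_coupled`). Both changes are harmless to the path. If a bad cell has become good,
its block is densely black in the second colouring, so that the cell of every black site there is
black with a margin. If a good cell has become bad, its block was densely white in the first
colouring, so that the first black region stays away from it, by a margin. In either case the
point is that a dense block shields its centre (`exists_dense_gain`).

In the remaining cells the ordinary points are common to the two configurations, so that the
Voronoi cells of the black sites met by the path can be linked one by one (`Compares`,
`exists_shadow`). The coupling fails only if some cell contains more than a constant times `log s`
ordinary points or a long run of cells contains none, and these events have a probability of order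
`1 / s` for a suitable side of the cells (`exists_coupling`, `eventually_exists_coupling`).
-/

noncomputable section

namespace VoronoiTorus

/-! ### Affine constraints on an interval -/

/-- Moving to the right as far as finitely many affine constraints permit, one stops at the end of
the interval or at a point where a non-constant constraint is tight. -/
lemma exists_rightmost {ι : Type*} (U : Finset ι) (α β θ : ι → ℝ) {hi t₀ : ℝ} (h1 : t₀ ≤ hi)
    (hU : ∀ w ∈ U, θ w ≤ α w * t₀ + β w) :
    ∃ t, t₀ ≤ t ∧ t ≤ hi ∧ (∀ w ∈ U, θ w ≤ α w * t + β w) ∧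
      (t = hi ∨ ∃ w ∈ U, α w ≠ 0 ∧ α w * t + β w = θ w) := by
  have hJ : IsCompact (Set.Icc t₀ hi ∩ ⋂ w ∈ U, {t | θ w ≤ α w * t + β w}) := by
    refine isCompact_Icc.inter_right ?_
    refine isClosed_biInter fun w _ => ?_
    exact isClosed_le continuous_const (by fun_prop)
  obtain ⟨t, ht, hmax⟩ := hJ.exists_isGreatest
    ⟨t₀, ⟨le_rfl, h1⟩, by simpa using hU⟩
  have htU : ∀ w ∈ U, θ w ≤ α w * t + β w := by simpa using ht.2
  refine ⟨t, ht.1.1, ht.1.2, htU, ?_⟩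
  by_contra hcon
  push Not at hcon
  obtain ⟨hne, hw⟩ := hcon
  have hlt : t < hi := lt_of_le_of_ne ht.1.2 hne
  have hev : ∀ᶠ u in 𝓝[>] t, ∀ w ∈ U, θ w ≤ α w * u + β w := by
    rw [Filter.eventually_all_finset]
    intro w hwU
    by_cases h0 : α w = 0
    · filter_upwards with u
      have := htU w hwU
      simpa [h0] using this
    · have hlt' : θ w < α w * t + β w := lt_of_le_of_ne (htU w hwU) (Ne.symm (hw w hwU h0))
      have hc : ContinuousAt (fun u => α w * u + β w) t := by fun_prop
      exact nhdsWithin_le_nhds ((hc.eventually_const_lt hlt').mono fun u hu => hu.le)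
  have hev2 : ∀ᶠ u in 𝓝[>] t, u < hi := nhdsWithin_le_nhds (eventually_lt_nhds hlt)
  obtain ⟨u, hu1, hu2, hu3⟩ := (hev.and (hev2.and self_mem_nhdsWithin)).exists
  have : u ≤ t := hmax ⟨⟨ht.1.1.trans (le_of_lt hu3), hu2.le⟩, by simpa using hu1⟩
  exact absurd hu3 (not_lt.mpr this)

/-- If finitely many affine functions are nonnegative at a point of an interval, and no value of
one of them at an endpoint, or at a point where another one equals `0` or `η`, lies in `[0, η)`,
then they are simultaneously at least `η` somewhere on the interval. -/
lemma exists_affine_ge {ι : Type*} (S : Finset ι) (α β : ι → ℝ) {lo hi t₀ η : ℝ}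
    (h0 : lo ≤ t₀) (h1 : t₀ ≤ hi)
    (hS : ∀ w ∈ S, 0 ≤ α w * t₀ + β w)
    (hgen : ∀ w' ∈ S, ∀ t, lo ≤ t → t ≤ hi →
      (t = lo ∨ t = hi ∨ ∃ w ∈ S, w ≠ w' ∧ α w ≠ 0 ∧
        (α w * t + β w = 0 ∨ α w * t + β w = η)) →
      0 ≤ α w' * t + β w' → η ≤ α w' * t + β w') :
    ∃ t, lo ≤ t ∧ t ≤ hi ∧ ∀ w ∈ S, η ≤ α w * t + β w := by
  classical
  -- The constraints are raised from `0` to `η` one at a time.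
  suffices H : ∀ T ⊆ S, ∃ t, lo ≤ t ∧ t ≤ hi ∧
      ∀ w ∈ S, (if w ∈ T then η else 0) ≤ α w * t + β w by
    obtain ⟨t, a, b, c⟩ := H S subset_rfl
    exact ⟨t, a, b, fun w hw => by simpa [hw] using c w hw⟩
  intro T
  induction T using Finset.induction_on with
  | empty => intro _; exact ⟨t₀, h0, h1, by simpa using hS⟩
  | insert w' T hw' ih =>
    intro hT
    obtain ⟨t, a, b, c⟩ := ih ((Finset.subset_insert _ _).trans hT)
    have hw'S : w' ∈ S := hT (Finset.mem_insert_self _ _)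
    have hcur : 0 ≤ α w' * t + β w' := by simpa [hw'] using c w' hw'S
    obtain ⟨u, u1, u2, u3, u4, u5⟩ : ∃ u, lo ≤ u ∧ u ≤ hi ∧
        (∀ w ∈ S.erase w', (if w ∈ T then η else 0) ≤ α w * u + β w) ∧
        α w' * t + β w' ≤ α w' * u + β w' ∧
        (u = lo ∨ u = hi ∨ ∃ w ∈ S.erase w', α w ≠ 0 ∧
          α w * u + β w = (if w ∈ T then η else 0)) := by
      rcases le_total 0 (α w') with hα | hα
      · obtain ⟨u, v1, v2, v3, v4⟩ := exists_rightmost (S.erase w') α β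
          (fun w => if w ∈ T then η else 0) b (fun w hw => c w (Finset.mem_of_mem_erase hw))
        exact ⟨u, a.trans v1, v2, v3, by nlinarith, Or.inr v4⟩
      · obtain ⟨u, v1, v2, v3, v4⟩ := exists_rightmost (S.erase w') (fun w => -α w) β
          (fun w => if w ∈ T then η else 0) (neg_le_neg a)
          (fun w hw => by simpa using c w (Finset.mem_of_mem_erase hw))
        refine ⟨-u, by linarith, by linarith, fun w hw => by simpa using v3 w hw,
          by nlinarith, ?_⟩
        rcases v4 with v4 | ⟨w, hw, h, h'⟩
        · left; linarith
        · right; right; exact ⟨w, hw, by simpa using h, by simpa using h'⟩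
    have hkey : η ≤ α w' * u + β w' := by
      refine hgen w' hw'S u u1 u2 ?_ (hcur.trans u4)
      rcases u5 with h | h | ⟨w, hw, h, h'⟩
      · exact Or.inl h
      · exact Or.inr (Or.inl h)
      · refine Or.inr (Or.inr ⟨w, Finset.mem_of_mem_erase hw, Finset.ne_of_mem_erase hw, h, ?_⟩)
        split_ifs at h' with hh
        · exact Or.inr h'
        · exact Or.inl h'
    refine ⟨u, u1, u2, fun w hw => ?_⟩
    by_cases hww : w = w'
    · subst hww; simpa using hkey
    · have := u3 w (Finset.mem_erase.2 ⟨hww, hw⟩)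
      simpa [Finset.mem_insert, hww] using this

/-! ### Perpendicular bisectors -/

/-- The points of the perpendicular bisector of `0` and `d`. -/
def bisPt (d : ℂ) (t : ℝ) : ℂ := d / 2 + t * (Complex.I * d)

/-- The parameters on the bisector of `0` and `d` that are singled out by `d` and `e`: a grid of
spacing `ζ`, and the points at which the squared distance to `e` exceeds that to `0` by `0` or
by `η`. -/
def criticalParam (ζ η : ℝ) (d e : ℂ) : Bool ⊕ ℤ → ℝ
  | Sum.inl θ => (‖e‖ ^ 2 - (d.re * e.re + d.im * e.im) - (if θ then η else 0)) /
      (2 * (d.re * e.im - d.im * e.re))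
  | Sum.inr k => k * ζ / ‖d‖

/-- The indices of the critical parameters, with the grid restricted to `2 K + 1` points. -/
def criticalIndices (K : ℕ) : Finset (Bool ⊕ ℤ) :=
  Finset.univ.disjSum (Finset.Icc (-K : ℤ) K)

/-- Relative to a site at the origin, with further sites at `d` and `e`, the point `e'` is nearly
equidistant with the origin from one of the finitely many critical points on the bisector of `0`
and `d`. -/
def Degenerate (ζ η : ℝ) (K : ℕ) (d e e' : ℂ) : Prop :=
  ∃ j ∈ criticalIndices K,
    0 ≤ ‖bisPt d (criticalParam ζ η d e j) - e'‖ ^ 2 - ‖bisPt d (criticalParam ζ η d e j)‖ ^ 2 ∧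
    ‖bisPt d (criticalParam ζ η d e j) - e'‖ ^ 2 - ‖bisPt d (criticalParam ζ η d e j)‖ ^ 2 < η

lemma normSq_eq (z : ℂ) : ‖z‖ ^ 2 = z.re ^ 2 + z.im ^ 2 := by
  rw [Complex.sq_norm, Complex.normSq_apply]; ring

lemma bisPt_re (d : ℂ) (t : ℝ) : (bisPt d t).re = d.re / 2 - t * d.im := by
  simp [bisPt]; ring

lemma bisPt_im (d : ℂ) (t : ℝ) : (bisPt d t).im = d.im / 2 + t * d.re := by
  simp [bisPt]

lemma bisPt_excess (d e : ℂ) (t : ℝ) :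
    ‖bisPt d t - e‖ ^ 2 - ‖bisPt d t‖ ^ 2 =
      (-2 * (d.re * e.im - d.im * e.re)) * t + (‖e‖ ^ 2 - (d.re * e.re + d.im * e.im)) := by
  simp only [normSq_eq, Complex.sub_re, Complex.sub_im, bisPt_re, bisPt_im]; ring

lemma norm_bisPt_sq (d : ℂ) (t : ℝ) : ‖bisPt d t‖ ^ 2 = (1 / 4 + t ^ 2) * ‖d‖ ^ 2 := by
  simp only [normSq_eq, bisPt_re, bisPt_im]; ring

lemma norm_bisPt_sub (d : ℂ) (t : ℝ) : ‖bisPt d t - d‖ = ‖bisPt d t‖ := by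
  rw [← sq_eq_sq₀ (norm_nonneg _) (norm_nonneg _)]
  simp only [normSq_eq, Complex.sub_re, Complex.sub_im, bisPt_re, bisPt_im]; ring

lemma bisPt_sub_bisPt (d : ℂ) (t u : ℝ) : ‖bisPt d t - bisPt d u‖ = |t - u| * ‖d‖ := by
  have : bisPt d t - bisPt d u = ((t - u : ℝ) : ℂ) * (Complex.I * d) := by
    simp [bisPt]; ring
  rw [this, norm_mul, norm_mul, Complex.norm_I, Complex.norm_real, Real.norm_eq_abs, one_mul]

lemma exists_eq_bisPt {d y : ℂ} (hd : d ≠ 0) (h : ‖y‖ = ‖y - d‖) : ∃ t, y = bisPt d t := by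
  have hpos : 0 < d.re ^ 2 + d.im ^ 2 := by rw [← normSq_eq]; positivity
  have h2 : ‖y‖ ^ 2 = ‖y - d‖ ^ 2 := by rw [h]
  simp only [normSq_eq, Complex.sub_re, Complex.sub_im] at h2
  refine ⟨(y.im * d.re - y.re * d.im) / (d.re ^ 2 + d.im ^ 2), ?_⟩
  apply Complex.ext
  · rw [bisPt_re]; field_simp; linear_combination d.re * h2
  · rw [bisPt_im]; field_simp; linear_combination d.im * h2

/-- If `y` is equidistant from the sites `0` and `d` and no farther from the points of `S`, and no
pair of points of `S` is degenerate, then near `y` there is a point of the bisector whose squared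
distance to every point of `S` exceeds that to the two sites by `η`. -/
lemma exists_bisector_gap {ζ η r : ℝ} {K : ℕ} (hζ : 0 < ζ)
    (hK : r / ζ + 1 ≤ K) {d y : ℂ} (hd : d ≠ 0) (hy : ‖y‖ = ‖y - d‖) (hyr : ‖y‖ ≤ r)
    (S : Finset ℂ) (hS : ∀ w ∈ S, ‖y‖ ≤ ‖y - w‖)
    (hdeg : ∀ w' ∈ S, ∀ w ∈ insert d S, w ≠ w' → ¬ Degenerate ζ η K d w w')
    (hdS : d ∉ S) :
    ∃ y', ‖y' - y‖ ≤ ζ ∧ ‖y'‖ = ‖y' - d‖ ∧ ∀ w ∈ S, ‖y'‖ ^ 2 + η ≤ ‖y' - w‖ ^ 2 := by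
  obtain ⟨t₀, rfl⟩ := exists_eq_bisPt hd hy
  have hdpos : 0 < ‖d‖ := norm_pos_iff.2 hd
  have ht0 : |t₀| * ‖d‖ ≤ r := by
    refine le_trans ?_ hyr
    refine abs_le_of_sq_le_sq' ?_ (norm_nonneg _) |>.2
    rw [norm_bisPt_sq, mul_pow, sq_abs]
    nlinarith [sq_nonneg ‖d‖]
  set k : ℤ := ⌊t₀ * ‖d‖ / ζ⌋ with hk
  have hk1 : (k : ℝ) ≤ t₀ * ‖d‖ / ζ := Int.floor_le _
  have hk2 : t₀ * ‖d‖ / ζ < k + 1 := Int.lt_floor_add_one _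
  have hlo : (k : ℝ) * ζ / ‖d‖ ≤ t₀ := by
    rw [div_le_iff₀ hdpos]; rwa [le_div_iff₀ hζ] at hk1
  have hhi : t₀ ≤ ((k + 1 : ℤ) : ℝ) * ζ / ‖d‖ := by
    rw [le_div_iff₀ hdpos]; push_cast; rw [div_lt_iff₀ hζ] at hk2; linarith
  have habs : |t₀ * ‖d‖ / ζ| ≤ r / ζ := by
    rw [abs_div, abs_mul, abs_of_pos hdpos, abs_of_pos hζ]; gcongr
  have hkK : ∀ j : ℤ, (k = j ∨ k + 1 = j) → Sum.inr j ∈ criticalIndices K := by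
    intro j hj
    simp only [criticalIndices, Finset.inr_mem_disjSum, Finset.mem_Icc]
    have h3 := abs_le.1 habs
    have hjl : (-(K : ℤ) : ℝ) ≤ j ∧ (j : ℝ) ≤ K := by
      rcases hj with rfl | rfl
      · constructor <;> push_cast <;> linarith
      · constructor <;> push_cast <;> linarith
    exact ⟨by exact_mod_cast hjl.1, by exact_mod_cast hjl.2⟩
  obtain ⟨t, hl, hh, ht⟩ := exists_affine_ge S
    (fun w => -2 * (d.re * w.im - d.im * w.re))
    (fun w => ‖w‖ ^ 2 - (d.re * w.re + d.im * w.im)) hlo hhi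
    (fun w hw => by
      rw [← bisPt_excess]
      have := hS w hw
      nlinarith [norm_nonneg (bisPt d t₀)])
    (by
      intro w' hw' t _ _ hcase hnn
      by_contra hlt
      push Not at hlt
      rw [← bisPt_excess] at hnn hlt
      rcases hcase with h | h | ⟨w, hwS, hne, hα, hval⟩
      · refine hdeg w' hw' d (Finset.mem_insert_self _ _) (fun h' => hdS (h' ▸ hw'))
          ⟨Sum.inr k, hkK k (Or.inl rfl), ?_⟩
        simp only [criticalParam]
        rw [← h]; exact ⟨hnn, hlt⟩
      · refine hdeg w' hw' d (Finset.mem_insert_self _ _) (fun h' => hdS (h' ▸ hw'))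
          ⟨Sum.inr (k + 1), hkK (k + 1) (Or.inr rfl), ?_⟩
        simp only [criticalParam]
        rw [← h]; exact ⟨hnn, hlt⟩
      · have hα' : (d.re * w.im - d.im * w.re) ≠ 0 := fun h0 => hα (by rw [h0]; ring)
        have hsolve : ∀ θ : Bool, (-2 * (d.re * w.im - d.im * w.re)) * t +
            (‖w‖ ^ 2 - (d.re * w.re + d.im * w.im)) = (if θ then η else 0) →
            criticalParam ζ η d w (Sum.inl θ) = t := by
          intro θ hθ
          simp only [criticalParam]
          rw [div_eq_iff (by simpa using hα'), ← hθ]; ring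
        have hmem : ∀ θ : Bool, Sum.inl θ ∈ criticalIndices K := by
          intro θ; simp [criticalIndices]
        rcases hval with h | h
        · refine hdeg w' hw' w (Finset.mem_insert_of_mem hwS) hne ⟨Sum.inl false, hmem _, ?_⟩
          rw [hsolve false (by simpa using h)]; exact ⟨hnn, hlt⟩
        · refine hdeg w' hw' w (Finset.mem_insert_of_mem hwS) hne ⟨Sum.inl true, hmem _, ?_⟩
          rw [hsolve true (by simpa using h)]; exact ⟨hnn, hlt⟩)
  refine ⟨bisPt d t, ?_, (norm_bisPt_sub d t).symm, fun w hw => ?_⟩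
  · rw [bisPt_sub_bisPt]
    have : |t - t₀| ≤ ζ / ‖d‖ := by
      have e : ((k + 1 : ℤ) : ℝ) * ζ / ‖d‖ = (k : ℝ) * ζ / ‖d‖ + ζ / ‖d‖ := by
        push_cast; ring
      rw [abs_le]; constructor <;> linarith
    rwa [le_div_iff₀ hdpos] at this
  · have := ht w hw
    rw [← bisPt_excess] at this
    linarith

/-- A difference of squared distances forces a difference of distances. -/
lemma add_le_of_sq_add_le {A B c R η : ℝ} (hA : 0 ≤ A) (hBR : B ≤ R) (hc : 0 ≤ c)
    (hη : c * (2 * R + c) ≤ η) (h : B ^ 2 + η ≤ A ^ 2) : B + c ≤ A := by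
  refine abs_le_of_sq_le_sq' ?_ hA |>.2
  nlinarith

/-- Moving straight towards `b` preserves the lead of `b` over any other point. -/
lemma add_le_of_mem_segment {b w x y : ℂ} {c : ℝ} (h : dist y b + c ≤ dist y w)
    (hx : x ∈ segment ℝ y b) : dist x b + c ≤ dist x w := by
  have h1 := dist_add_dist_of_mem_segment hx
  have h2 := dist_triangle y x w
  linarith

/-- On the way from `y` to `b` one gains on every point that is at least as far from `y` as `b`
is and that is not close to `b`. -/
lemma sq_add_le_of_lineMap {b w y : ℂ} {θ ρ : ℝ} (hθ : 0 ≤ θ) (hθ1 : θ ≤ 1)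
    (h : dist y b ≤ dist y w) (hρ : ρ ≤ ‖w - b‖ ^ 2) :
    dist (y + θ * (b - y)) b ^ 2 + θ * ρ ≤ dist (y + θ * (b - y)) w ^ 2 := by
  have h2 : dist y b ^ 2 ≤ dist y w ^ 2 := by gcongr
  simp only [Complex.dist_eq, normSq_eq, Complex.sub_re, Complex.sub_im, Complex.add_re,
    Complex.add_im, Complex.mul_re, Complex.mul_im, Complex.ofReal_re, Complex.ofReal_im,
    zero_mul, sub_zero, add_zero] at h2 hρ ⊢
  nlinarith [mul_le_mul_of_nonneg_left hρ hθ, mul_le_mul_of_nonneg_left h2 (sub_nonneg.2 hθ1)]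

/-! ### Grid squares -/

/-- The index of the square, of the grid of mesh `a`, that contains `x`. -/
def gridIdx (a : ℝ) (x : ℂ) : ℤ × ℤ := (⌊x.re / a⌋, ⌊x.im / a⌋)

/-- The squares in the `9 × 9` block around a given one. -/
def InBlock (z z' : ℤ × ℤ) : Prop := |z.1 - z'.1| ≤ 4 ∧ |z.2 - z'.2| ≤ 4

lemma dist_le_of_gridIdx_eq {a : ℝ} (ha : 0 < a) {x y : ℂ} (h : gridIdx a x = gridIdx a y) :
    dist x y ≤ 3 / 2 * a := by
  simp only [gridIdx, Prod.mk.injEq] at h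
  have key : ∀ u v : ℝ, ⌊u / a⌋ = ⌊v / a⌋ → (u - v) ^ 2 ≤ a ^ 2 := by
    intro u v huv
    have := Int.abs_sub_lt_one_of_floor_eq_floor huv
    rw [← sub_div, abs_div, abs_of_pos ha, div_lt_one ha] at this
    exact sq_le_sq' (by linarith [(abs_lt.1 this).1]) (by linarith [(abs_lt.1 this).2])
  rw [Complex.dist_eq]
  refine abs_le_of_sq_le_sq' ?_ (by positivity) |>.2
  rw [normSq_eq, Complex.sub_re, Complex.sub_im]
  nlinarith [key _ _ h.1, key _ _ h.2]

lemma abs_floor_div_sub_le {a u v : ℝ} (ha : 0 < a) (h : |u - v| ≤ 2 * a) :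
    |⌊u / a⌋ - ⌊v / a⌋| ≤ 2 := by
  have h1 : |u / a - v / a| ≤ 2 := by
    rw [← sub_div, abs_div, abs_of_pos ha, div_le_iff₀ ha]; exact h
  have e1 := Int.floor_mono (show u / a ≤ v / a + (2 : ℤ) by push_cast; linarith [(abs_le.1 h1).2])
  have e2 := Int.floor_mono (show v / a ≤ u / a + (2 : ℤ) by push_cast; linarith [(abs_le.1 h1).1])
  rw [Int.floor_add_intCast] at e1 e2
  rw [abs_le]; omega

/-- If every square of the block around `p` contains a point of `V`, then some point of `V` is
closer to `x` than `p` is, or closer than everything outside the block, with a margin in either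
case. -/
lemma exists_dense_gain {a : ℝ} (ha : 0 < a) {V : Set ℂ} (x p : ℂ)
    (hV : ∀ z, InBlock z (gridIdx a p) → ∃ v ∈ V, gridIdx a v = z) :
    ∃ v ∈ V, InBlock (gridIdx a v) (gridIdx a p) ∧ (dist x v + a / 2 ≤ dist x p ∨
      ∀ u, ¬ InBlock (gridIdx a u) (gridIdx a p) → dist x v + a / 2 ≤ dist x u) := by
  by_cases hx : dist x p ≤ 2 * a
  · have hre : |x.re - p.re| ≤ 2 * a := by
      have := Complex.abs_re_le_norm (x - p)
      rw [← Complex.dist_eq, Complex.sub_re] at this; linarith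
    have him : |x.im - p.im| ≤ 2 * a := by
      have := Complex.abs_im_le_norm (x - p)
      rw [← Complex.dist_eq, Complex.sub_im] at this; linarith
    have h1 := abs_floor_div_sub_le ha hre
    have h2 := abs_floor_div_sub_le ha him
    have hb : InBlock (gridIdx a x) (gridIdx a p) :=
      ⟨h1.trans (by norm_num), h2.trans (by norm_num)⟩
    obtain ⟨v, hv, hvx⟩ := hV _ hb
    refine ⟨v, hv, hvx ▸ hb, Or.inr fun u hu => ?_⟩
    have hxv := dist_le_of_gridIdx_eq ha hvx.symm
    suffices 2 * a ≤ dist x u by linarith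
    by_contra hlt
    push Not at hlt
    have hre' : |x.re - u.re| ≤ 2 * a := by
      have := Complex.abs_re_le_norm (x - u)
      rw [← Complex.dist_eq, Complex.sub_re] at this; linarith
    have him' : |x.im - u.im| ≤ 2 * a := by
      have := Complex.abs_im_le_norm (x - u)
      rw [← Complex.dist_eq, Complex.sub_im] at this; linarith
    have h3 := abs_floor_div_sub_le ha hre'
    have h4 := abs_floor_div_sub_le ha him'
    apply hu
    simp only [InBlock, gridIdx, abs_le] at *
    omega
  · push Not at hx
    have hpos : 0 < dist x p := by linarith
    -- `q` is the point at distance `2 a` from `p` in the direction of `x`.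
    set l : ℝ := 2 * a / dist x p with hl
    have hl0 : 0 ≤ l := by positivity
    have hl1 : l ≤ 1 := by rw [hl, div_le_one hpos]; exact hx.le
    set q : ℂ := p + l * (x - p) with hq
    have hqp : dist q p = 2 * a := by
      rw [Complex.dist_eq, hq, add_sub_cancel_left, norm_mul, Complex.norm_real, Real.norm_eq_abs,
        abs_of_nonneg hl0, ← Complex.dist_eq, hl]
      field_simp
    have hxq : dist x q = dist x p - 2 * a := by
      have : x - q = ((1 - l : ℝ) : ℂ) * (x - p) := by rw [hq]; push_cast; ring
      rw [Complex.dist_eq, this, norm_mul, Complex.norm_real, Real.norm_eq_abs,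
        abs_of_nonneg (by linarith), ← Complex.dist_eq, hl]
      field_simp
    have hre : |q.re - p.re| ≤ 2 * a := by
      have := Complex.abs_re_le_norm (q - p)
      rw [← Complex.dist_eq, Complex.sub_re] at this; linarith
    have him : |q.im - p.im| ≤ 2 * a := by
      have := Complex.abs_im_le_norm (q - p)
      rw [← Complex.dist_eq, Complex.sub_im] at this; linarith
    have hb : InBlock (gridIdx a q) (gridIdx a p) :=
      ⟨(abs_floor_div_sub_le ha hre).trans (by norm_num),
        (abs_floor_div_sub_le ha him).trans (by norm_num)⟩
    obtain ⟨v, hv, hvq⟩ := hV _ hb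
    refine ⟨v, hv, hvq ▸ hb, Or.inl ?_⟩
    have h1 := dist_le_of_gridIdx_eq ha hvq.symm
    have h2 := dist_triangle x q v
    linarith

/-! ### Polygonal lines -/

/-- `u` and `v` are joined by a polygonal line inside `G`. -/
def PolyJoined (G : Set ℂ) : ℂ → ℂ → Prop :=
  Relation.ReflTransGen fun u v => segment ℝ u v ⊆ G

lemma PolyJoined.symm {G : Set ℂ} {u v : ℂ} (h : PolyJoined G u v) : PolyJoined G v u := by
  have : Std.Symm fun u v : ℂ => segment ℝ u v ⊆ G := ⟨fun x y h => by rwa [segment_symm]⟩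
  exact Std.Symm.symm (r := Relation.ReflTransGen fun u v : ℂ => segment ℝ u v ⊆ G) _ _ h

lemma PolyJoined.mono {G H : Set ℂ} (hGH : G ⊆ H) {u v : ℂ} (h : PolyJoined G u v) :
    PolyJoined H u v := by
  induction h with
  | refl => exact Relation.ReflTransGen.refl
  | tail _ h ih => exact ih.tail (h.trans hGH)

lemma PolyJoined.of_segment {G : Set ℂ} {u v : ℂ} (h : segment ℝ u v ⊆ G) : PolyJoined G u v :=
  Relation.ReflTransGen.single h

lemma PolyJoined.exists_vertices {G : Set ℂ} {u v : ℂ} (h : PolyJoined G u v) :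
    ∃ (N : ℕ) (p : ℕ → ℂ), p 0 = u ∧ p N = v ∧
      ∀ i < N, segment ℝ (p i) (p (i + 1)) ⊆ G := by
  induction h with
  | refl => exact ⟨0, fun _ => u, rfl, rfl, by simp⟩
  | @tail b c _ hbc ih =>
    obtain ⟨N, p, h0, hN, hp⟩ := ih
    refine ⟨N + 1, fun i => if i ≤ N then p i else c, by simpa using h0, by simp, ?_⟩
    intro i hi
    rcases Nat.lt_succ_iff_lt_or_eq.1 hi with h | h
    · simpa [h.le, Nat.succ_le_of_lt h] using hp i h
    · subst h; simpa [hN] using hbc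

/-- A polygonal line inside `G` visiting all of finitely many points that are joined to a point
`u` of it. -/
lemma exists_polyline_visiting {G : Set ℂ} {u : ℂ} (hu : u ∈ G) (A : Finset ℂ)
    (hA : ∀ v ∈ A, PolyJoined G u v) :
    ∃ (N : ℕ) (p : ℕ → ℂ), (∀ i < N + 1, segment ℝ (p i) (p (i + 1)) ⊆ G) ∧
      ∀ v ∈ A, ∃ i ≤ N + 1, p i = v := by
  classical
  suffices H : ∃ (N : ℕ) (p : ℕ → ℂ), p 0 = u ∧ (∀ i < N, segment ℝ (p i) (p (i + 1)) ⊆ G) ∧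
      ∀ v ∈ A, ∃ i ≤ N, p i = v by
    obtain ⟨N, p, h0, h1, h2⟩ := H
    refine ⟨N, fun i => if i = 0 then u else p (i - 1), fun i hi => ?_, fun v hv => ?_⟩
    · rcases Nat.eq_zero_or_pos i with rfl | hpos
      · simpa [h0] using hu
      · obtain ⟨j, rfl⟩ := Nat.exists_eq_succ_of_ne_zero hpos.ne'
        simpa using h1 j (by omega)
    · obtain ⟨i, hi, rfl⟩ := h2 v hv
      exact ⟨i + 1, by omega, by simp⟩
  induction A using Finset.induction_on with
  | empty => exact ⟨0, fun _ => u, rfl, by simp, by simp⟩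
  | insert v A _ ih =>
    obtain ⟨N, p, h0, h1, h2⟩ := ih fun w hw => hA w (Finset.mem_insert_of_mem hw)
    obtain ⟨M, q, q0, qM, hq⟩ := (hA v (Finset.mem_insert_self _ _)).symm.exists_vertices
    -- The new line starts at `v` and reaches `u`; it is walked from `u` to `v` and back.
    obtain ⟨M', q', q0', qM', hq'⟩ := (hA v (Finset.mem_insert_self _ _)).exists_vertices
    refine ⟨M' + (M + N), fun i => if i ≤ M' then q' i else if i - M' ≤ M then q (i - M')
      else p (i - M' - M), by simpa using q0', ?_, ?_⟩
    · intro i hi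
      by_cases h : i < M'
      · simpa [h.le, Nat.succ_le_of_lt h] using hq' i h
      by_cases h' : i - M' < M
      · have e1 : ¬ i + 1 ≤ M' := by omega
        have e2 : i + 1 - M' ≤ M := by omega
        have e3 : i + 1 - M' = (i - M') + 1 := by omega
        have := hq (i - M') h'
        by_cases h'' : i = M'
        · subst h''
          simp only [le_refl, if_true, e1, if_false, e2]
          simp only [Nat.sub_self] at this
          rw [q0] at this
          simpa [qM'] using this
        · have e4 : ¬ i ≤ M' := by omega
          have e5 : i - M' ≤ M := by omega
          simp only [e4, if_false, e5, if_true, e1, e2]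
          rw [e3]; exact this
      · have e1 : ¬ i + 1 ≤ M' := by omega
        have e2 : ¬ i + 1 - M' ≤ M := by omega
        have e3 : i + 1 - M' - M = (i - M' - M) + 1 := by omega
        have hthis := h1 (i - M' - M) (by omega)
        simp only [e1, e2, if_false]
        rw [e3]
        by_cases h3 : i ≤ M'
        · have hiM : i = M' := by omega
          have hM0 : M = 0 := by omega
          subst hM0
          subst hiM
          simp only [le_refl, if_true]
          have : q' i = p 0 := by rw [qM', h0, ← q0, qM]
          simpa [this] using hthis
        · simp only [h3, if_false]
          by_cases h4 : i - M' ≤ M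
          · have e5 : i - M' = M := by omega
            simp only [h4, if_true]
            rw [e5, qM, ← h0]
            simpa [e5] using hthis
          · simp only [h4, if_false]; exact hthis
    · intro w hw
      rcases Finset.mem_insert.1 hw with rfl | hw
      · exact ⟨M', by omega, by simpa using qM'⟩
      · obtain ⟨i, hi, rfl⟩ := h2 w hw
        rcases Nat.eq_zero_or_pos i with rfl | hpos
        · exact ⟨0, by omega, by simp [q0', h0]⟩
        · refine ⟨M' + M + i, by omega, ?_⟩
          have e1 : ¬ M' + M + i ≤ M' := by omega
          have e2 : ¬ M' + M + i - M' ≤ M := by omega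
          have e3 : M' + M + i - M' - M = i := by omega
          simp only [e1, e2, if_false, e3]

/-- If finitely many closed sets cover a connected set, any two of those that meet it can be linked
by sets of the family, consecutive ones meeting on it. -/
lemma linked_of_isPreconnected {X ι : Type*} [TopologicalSpace X] (A : Finset ι)
    (C : ι → Set X) (hC : ∀ b ∈ A, IsClosed (C b)) {γ : Set X} (hγ : IsPreconnected γ)
    (hcov : γ ⊆ ⋃ b ∈ A, C b) (hne : ∀ b ∈ A, (γ ∩ C b).Nonempty) (R : ι → ι → Prop)
    (hR : Equivalence R)
    (hstep : ∀ b ∈ A, ∀ b' ∈ A, ∀ y ∈ γ, y ∈ C b → y ∈ C b' → R b b') :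
    ∀ b ∈ A, ∀ b' ∈ A, R b b' := by
  classical
  intro b hb b' hb'
  by_contra hcon
  have key := isPreconnected_closed_iff.1 hγ (⋃ c ∈ A.filter (R b), C c)
    (⋃ c ∈ A.filter (fun c => ¬ R b c), C c)
    (isClosed_biUnion_finset fun c hc => hC c (Finset.mem_filter.1 hc).1)
    (isClosed_biUnion_finset fun c hc => hC c (Finset.mem_filter.1 hc).1)
  have hsub : γ ⊆ (⋃ c ∈ A.filter (R b), C c) ∪ (⋃ c ∈ A.filter (fun c => ¬ R b c), C c) := by
    intro x hx
    obtain ⟨c, hc, hxc⟩ := Set.mem_iUnion₂.1 (hcov hx)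
    by_cases h : R b c
    · exact Or.inl (Set.mem_iUnion₂.2 ⟨c, Finset.mem_filter.2 ⟨hc, h⟩, hxc⟩)
    · exact Or.inr (Set.mem_iUnion₂.2 ⟨c, Finset.mem_filter.2 ⟨hc, h⟩, hxc⟩)
  have h1 : (γ ∩ ⋃ c ∈ A.filter (R b), C c).Nonempty := by
    obtain ⟨x, hx, hxb⟩ := hne b hb
    exact ⟨x, hx, Set.mem_iUnion₂.2 ⟨b, Finset.mem_filter.2 ⟨hb, hR.refl b⟩, hxb⟩⟩
  have h2 : (γ ∩ ⋃ c ∈ A.filter (fun c => ¬ R b c), C c).Nonempty := by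
    obtain ⟨x, hx, hxb⟩ := hne b' hb'
    exact ⟨x, hx, Set.mem_iUnion₂.2 ⟨b', Finset.mem_filter.2 ⟨hb', hcon⟩, hxb⟩⟩
  obtain ⟨y, hy, hy1, hy2⟩ := key hsub h1 h2
  obtain ⟨c, hc, hyc⟩ := Set.mem_iUnion₂.1 hy1
  obtain ⟨c', hc', hyc'⟩ := Set.mem_iUnion₂.1 hy2
  rw [Finset.mem_filter] at hc hc'
  exact hc'.2 (hR.trans hc.2 (hstep c hc.1 c' hc'.1 y hy hyc hyc'))

section

/-! ### Comparing two coloured point sets in the plane -/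

/-- The geometric relation between two coloured point sets in the plane, the first with sites `Z₁`
of which those in `B₁` are black, the second with black sites `B₂` and white sites `W₂`. In the
block around a *fixed* square, the second set is densely black. In the block around a *broken*
square, the first set is densely white. The remaining points of interest are common to both sets,
and no remaining white point is in degenerate position with respect to them. -/
structure Compares (a r ζ η : ℝ) (K : ℕ) (B₁ Z₁ B₂ W₂ : Set ℂ) (fixed broken : Set (ℤ × ℤ)) :
    Prop where
  subset : B₁ ⊆ Z₁
  finite_black : ∀ x ρ, (B₁ ∩ Metric.closedBall x ρ).Finite
  finite_white : ∀ x ρ, (W₂ ∩ Metric.closedBall x ρ).Finite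
  close : ∀ x, ∃ z ∈ Z₁, dist x z ≤ r
  black_of_fixed : ∀ t ∈ fixed, ∀ z, InBlock z t → ∃ v ∈ B₂, gridIdx a v = z
  white_of_fixed : ∀ t ∈ fixed, ∀ w ∈ W₂, ¬ InBlock (gridIdx a w) t
  site_of_broken : ∀ t ∈ broken, ∀ z, InBlock z t → ∃ v ∈ Z₁, gridIdx a v = z
  black_of_broken : ∀ t ∈ broken, ∀ b ∈ B₁, ¬ InBlock (gridIdx a b) t
  black : ∀ b ∈ B₁, gridIdx a b ∈ fixed ∨ b ∈ B₂
  white : ∀ w ∈ W₂, gridIdx a w ∈ broken ∨ w ∈ Z₁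
  disjoint : Disjoint B₂ W₂
  nondegenerate : ∀ w' ∈ W₂, gridIdx a w' ∉ broken →
    ∀ b ∈ B₁, gridIdx a b ∉ fixed → dist b w' ≤ 5 * r →
    ∀ b' ∈ B₁, gridIdx a b' ∉ fixed → dist b' w' ≤ 5 * r →
    ∀ w, w = b' ∨ (w ∈ W₂ ∧ gridIdx a w ∉ broken ∧ w ≠ w' ∧ dist w w' ≤ 6 * r) →
      ¬ Degenerate ζ η K (b' - b) (w - b) (w' - b)

/-- The points that some site of `B` beats every site of `W` by `c`. -/
def leadSet (B W : Set ℂ) (c : ℝ) : Set ℂ := {x | ∃ b ∈ B, ∀ w ∈ W, dist x b + c ≤ dist x w}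

namespace Compares

variable {a r ζ η c : ℝ} {K : ℕ} {B₁ Z₁ B₂ W₂ : Set ℂ} {fixed broken : Set (ℤ × ℤ)}

/-- Near the first black region, a white point of the second set is a site of the first set, or it
is beaten by a margin. -/
lemma white_cases (h : Compares a r ζ η K B₁ Z₁ B₂ W₂ fixed broken) (ha : 0 < a) {x b w : ℂ}
    (hb : b ∈ B₁) (hx : ∀ z ∈ Z₁, dist x b ≤ dist x z) (hw : w ∈ W₂) :
    (gridIdx a w ∉ broken ∧ dist x b ≤ dist x w) ∨ dist x b + a / 2 ≤ dist x w := by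
  by_cases hbr : gridIdx a w ∈ broken
  · right
    obtain ⟨v, hv, -, hgain⟩ := exists_dense_gain ha x w (h.site_of_broken _ hbr)
    rcases hgain with hg | hg
    · linarith [hx v hv]
    · linarith [hx v hv, hg b (h.black_of_broken _ hbr b hb)]
  · exact Or.inl ⟨hbr, hx w ((h.white w hw).resolve_left hbr)⟩

/-- The whole cell of a black site of a fixed square is black in the second set, by a margin. -/
lemma fixed_gain (h : Compares a r ζ η K B₁ Z₁ B₂ W₂ fixed broken) (ha : 0 < a) {x b : ℂ}
    (hb : b ∈ B₁) (hx : ∀ z ∈ Z₁, dist x b ≤ dist x z) (hfix : gridIdx a b ∈ fixed) :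
    x ∈ leadSet B₂ W₂ (a / 2) := by
  obtain ⟨v, hv, -, hgain⟩ := exists_dense_gain ha x b (h.black_of_fixed _ hfix)
  refine ⟨v, hv, fun w hw => ?_⟩
  rcases hgain with hg | hg
  · rcases h.white_cases ha hb hx hw with ⟨-, h2⟩ | h2 <;> linarith
  · exact hg w (h.white_of_fixed _ hfix w hw)

/-- A white point that is not beaten by a margin is not close to the black site. -/
lemma sq_separation (h : Compares a r ζ η K B₁ Z₁ B₂ W₂ fixed broken) {b w : ℂ}
    (hb : b ∈ B₁) (hfix : gridIdx a b ∉ fixed) (hw : w ∈ W₂) (hbr : gridIdx a w ∉ broken)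
    (hd : dist b w ≤ 5 * r) : η ≤ ‖w - b‖ ^ 2 := by
  have := h.nondegenerate w hw hbr b hb hfix hd b hb hfix hd b (Or.inl rfl)
  simp only [Degenerate, not_exists, not_and, not_lt, sub_self] at this
  -- For `b' = b` the bisector degenerates to the point `b`, where the distance to `b` is zero.
  have h0 := this (Sum.inr 0) (by simp [criticalIndices])
  simp only [bisPt, zero_div, mul_zero, add_zero, zero_sub, norm_neg, norm_zero, ne_eq,
    OfNat.ofNat_ne_zero, not_false_eq_true, zero_pow, sub_zero] at h0
  exact h0 (by positivity)

/-- Two adjacent black sites outside the fixed squares are joined through a point, near a given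
common point of their cells, at which both have a lead. -/
lemma exists_lead_of_adjacent (h : Compares a r ζ η K B₁ Z₁ B₂ W₂ fixed broken) (ha : 0 < a)
    (hc : 0 ≤ c) (hca : c ≤ a / 8) (hζ : 0 < ζ) (hζa : ζ ≤ a / 16) (har : a ≤ r)
    (hcη : c * (4 * r + c) ≤ η) (hK : r / ζ + 1 ≤ K) {b b' y : ℂ}
    (hb : b ∈ B₁) (hb' : b' ∈ B₁) (hf : gridIdx a b ∉ fixed) (hf' : gridIdx a b' ∉ fixed)
    (hbb : b ≠ b') (hy : ∀ z ∈ Z₁, dist y b ≤ dist y z) (hy' : ∀ z ∈ Z₁, dist y b' ≤ dist y z)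
    (hyr : dist y b ≤ r) :
    ∃ y', dist y' y ≤ ζ ∧ dist y' b = dist y' b' ∧ ∀ w ∈ W₂, dist y' b + c ≤ dist y' w := by
  classical
  have heq : dist y b = dist y b' := le_antisymm (hy _ (h.subset hb')) (hy' _ (h.subset hb))
  -- The white points that matter, seen from `b`.
  have hfin : {w | w ∈ W₂ ∧ gridIdx a w ∉ broken ∧ dist w y ≤ 3 * r}.Finite :=
    (h.finite_white y (3 * r)).subset fun w hw => ⟨hw.1, hw.2.2⟩
  set S : Finset ℂ := hfin.toFinset.image fun w => w - b with hS
  have hmemS : ∀ e ∈ S, ∃ w, w ∈ W₂ ∧ gridIdx a w ∉ broken ∧ dist w y ≤ 3 * r ∧ e = w - b := by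
    intro e he
    obtain ⟨w, hw, rfl⟩ := Finset.mem_image.1 he
    rw [Set.Finite.mem_toFinset] at hw
    exact ⟨w, hw.1, hw.2.1, hw.2.2, rfl⟩
  have hyb : ‖y - b‖ = dist y b := (Complex.dist_eq _ _).symm
  have hyb' : ‖y - b - (b' - b)‖ = dist y b' := by rw [Complex.dist_eq]; congr 1; ring
  obtain ⟨u, hu1, hu2, hu3⟩ := exists_bisector_gap (ζ := ζ) (η := η) (r := r) (K := K)
    (d := b' - b) (y := y - b) hζ hK (sub_ne_zero.2 hbb.symm) (by rw [hyb, hyb', heq])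
    (by rw [hyb]; exact hyr) S
    (by
      intro e he
      obtain ⟨w, hw, hbr, -, rfl⟩ := hmemS e he
      have : ‖y - b - (w - b)‖ = dist y w := by rw [Complex.dist_eq]; congr 1; ring
      rw [hyb, this]
      exact hy w ((h.white w hw).resolve_left hbr))
    (by
      intro e' he' e he hne
      obtain ⟨w', hw', hbr', hd', rfl⟩ := hmemS e' he'
      have d1 : dist b w' ≤ 5 * r := by
        have := dist_triangle4 b y y w'
        rw [dist_comm b y, dist_self, dist_comm y w'] at this; linarith
      have d2 : dist b' w' ≤ 5 * r := by
        have := dist_triangle4 b' y y w'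
        rw [dist_comm b' y, dist_self, dist_comm y w'] at this; linarith
      rcases Finset.mem_insert.1 he with rfl | he
      · exact h.nondegenerate w' hw' hbr' b hb hf d1 b' hb' hf' d2 b' (Or.inl rfl)
      · obtain ⟨w, hw, hbr, hd, rfl⟩ := hmemS e he
        refine h.nondegenerate w' hw' hbr' b hb hf d1 b' hb' hf' d2 w
          (Or.inr ⟨hw, hbr, fun hh => hne (by rw [hh]), ?_⟩)
        have := dist_triangle w y w'
        rw [dist_comm y w'] at this; linarith)
    (by
      intro hmem
      obtain ⟨w, hw, hbr, -, heq'⟩ := hmemS _ hmem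
      have hwb : b' = w := by linear_combination heq'
      subst hwb
      exact Set.disjoint_left.1 h.disjoint ((h.black _ hb').resolve_left hf') hw)
  have e1 : ∀ w, dist (u + b) w = ‖u - (w - b)‖ := by
    intro w; rw [Complex.dist_eq]; congr 1; ring
  have hd : dist (u + b) y ≤ ζ := by
    rw [e1]; rw [norm_sub_rev] at hu1 ⊢; exact hu1
  have hub : dist (u + b) b = ‖u‖ := by rw [e1]; simp
  have hur : dist (u + b) b ≤ 2 * r := by
    have := dist_triangle (u + b) y b; linarith
  refine ⟨u + b, hd, by rw [hub, e1, hu2], fun w hw => ?_⟩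
  have t1 := dist_triangle (u + b) y b
  have t2 := dist_triangle y (u + b) w
  rw [dist_comm y (u + b)] at t2
  rcases h.white_cases ha hb hy hw with ⟨hbr, -⟩ | hlead
  · by_cases hnear : dist w y ≤ 3 * r
    · have hmem : w - b ∈ S := Finset.mem_image.2 ⟨w, by
        rw [Set.Finite.mem_toFinset]; exact ⟨hw, hbr, hnear⟩, rfl⟩
      have h3 := hu3 _ hmem
      rw [← e1, ← hub] at h3
      refine add_le_of_sq_add_le (R := 2 * r) dist_nonneg hur hc ?_ h3
      linarith
    · push Not at hnear
      rw [dist_comm] at hnear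
      linarith
  · linarith

/-- A black site adjacent to the region where the second set is black by a margin is joined to
it. -/
lemma joined_of_lead (h : Compares a r ζ η K B₁ Z₁ B₂ W₂ fixed broken) (ha : 0 < a)
    (hc : 0 ≤ c) (hca : c ≤ a / 8) (har : a ≤ r)
    (hcη : c * (4 * r + c) * (8 * r) ≤ η * a) {b y : ℂ}
    (hb : b ∈ B₁) (hf : gridIdx a b ∉ fixed) (hy : ∀ z ∈ Z₁, dist y b ≤ dist y z)
    (hyr : dist y b ≤ r) (hlead : y ∈ leadSet B₂ W₂ (a / 2)) :
    PolyJoined (leadSet B₂ W₂ c ∩ Metric.closedBall y r) y b := by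
  obtain ⟨v, hv, hvw⟩ := hlead
  have hr : 0 < r := ha.trans_le har
  have hnear : ∀ x, dist x y ≤ a / 8 → x ∈ leadSet B₂ W₂ c := by
    intro x hx
    refine ⟨v, hv, fun w hw => ?_⟩
    have t1 := dist_triangle x y v
    have t2 := dist_triangle y x w
    rw [dist_comm y x] at t2
    linarith [hvw w hw]
  have hball : ∀ x z, x ∈ Metric.closedBall y r → z ∈ Metric.closedBall y r →
      segment ℝ x z ⊆ Metric.closedBall y r := fun x z hx hz =>
    (convex_closedBall y r).segment_subset hx hz
  have hyy : y ∈ Metric.closedBall y r := Metric.mem_closedBall_self hr.le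
  have hby : b ∈ Metric.closedBall y r := by rw [Metric.mem_closedBall, dist_comm]; exact hyr
  have hbB : b ∈ B₂ := (h.black b hb).resolve_left hf
  -- Up to distance `a / 8` from `y` the lead at `y` suffices; beyond, `b` itself has a lead.
  by_cases hclose : dist y b ≤ a / 8
  · refine PolyJoined.of_segment fun x hx => ⟨hnear x ?_, hball _ _ hyy hby hx⟩
    have := dist_add_dist_of_mem_segment hx
    rw [dist_comm]
    linarith [dist_nonneg (x := x) (y := b)]
  · push Not at hclose
    have hpos : 0 < dist y b := by linarith
    set θ : ℝ := a / 8 / dist y b with hθ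
    have hθ0 : 0 ≤ θ := by positivity
    have hθ1 : θ ≤ 1 := by rw [hθ, div_le_one hpos]; exact hclose.le
    set x : ℂ := y + θ * (b - y) with hx
    have hxy : dist x y = a / 8 := by
      rw [Complex.dist_eq, hx, add_sub_cancel_left, norm_mul, Complex.norm_real, Real.norm_eq_abs,
        abs_of_nonneg hθ0, ← Complex.dist_eq, dist_comm, hθ]
      field_simp
    have hxb : dist x b ≤ r := by
      have : x - b = ((1 - θ : ℝ) : ℂ) * (y - b) := by rw [hx]; push_cast; ring
      rw [Complex.dist_eq, this, norm_mul, Complex.norm_real, Real.norm_eq_abs,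
        abs_of_nonneg (by linarith), ← Complex.dist_eq]
      nlinarith
    have hxball : x ∈ Metric.closedBall y r := by rw [Metric.mem_closedBall, hxy]; linarith
    have hxlead : ∀ w ∈ W₂, dist x b + c ≤ dist x w := by
      intro w hw
      have t2 := dist_triangle y x w
      rw [dist_comm y x] at t2
      have hxb' : dist x b = dist y b - a / 8 := by
        have : x - b = ((1 - θ : ℝ) : ℂ) * (y - b) := by rw [hx]; push_cast; ring
        rw [Complex.dist_eq, this, norm_mul, Complex.norm_real, Real.norm_eq_abs,
          abs_of_nonneg (by linarith), ← Complex.dist_eq, hθ]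
        field_simp
      rcases h.white_cases ha hb hy hw with ⟨hbr, hle⟩ | hl
      · by_cases hd : dist b w ≤ 5 * r
        · have hs := h.sq_separation hb hf hw hbr hd
          have h3 := sq_add_le_of_lineMap hθ0 hθ1 hle hs
          rw [← hx] at h3
          refine add_le_of_sq_add_le (R := 2 * r) dist_nonneg (by linarith) hc ?_ h3
          have hη : 0 ≤ η * a := le_trans (by positivity) hcη
          have hη' : 0 ≤ η := nonneg_of_mul_nonneg_left hη ha
          have h4 : a / 8 / r ≤ θ := by rw [hθ]; gcongr
          calc c * (2 * (2 * r) + c) = c * (4 * r + c) * (8 * r) / (8 * r) := by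
                field_simp; ring
            _ ≤ η * a / (8 * r) := by gcongr
            _ = a / 8 / r * η := by field_simp
            _ ≤ θ * η := by gcongr
        · push Not at hd
          have t3 := dist_triangle b x w
          rw [dist_comm b x] at t3
          linarith
      · linarith
    refine Relation.ReflTransGen.tail (b := x) (PolyJoined.of_segment fun u hu =>
      ⟨hnear u ?_, hball _ _ hyy hxball hu⟩) fun u hu =>
      ⟨⟨b, hbB, fun w hw => add_le_of_mem_segment (hxlead w hw) hu⟩, hball _ _ hxball hby hu⟩
    have := dist_add_dist_of_mem_segment hu
    rw [dist_comm y x, hxy] at this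
    rw [dist_comm]
    linarith [dist_nonneg (x := u) (y := x)]

/-- A cell of a black site of a fixed square is star-shaped and black in the second set. -/
lemma joined_of_fixed (h : Compares a r ζ η K B₁ Z₁ B₂ W₂ fixed broken) (ha : 0 < a)
    (hca : c ≤ a / 2) {b y : ℂ} (hr : 0 ≤ r)
    (hb : b ∈ B₁) (hf : gridIdx a b ∈ fixed) (hy : ∀ z ∈ Z₁, dist y b ≤ dist y z)
    (hyr : dist y b ≤ r) :
    PolyJoined (leadSet B₂ W₂ c ∩ Metric.closedBall y r) y b := by
  refine PolyJoined.of_segment fun x hx => ⟨?_, ?_⟩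
  · obtain ⟨v, hv, hvw⟩ := h.fixed_gain ha (x := x) hb (fun z hz => by
      simpa using add_le_of_mem_segment (c := 0) (by simpa using hy z hz) hx) hf
    exact ⟨v, hv, fun w hw => by linarith [hvw w hw]⟩
  · refine (convex_closedBall y r).segment_subset (Metric.mem_closedBall_self hr) ?_ hx
    rw [Metric.mem_closedBall, dist_comm]; exact hyr

/-- Two black sites whose cells have a common point are joined, near it, inside the region where
the second set is robustly black. -/
lemma joined_of_adjacent (h : Compares a r ζ η K B₁ Z₁ B₂ W₂ fixed broken) (ha : 0 < a)
    (hc : 0 ≤ c) (hca : c ≤ a / 8) (hζ : 0 < ζ) (hζa : ζ ≤ a / 16) (har : a ≤ r)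
    (hcη : c * (4 * r + c) * (8 * r) ≤ η * a) (hK : r / ζ + 1 ≤ K) {b b' y : ℂ}
    (hb : b ∈ B₁) (hb' : b' ∈ B₁) (hy : ∀ z ∈ Z₁, dist y b ≤ dist y z)
    (hy' : ∀ z ∈ Z₁, dist y b' ≤ dist y z) :
    PolyJoined (leadSet B₂ W₂ c ∩ Metric.closedBall y r) b b' := by
  have hr : 0 < r := ha.trans_le har
  have hyr : dist y b ≤ r := by
    obtain ⟨z, hz, hzr⟩ := h.close y; exact (hy z hz).trans hzr
  have hyr' : dist y b' ≤ r := by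
    obtain ⟨z, hz, hzr⟩ := h.close y; exact (hy' z hz).trans hzr
  by_cases hbb : b = b'
  · subst hbb; exact Relation.ReflTransGen.refl
  by_cases hf : gridIdx a b ∈ fixed
  · refine (h.joined_of_fixed ha (by linarith) hr.le hb hf hy hyr).symm.trans ?_
    by_cases hf' : gridIdx a b' ∈ fixed
    · exact h.joined_of_fixed ha (by linarith) hr.le hb' hf' hy' hyr'
    · exact h.joined_of_lead ha hc hca har hcη hb' hf' hy' hyr' (h.fixed_gain ha hb hy hf)
  by_cases hf' : gridIdx a b' ∈ fixed
  · exact (h.joined_of_lead ha hc hca har hcη hb hf hy hyr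
      (h.fixed_gain ha hb' hy' hf')).symm.trans
        (h.joined_of_fixed ha (by linarith) hr.le hb' hf' hy' hyr')
  have hcη' : c * (4 * r + c) ≤ η := by
    have h1 : c * (4 * r + c) * a ≤ η * a := by
      refine le_trans ?_ hcη
      gcongr; linarith
    exact le_of_mul_le_mul_right h1 ha
  obtain ⟨y', h1, h2, h3⟩ := h.exists_lead_of_adjacent ha hc hca hζ hζa har hcη' hK hb hb' hf hf'
    hbb hy hy' hyr
  have hball : ∀ z, dist y z ≤ r → segment ℝ y' z ⊆ Metric.closedBall y r := fun z hz =>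
    (convex_closedBall y r).segment_subset (by rw [Metric.mem_closedBall]; linarith)
      (by rw [Metric.mem_closedBall, dist_comm]; exact hz)
  have j1 : PolyJoined (leadSet B₂ W₂ c ∩ Metric.closedBall y r) y' b :=
    PolyJoined.of_segment fun u hu => ⟨⟨b, (h.black b hb).resolve_left hf,
      fun w hw => add_le_of_mem_segment (h3 w hw) hu⟩, hball b hyr hu⟩
  have j2 : PolyJoined (leadSet B₂ W₂ c ∩ Metric.closedBall y r) y' b' :=
    PolyJoined.of_segment fun u hu => ⟨⟨b', (h.black b' hb').resolve_left hf',
      fun w hw => add_le_of_mem_segment (h2 ▸ h3 w hw) hu⟩, hball b' hyr' hu⟩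
  exact j1.symm.trans j2

/-- A black site lies in the region where the second set is robustly black. -/
lemma mem_leadSet (h : Compares a r ζ η K B₁ Z₁ B₂ W₂ fixed broken) (ha : 0 < a)
    (hc : 0 ≤ c) (hca : c ≤ a / 8) (har : a ≤ r)
    (hcη : c * (4 * r + c) * (8 * r) ≤ η * a) {b : ℂ}
    (hb : b ∈ B₁) : b ∈ leadSet B₂ W₂ c := by
  have hself : ∀ z ∈ Z₁, dist b b ≤ dist b z := by simp
  by_cases hf : gridIdx a b ∈ fixed
  · obtain ⟨v, hv, hvw⟩ := h.fixed_gain ha hb hself hf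
    exact ⟨v, hv, fun w hw => by linarith [hvw w hw]⟩
  · refine ⟨b, (h.black b hb).resolve_left hf, fun w hw => ?_⟩
    rcases h.white_cases ha hb hself hw with ⟨hbr, -⟩ | h2
    · by_cases hd : dist b w ≤ 5 * r
      · have hs := h.sq_separation hb hf hw hbr hd
        rw [← Complex.dist_eq, dist_comm] at hs
        have hr : 0 < r := ha.trans_le har
        refine add_le_of_sq_add_le (R := 2 * r) (η := η) dist_nonneg (by simp; linarith) hc ?_
          (by simpa using hs)
        have h1 : c * (4 * r + c) * a ≤ η * a := by
          refine le_trans ?_ hcη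
          gcongr; linarith
        have := le_of_mul_le_mul_right h1 ha
        linarith
      · simp only [dist_self]; linarith
    · linarith

/-- A compact connected set that is black in the first set is shadowed by a polygonal line that is
robustly black in the second set. -/
theorem exists_shadow (h : Compares a r ζ η K B₁ Z₁ B₂ W₂ fixed broken) (ha : 0 < a)
    (hc : 0 ≤ c) (hca : c ≤ a / 8) (hζ : 0 < ζ) (hζa : ζ ≤ a / 16) (har : a ≤ r)
    (hcη : c * (4 * r + c) * (8 * r) ≤ η * a) (hK : r / ζ + 1 ≤ K) {γ : Set ℂ}
    (hγ : IsCompact γ) (hγc : IsConnected γ)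
    (hblack : ∀ x ∈ γ, ∃ b ∈ B₁, ∀ z ∈ Z₁, dist x b ≤ dist x z) :
    ∃ (N : ℕ) (p : ℕ → ℂ),
      (∀ i < N + 1, ∀ y ∈ segment ℝ (p i) (p (i + 1)),
        y ∈ leadSet B₂ W₂ c ∧ ∃ x ∈ γ, dist y x ≤ r) ∧
      ∀ x ∈ γ, ∃ i ≤ N + 1, dist x (p i) ≤ r := by
  classical
  have hr : 0 < r := ha.trans_le har
  set G : Set ℂ := leadSet B₂ W₂ c ∩ {y | ∃ x ∈ γ, dist y x ≤ r} with hG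
  set C : ℂ → Set ℂ := fun b => {x | ∀ z ∈ Z₁, dist x b ≤ dist x z} with hC
  have hCr : ∀ b, ∀ x ∈ C b, dist x b ≤ r := fun b x hx => by
    obtain ⟨z, hz, hzr⟩ := h.close x; exact (hx z hz).trans hzr
  obtain ⟨ρ, hρ⟩ := hγ.isBounded.subset_closedBall 0
  have hfin : {b | b ∈ B₁ ∧ (γ ∩ C b).Nonempty}.Finite := by
    refine (h.finite_black 0 (ρ + r)).subset ?_
    rintro b ⟨hb, x, hx, hxb⟩
    refine ⟨hb, ?_⟩
    have h1 := hCr b x hxb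
    have h2 : dist x 0 ≤ ρ := hρ hx
    have h3 := dist_triangle b x 0
    rw [dist_comm b x] at h3
    rw [Metric.mem_closedBall]; linarith
  set A := hfin.toFinset with hA
  have hmemA : ∀ b ∈ A, b ∈ B₁ ∧ (γ ∩ C b).Nonempty := fun b hb => by
    rwa [hA, Set.Finite.mem_toFinset] at hb
  have hmono : ∀ y ∈ γ, leadSet B₂ W₂ c ∩ Metric.closedBall y r ⊆ G := fun y hy x hx =>
    ⟨hx.1, y, hy, hx.2⟩
  have hlink := linked_of_isPreconnected A C
    (fun b _ => by
      have : C b = ⋂ z ∈ Z₁, {x | dist x b ≤ dist x z} := by ext; simp [hC]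
      rw [this]
      exact isClosed_biInter fun z _ => isClosed_le (by fun_prop) (by fun_prop))
    hγc.isPreconnected
    (fun x hx => by
      obtain ⟨b, hb, hxb⟩ := hblack x hx
      exact Set.mem_iUnion₂.2 ⟨b, by rw [hA, Set.Finite.mem_toFinset]; exact ⟨hb, x, hx, hxb⟩, hxb⟩)
    (fun b hb => (hmemA b hb).2) (PolyJoined G)
    ⟨fun _ => Relation.ReflTransGen.refl, PolyJoined.symm, Relation.ReflTransGen.trans⟩
    (fun b hb b' hb' y hy h1 h2 => by
      refine PolyJoined.mono (hmono y hy)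
        (h.joined_of_adjacent ha hc hca hζ hζa har hcη hK (hmemA b hb).1 (hmemA b' hb').1 h1 h2))
  obtain ⟨x₀, hx₀⟩ := hγc.nonempty
  obtain ⟨b₀, hb₀, hxb₀⟩ := hblack x₀ hx₀
  have hb₀A : b₀ ∈ A := by rw [hA, Set.Finite.mem_toFinset]; exact ⟨hb₀, x₀, hx₀, hxb₀⟩
  have hb₀G : b₀ ∈ G := ⟨h.mem_leadSet ha hc hca har hcη hb₀, x₀, hx₀, by
    rw [dist_comm]; exact hCr _ _ hxb₀⟩
  obtain ⟨N, p, hp, hvis⟩ := exists_polyline_visiting hb₀G A (hlink b₀ hb₀A)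
  refine ⟨N, p, fun i hi y hy => hp i hi hy, fun x hx => ?_⟩
  obtain ⟨b, hb, hxb⟩ := hblack x hx
  obtain ⟨i, hi, rfl⟩ := hvis b (by
    rw [hA, Set.Finite.mem_toFinset]; exact ⟨hb, x, hx, hxb⟩)
  exact ⟨i, hi, hCr _ _ hxb⟩

end Compares

end

/-! ### The configuration space -/

/-- The number of ordinary points of a cell, and a sequence from which their positions in the unit
square are read off. -/
abbrev OrdPart : Type := ℕ × (ℕ → ℝ × ℝ)

/-- The remaining data of a cell: the number of extra points, a sequence from which their positions
are read off, a sequence from which the marks of the ordinary points are read off, and a label. -/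
abbrev FreePart : Type := ℕ × (ℕ → ℝ × ℝ) × (ℕ → Fin 3) × (Fin 9 × Fin 9)

/-- The data of a cell of the torus. A point of mark `0` is black and a point of mark `1` is white,
in either colouring; a point of mark `2` is white in the first colouring and black in the second.
Extra points count as points of mark `2`. -/
abbrev CellState : Type := OrdPart × FreePart

/-- The cells of the torus, cut into `n × n` squares. -/
abbrev Tile (n : ℕ) : Type := ZMod n × ZMod n

/-- A configuration: the data of all cells. -/
abbrev Conf (n : ℕ) : Type := Tile n → CellState

namespace CellState

/-- The number of ordinary points. -/
def num (q : CellState) : ℕ := q.1.1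
/-- The positions of the ordinary points. -/
def pos (q : CellState) : ℕ → ℝ × ℝ := q.1.2
/-- The number of extra points. -/
def xnum (q : CellState) : ℕ := q.2.1
/-- The positions of the extra points. -/
def xpos (q : CellState) : ℕ → ℝ × ℝ := q.2.2.1
/-- The marks of the ordinary points. -/
def mark (q : CellState) : ℕ → Fin 3 := q.2.2.2.1
/-- The label. -/
def label (q : CellState) : Fin 9 × Fin 9 := q.2.2.2.2

@[fun_prop] lemma measurable_num : Measurable num := by unfold num; fun_prop
@[fun_prop] lemma measurable_pos : Measurable pos := by unfold pos; fun_prop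
@[fun_prop] lemma measurable_xnum : Measurable xnum := by unfold xnum; fun_prop
@[fun_prop] lemma measurable_xpos : Measurable xpos := by unfold xpos; fun_prop
@[fun_prop] lemma measurable_mark : Measurable mark := by unfold mark; fun_prop
@[fun_prop] lemma measurable_label : Measurable label := by unfold label; fun_prop

end CellState

/-- The uniform distribution on the unit square. -/
def unitSq : Measure (ℝ × ℝ) := volume.restrict (Set.Ico 0 1 ×ˢ Set.Ico 0 1)

instance : IsProbabilityMeasure unitSq := ⟨by
  rw [unitSq, Measure.restrict_apply_univ, Measure.volume_eq_prod, Measure.prod_prod]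
  simp⟩

/-- The law of the ordinary points of a cell. -/
def ordLaw (l : NNReal) : Measure OrdPart :=
  (poissonMeasure l).prod (Measure.infinitePi fun _ : ℕ => unitSq)

/-- The law of the remaining data of a cell. -/
def freeLaw (l : NNReal) (ν : Measure (Fin 3)) : Measure FreePart :=
  (poissonMeasure l).prod ((Measure.infinitePi fun _ : ℕ => unitSq).prod
    ((Measure.infinitePi fun _ : ℕ => ν).prod (uniformOn Set.univ)))

/-- The law of the data of a cell, with intensities `l` and `l'` of the ordinary and the extra
points, and with marks distributed according to `ν`. -/
def cellLaw (l l' : NNReal) (ν : Measure (Fin 3)) : Measure CellState :=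
  (ordLaw l).prod (freeLaw l' ν)

/-- The law of a configuration: the cells are independent. -/
def confLaw (n : ℕ) [NeZero n] (l l' : NNReal) (ν : Measure (Fin 3)) : Measure (Conf n) :=
  Measure.pi fun _ => cellLaw l l' ν

instance (l : NNReal) : IsProbabilityMeasure (ordLaw l) := by unfold ordLaw; infer_instance
instance : IsProbabilityMeasure (uniformOn (Set.univ : Set (Fin 9 × Fin 9))) :=
  isProbabilityMeasure_uniformOn Set.finite_univ Set.univ_nonempty
instance (l : NNReal) (ν : Measure (Fin 3)) [IsProbabilityMeasure ν] :
    IsProbabilityMeasure (freeLaw l ν) := by unfold freeLaw; infer_instance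
instance (l l' : NNReal) (ν : Measure (Fin 3)) [IsProbabilityMeasure ν] :
    IsProbabilityMeasure (cellLaw l l' ν) := by unfold cellLaw; infer_instance
instance (n : ℕ) [NeZero n] (l l' : NNReal) (ν : Measure (Fin 3)) [IsProbabilityMeasure ν] :
    IsProbabilityMeasure (confLaw n l l' ν) := by unfold confLaw; infer_instance

/-! ### Poisson counts -/

lemma integral_prod_range_infinitePi {E : Type*} [MeasurableSpace E] (ν : Measure E)
    [IsProbabilityMeasure ν] (n : ℕ) (f : ℕ → E → ℂ) (hf : ∀ i, Measurable (f i)) :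
    ∫ x, ∏ i ∈ Finset.range n, f i (x i) ∂(Measure.infinitePi fun _ : ℕ => ν) =
      ∏ i ∈ Finset.range n, ∫ u, f i u ∂ν := by
  have h := integral_restrict_infinitePi (μ := fun _ : ℕ => ν) (s := Finset.range n)
    (f := fun x => ∏ i : Finset.range n, f i (x i))
    (Measurable.aestronglyMeasurable (Finset.measurable_prod _ fun i _ =>
      (hf i).comp (measurable_pi_apply i)))
  rw [integral_fintype_prod_eq_prod (fun (i : Finset.range n) => f i)] at h
  rw [← Finset.prod_coe_sort (Finset.range n) (fun i => ∫ u, f i u ∂ν), ← h]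
  refine integral_congr_ae (ae_of_all _ fun x => ?_)
  exact (Finset.prod_coe_sort (Finset.range n) (fun i => f i (x i))).symm

lemma integral_pow_poissonMeasure (r : NNReal) (z : ℂ) :
    ∫ n, z ^ n ∂(poissonMeasure r) = Complex.exp (r * (z - 1)) := by
  rw [integral_poissonMeasure]
  calc ∑' n : ℕ, (Real.exp (-r) * r ^ n / n.factorial) • z ^ n
      = ∑' n : ℕ, (Real.exp (-r) : ℂ) * ((r * z) ^ n / n.factorial) := by
        congr with n
        rw [Complex.real_smul]; push_cast; rw [mul_pow]; ring
    _ = (Real.exp (-r) : ℂ) * ∑' n : ℕ, ((r * z) ^ n / n.factorial) := tsum_mul_left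
    _ = (Real.exp (-r) : ℂ) * Complex.exp (r * z) := by
        rw [(NormedSpace.expSeries_div_hasSum_exp (r * z : ℂ)).tsum_eq, Complex.exp_eq_exp_ℂ]
    _ = _ := by
        rw [Complex.ofReal_exp, ← Complex.exp_add]; push_cast; ring_nf

lemma measurable_prod_range {α β : Type*} [MeasurableSpace α] [CommMonoid β] [MeasurableSpace β]
    [MeasurableMul₂ β] {N : α → ℕ} (hN : Measurable N) {f : ℕ → α → β}
    (hf : ∀ i, Measurable (f i)) : Measurable fun x => ∏ i ∈ Finset.range (N x), f i x := by
  have h : Measurable fun p : ℕ × α => ∏ i ∈ Finset.range p.1, f i p.2 :=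
    measurable_from_prod_countable_right fun n =>
      Finset.measurable_prod (Finset.range n) fun i _ => hf i
  exact h.comp (hN.prodMk measurable_id)

lemma measurable_sum_range {α β : Type*} [MeasurableSpace α] [AddCommMonoid β] [MeasurableSpace β]
    [MeasurableAdd₂ β] {N : α → ℕ} (hN : Measurable N) {f : ℕ → α → β}
    (hf : ∀ i, Measurable (f i)) : Measurable fun x => ∑ i ∈ Finset.range (N x), f i x := by
  have h : Measurable fun p : ℕ × α => ∑ i ∈ Finset.range p.1, f i p.2 :=
    measurable_from_prod_countable_right fun n =>
      Finset.measurable_sum (Finset.range n) fun i _ => hf i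
  exact h.comp (hN.prodMk measurable_id)

lemma norm_prod_range_le_one {N : ℕ} {f : ℕ → ℂ} (hf : ∀ i, ‖f i‖ ≤ 1) :
    ‖∏ i ∈ Finset.range N, f i‖ ≤ 1 := by
  rw [norm_prod]
  exact Finset.prod_le_one (fun _ _ => norm_nonneg _) fun i _ => hf i

/-- The generating functional of a marked Poisson process in one cell. -/
lemma integral_cellLaw (l l' : NNReal) (ν : Measure (Fin 3)) [IsProbabilityMeasure ν]
    (φ : (ℝ × ℝ) × Fin 3 → ℂ) (hφ : Measurable φ) (hφ1 : ∀ x, ‖φ x‖ ≤ 1) :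
    ∫ q, (∏ i ∈ Finset.range q.num, φ (q.pos i, q.mark i)) *
        ∏ i ∈ Finset.range q.xnum, φ (q.xpos i, 2) ∂(cellLaw l l' ν) =
      Complex.exp (l * (∫ x, φ x ∂(unitSq.prod ν) - 1) +
        l' * (∫ o, φ (o, 2) ∂unitSq - 1)) := by
  have hbound : ∀ q : CellState, ‖(∏ i ∈ Finset.range q.num, φ (q.pos i, q.mark i)) *
        ∏ i ∈ Finset.range q.xnum, φ (q.xpos i, 2)‖ ≤ 1 := fun q => by
    rw [norm_mul]
    exact mul_le_one₀ (norm_prod_range_le_one fun i => hφ1 _) (norm_nonneg _)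
      (norm_prod_range_le_one fun i => hφ1 _)
  have hint : Integrable (fun q : CellState =>
      (∏ i ∈ Finset.range q.num, φ (q.pos i, q.mark i)) *
        ∏ i ∈ Finset.range q.xnum, φ (q.xpos i, 2)) (cellLaw l l' ν) := by
    refine Integrable.of_bound (Measurable.aestronglyMeasurable ?_) 1 (ae_of_all _ hbound)
    exact (measurable_prod_range (by fun_prop) fun i => by fun_prop).mul
      (measurable_prod_range (by fun_prop) fun i => by fun_prop)
  have hφi : Integrable φ (unitSq.prod ν) :=
    Integrable.of_bound hφ.aestronglyMeasurable 1 (ae_of_all _ hφ1)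
  rw [cellLaw, integral_prod _ hint]
  have hinner : ∀ o : OrdPart, ∫ f : FreePart,
      (∏ i ∈ Finset.range o.1, φ (o.2 i, f.2.2.1 i)) *
        ∏ i ∈ Finset.range f.1, φ (f.2.1 i, 2) ∂(freeLaw l' ν) =
      (∏ i ∈ Finset.range o.1, ∫ m, φ (o.2 i, m) ∂ν) *
        Complex.exp (l' * (∫ o, φ (o, 2) ∂unitSq - 1)) := by
    intro o
    have hm1 : Measurable fun f : FreePart => ∏ i ∈ Finset.range f.1, φ (f.2.1 i, 2) :=
      measurable_prod_range (by fun_prop) fun i => by fun_prop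
    have hm2 : Measurable fun f : FreePart => ∏ i ∈ Finset.range o.1, φ (o.2 i, f.2.2.1 i) :=
      Finset.measurable_prod _ fun i _ => by fun_prop
    have hi : Integrable (fun f : FreePart =>
        (∏ i ∈ Finset.range o.1, φ (o.2 i, f.2.2.1 i)) *
        ∏ i ∈ Finset.range f.1, φ (f.2.1 i, 2)) (freeLaw l' ν) := by
      refine Integrable.of_bound (hm2.mul hm1).aestronglyMeasurable 1 (ae_of_all _ fun f => ?_)
      rw [norm_mul]
      exact mul_le_one₀ (norm_prod_range_le_one fun i => hφ1 _) (norm_nonneg _)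
        (norm_prod_range_le_one fun i => hφ1 _)
    rw [freeLaw, integral_prod _ hi]
    simp only
    have h1 : ∀ n : ℕ, ∫ g : (ℕ → ℝ × ℝ) × (ℕ → Fin 3) × (Fin 9 × Fin 9),
        (∏ i ∈ Finset.range o.1, φ (o.2 i, g.2.1 i)) *
        ∏ i ∈ Finset.range n, φ (g.1 i, 2) ∂((Measure.infinitePi fun _ : ℕ => unitSq).prod
    ((Measure.infinitePi fun _ : ℕ => ν).prod (uniformOn Set.univ))) =
        (∏ i ∈ Finset.range o.1, ∫ m, φ (o.2 i, m) ∂ν) * (∫ o, φ (o, 2) ∂unitSq) ^ n := by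
      intro n
      have e := integral_prod_mul (μ := Measure.infinitePi fun _ : ℕ => unitSq)
        (ν := (Measure.infinitePi fun _ : ℕ => ν).prod
          (uniformOn (Set.univ : Set (Fin 9 × Fin 9))))
        (fun x : ℕ → ℝ × ℝ => ∏ i ∈ Finset.range n, φ (x i, 2))
        (fun g : (ℕ → Fin 3) × (Fin 9 × Fin 9) => ∏ i ∈ Finset.range o.1, φ (o.2 i, g.1 i))
      have e2 := integral_prod_mul (μ := Measure.infinitePi fun _ : ℕ => ν)
        (ν := uniformOn (Set.univ : Set (Fin 9 × Fin 9)))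
        (fun x : ℕ → Fin 3 => ∏ i ∈ Finset.range o.1, φ (o.2 i, x i)) (fun _ => (1 : ℂ))
      simp only [mul_one] at e2
      rw [e2] at e
      simp_rw [mul_comm (∏ i ∈ Finset.range o.1, _)]
      rw [e, integral_prod_range_infinitePi unitSq n (fun _ o => φ (o, 2)) (fun i => by fun_prop),
        integral_prod_range_infinitePi ν o.1 (fun i m => φ (o.2 i, m)) (fun i => by fun_prop)]
      simp [mul_comm]
    simp_rw [h1]
    rw [integral_const_mul, integral_pow_poissonMeasure]
  have hcong : ∀ o : OrdPart, ∫ f : FreePart,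
      (∏ i ∈ Finset.range (CellState.num (o, f)),
        φ (CellState.pos (o, f) i, CellState.mark (o, f) i)) *
        ∏ i ∈ Finset.range (CellState.xnum (o, f)), φ (CellState.xpos (o, f) i, 2)
          ∂(freeLaw l' ν) =
      (∏ i ∈ Finset.range o.1, ∫ m, φ (o.2 i, m) ∂ν) *
        Complex.exp (l' * (∫ o, φ (o, 2) ∂unitSq - 1)) := hinner
  simp_rw [hcong]
  rw [integral_mul_const]
  have hmm : Measurable fun o : ℝ × ℝ => ∫ m, φ (o, m) ∂ν :=
    (StronglyMeasurable.integral_prod_right (ν := ν) (f := fun o m => φ (o, m))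
      hφ.stronglyMeasurable).measurable
  have hmi : Integrable (fun o : OrdPart => ∏ i ∈ Finset.range o.1, ∫ m, φ (o.2 i, m) ∂ν)
      (ordLaw l) := by
    refine Integrable.of_bound (Measurable.aestronglyMeasurable ?_) 1 (ae_of_all _ fun o => ?_)
    · exact measurable_prod_range (by fun_prop) fun i => hmm.comp (by fun_prop)
    · refine norm_prod_range_le_one fun i => ?_
      refine (norm_integral_le_of_norm_le_const (ae_of_all _ fun m => hφ1 _)).trans ?_
      simp
  rw [ordLaw, integral_prod _ hmi]
  simp only
  simp_rw [integral_prod_range_infinitePi unitSq _ (fun _ o => ∫ m, φ (o, m) ∂ν) (fun _ => hmm)]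
  simp only [Finset.prod_const, Finset.card_range]
  rw [integral_pow_poissonMeasure, ← integral_prod _ hφi, Complex.exp_add]

/-- The number of points of a configuration with prescribed positions and marks. -/
def ptCount {n : ℕ} [NeZero n] (S : Tile n → Set ((ℝ × ℝ) × Fin 3)) (ω : Conf n) : ℕ :=
  ∑ c, ((∑ i ∈ Finset.range (ω c).num, (S c).indicator 1 ((ω c).pos i, (ω c).mark i)) +
    ∑ i ∈ Finset.range (ω c).xnum, (S c).indicator 1 ((ω c).xpos i, 2))

lemma measurable_ptCount {n : ℕ} [NeZero n] {S : Tile n → Set ((ℝ × ℝ) × Fin 3)}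
    (hS : ∀ c, MeasurableSet (S c)) : Measurable (ptCount S) := by
  unfold ptCount
  refine Finset.measurable_sum _ fun c _ => Measurable.add ?_ ?_
  · exact measurable_sum_range (by fun_prop) fun i =>
      (measurable_one.indicator (hS c)).comp (by fun_prop)
  · exact measurable_sum_range (by fun_prop) fun i =>
      (measurable_one.indicator (hS c)).comp (by fun_prop)

/-- The mean of `ptCount`. -/
def ptMean {n : ℕ} [NeZero n] (l l' : NNReal) (ν : Measure (Fin 3))
    (S : Tile n → Set ((ℝ × ℝ) × Fin 3)) : NNReal :=
  ∑ c, (l * ((unitSq.prod ν) (S c)).toNNReal + l' * (unitSq {o | (o, 2) ∈ S c}).toNNReal)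

lemma charFun_ptCount {n : ℕ} [NeZero n] (l l' : NNReal) (ν : Measure (Fin 3))
    [IsProbabilityMeasure ν] {ι : Type*} [Fintype ι]
    (S : ι → Tile n → Set ((ℝ × ℝ) × Fin 3)) (hS : ∀ j c, MeasurableSet (S j c))
    (hd : ∀ j j', j ≠ j' → ∀ c, Disjoint (S j c) (S j' c)) (t : ι → ℝ) :
    ∫ ω, Complex.exp ((∑ j, t j * (ptCount (S j) ω : ℝ) : ℝ) * Complex.I) ∂(confLaw n l l' ν) =
      ∏ j, Complex.exp (ptMean l l' ν (S j) * (Complex.exp (t j * Complex.I) - 1)) := by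
  classical
  set φ : Tile n → (ℝ × ℝ) × Fin 3 → ℂ := fun c x =>
    Complex.exp ((∑ j, t j * (S j c).indicator 1 x : ℝ) * Complex.I) with hφdef
  have hφ : ∀ c, Measurable (φ c) := by
    intro c
    have : Measurable fun x => (∑ j, t j * (S j c).indicator 1 x : ℝ) :=
      Finset.measurable_sum _ fun j _ => (measurable_one.indicator (hS j c)).const_mul _
    exact Complex.measurable_exp.comp ((Complex.measurable_ofReal.comp this).mul_const _)
  have hφ1 : ∀ c x, ‖φ c x‖ ≤ 1 := fun c x => by rw [hφdef]; simp only; rw [Complex.norm_exp_ofReal_mul_I]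
  have hsplit : ∀ ω : Conf n, Complex.exp ((∑ j, t j * (ptCount (S j) ω : ℝ) : ℝ) * Complex.I) =
      ∏ c, ((∏ i ∈ Finset.range (ω c).num, φ c ((ω c).pos i, (ω c).mark i)) *
        ∏ i ∈ Finset.range (ω c).xnum, φ c ((ω c).xpos i, 2)) := by
    intro ω
    simp only [hφdef, ← Complex.exp_sum, ← Complex.exp_add]
    congr 1
    simp only [← Finset.sum_mul, ← add_mul, ← Complex.ofReal_sum, ← Complex.ofReal_add]
    congr 2
    simp only [ptCount, Nat.cast_sum, Nat.cast_add, Finset.mul_sum, mul_add]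
    rw [Finset.sum_comm]
    refine Finset.sum_congr rfl fun c _ => ?_
    rw [Finset.sum_add_distrib, Finset.sum_comm]
    congr 1
    · refine Finset.sum_congr rfl fun i _ => Finset.sum_congr rfl fun j _ => ?_
      simp [Set.indicator_apply]
    · rw [Finset.sum_comm]
      refine Finset.sum_congr rfl fun i _ => Finset.sum_congr rfl fun j _ => ?_
      simp [Set.indicator_apply]
  have hexpand : ∀ c x, φ c x = 1 + ∑ j, (Complex.exp (t j * Complex.I) - 1) *
      (S j c).indicator 1 x := by
    intro c x
    by_cases hx : ∃ j, x ∈ S j c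
    · obtain ⟨j, hj⟩ := hx
      have hother : ∀ k, k ≠ j → x ∉ S k c := fun k hk hxk =>
        Set.disjoint_left.1 (hd k j hk c) hxk hj
      have e1 : (∑ k, t k * (S k c).indicator 1 x : ℝ) = t j := by
        rw [Finset.sum_eq_single j (fun k _ hk => by simp [hother k hk]) (by simp)]
        simp [hj]
      have e2 : ∑ k, (Complex.exp (t k * Complex.I) - 1) * (S k c).indicator 1 x =
          Complex.exp (t j * Complex.I) - 1 := by
        rw [Finset.sum_eq_single j (fun k _ hk => by simp [hother k hk]) (by simp)]
        simp [hj]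
      rw [hφdef]; simp only; rw [e1, e2]; ring
    · push Not at hx
      simp [hφdef, hx]
  have hint : ∀ (μ : Measure ((ℝ × ℝ) × Fin 3)) [IsProbabilityMeasure μ] (c : Tile n),
      ∫ x, φ c x ∂μ - 1 = ∑ j, (Complex.exp (t j * Complex.I) - 1) * (μ (S j c)).toReal := by
    intro μ _ c
    simp_rw [hexpand]
    have hi : ∀ j, Integrable (fun x => (Complex.exp (t j * Complex.I) - 1) *
        (S j c).indicator (1 : (ℝ × ℝ) × Fin 3 → ℂ) x) μ := fun j =>
      ((integrable_const (1 : ℂ)).indicator (hS j c)).const_mul _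
    rw [integral_add (integrable_const _) (integrable_finsetSum _ fun j _ => hi j),
      integral_finsetSum _ fun j _ => hi j]
    simp only [integral_const, probReal_univ, one_smul, add_sub_cancel_left]
    refine Finset.sum_congr rfl fun j _ => ?_
    rw [integral_const_mul]
    congr 1
    have := integral_indicator_const (μ := μ) (1 : ℂ) (hS j c)
    rw [show ((S j c).indicator (1 : (ℝ × ℝ) × Fin 3 → ℂ)) = (S j c).indicator (fun _ => (1 : ℂ)) from rfl, this]
    simp [Measure.real]
  simp_rw [hsplit]
  rw [confLaw, integral_fintype_prod_eq_prod (fun c q =>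
    (∏ i ∈ Finset.range (CellState.num q), φ c (CellState.pos q i, CellState.mark q i)) *
        ∏ i ∈ Finset.range (CellState.xnum q), φ c (CellState.xpos q i, 2))]
  simp_rw [integral_cellLaw l l' ν _ (hφ _) (hφ1 _)]
  rw [← Complex.exp_sum, ← Complex.exp_sum]
  congr 1
  have hx : ∀ c, ∫ o, φ c (o, 2) ∂unitSq - 1 =
      ∑ j, (Complex.exp (t j * Complex.I) - 1) * (unitSq {o | (o, 2) ∈ S j c}).toReal := by
    intro c
    have hm : Measurable fun o : ℝ × ℝ => ((o, 2) : (ℝ × ℝ) × Fin 3) := by fun_prop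
    have : IsProbabilityMeasure (unitSq.map fun o => ((o, 2) : (ℝ × ℝ) × Fin 3)) :=
      Measure.isProbabilityMeasure_map hm.aemeasurable
    have h := hint (unitSq.map fun o => ((o, 2) : (ℝ × ℝ) × Fin 3)) c
    rw [integral_map hm.aemeasurable (hφ c).aestronglyMeasurable] at h
    rw [h]
    refine Finset.sum_congr rfl fun j _ => ?_
    rw [Measure.map_apply hm (hS j c)]; rfl
  simp_rw [hint, hx, ptMean]
  push_cast
  simp only [Finset.mul_sum, Finset.sum_mul]
  rw [Finset.sum_comm]
  refine Finset.sum_congr rfl fun c _ => ?_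
  rw [← Finset.sum_add_distrib]
  refine Finset.sum_congr rfl fun j _ => ?_
  simp only [ENNReal.toReal]
  ring

lemma ext_of_map_natCast {μ ν : Measure ℕ}
    (h : μ.map (Nat.cast : ℕ → ℝ) = ν.map (Nat.cast : ℕ → ℝ)) : μ = ν := by
  refine Measure.ext_of_singleton fun k => ?_
  have e : ∀ ρ : Measure ℕ, ρ.map (Nat.cast : ℕ → ℝ) {(k : ℝ)} = ρ {k} := fun ρ => by
    rw [Measure.map_apply .of_discrete (measurableSet_singleton _)]
    congr 1; ext j; simp
  rw [← e μ, ← e ν, h]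

/-- The number of points with prescribed positions and marks has a Poisson distribution. -/
lemma map_ptCount {n : ℕ} [NeZero n] (l l' : NNReal) (ν : Measure (Fin 3))
    [IsProbabilityMeasure ν] (S : Tile n → Set ((ℝ × ℝ) × Fin 3))
    (hS : ∀ c, MeasurableSet (S c)) :
    (confLaw n l l' ν).map (ptCount S) = poissonMeasure (ptMean l l' ν S) := by
  apply ext_of_map_natCast
  have : IsProbabilityMeasure ((confLaw n l l' ν).map (ptCount S)) :=
    Measure.isProbabilityMeasure_map (measurable_ptCount hS).aemeasurable
  apply Measure.ext_of_charFun
  ext t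
  have h := charFun_ptCount l l' ν (fun _ : Unit => S) (fun _ => hS)
    (fun j j' hj => absurd (Subsingleton.elim j j') hj) (fun _ => t)
  rw [charFun_map_cast_poissonMeasure, charFun_apply_real,
    Measure.map_map .of_discrete (measurable_ptCount hS),
    integral_map (by have := measurable_ptCount hS; fun_prop) (by fun_prop)]
  simpa using h

/-- Counts of disjoint families of points are independent. -/
lemma iIndepFun_ptCount {n : ℕ} [NeZero n] (l l' : NNReal) (ν : Measure (Fin 3))
    [IsProbabilityMeasure ν] {ι : Type*} [Fintype ι]
    (S : ι → Tile n → Set ((ℝ × ℝ) × Fin 3)) (hS : ∀ j c, MeasurableSet (S j c))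
    (hd : ∀ j j', j ≠ j' → ∀ c, Disjoint (S j c) (S j' c)) :
    iIndepFun (fun j => ptCount (S j)) (confLaw n l l' ν) := by
  classical
  have hm : ∀ j, Measurable fun ω : Conf n => (ptCount (S j) ω : ℝ) := fun j =>
    measurable_from_nat.comp (measurable_ptCount (hS j))
  have h : iIndepFun (fun j ω => (ptCount (S j) ω : ℝ)) (confLaw n l l' ν) := by
    rw [iIndepFun_iff_charFun_pi fun j => (hm j).aemeasurable]
    intro t
    have h1 := charFun_ptCount l l' ν S hS hd t
    have h2 : ∀ j, charFun ((confLaw n l l' ν).map fun ω => (ptCount (S j) ω : ℝ)) (t j) =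
        Complex.exp (ptMean l l' ν (S j) * (Complex.exp (t j * Complex.I) - 1)) := by
      intro j
      rw [← charFun_map_cast_poissonMeasure, ← map_ptCount l l' ν _ (hS j),
        Measure.map_map .of_discrete (measurable_ptCount (hS j))]
      rfl
    simp_rw [h2, ← h1]
    have hv : Measurable fun ω : Conf n => WithLp.toLp 2 fun j => (ptCount (S j) ω : ℝ) :=
      (WithLp.measurable_toLp 2 _).comp (measurable_pi_lambda _ hm)
    rw [charFun_apply, integral_map hv.aemeasurable (by fun_prop)]
    simp [PiLp.inner_apply]
  have := h.comp (fun _ x => ⌊x⌋₊) fun _ => Nat.measurable_floor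
  refine this.congr fun j => ae_of_all _ fun ω => ?_
  simp

/-! ### Simple configurations -/

namespace CellState

/-- The position of an ordinary (`b = false`) or extra (`b = true`) point. -/
def off (q : CellState) (b : Bool) (i : ℕ) : ℝ × ℝ := if b then q.xpos i else q.pos i
/-- The number of ordinary or extra points. -/
def cnt (q : CellState) (b : Bool) : ℕ := if b then q.xnum else q.num
/-- The mark of an ordinary or extra point. -/
def mk' (q : CellState) (b : Bool) (i : ℕ) : Fin 3 := if b then 2 else q.mark i

/-- The positions lie in the half-open unit square and are distinct. -/
def Simple (q : CellState) : Prop :=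
  (∀ b i, q.off b i ∈ Set.Ico (0 : ℝ) 1 ×ˢ Set.Ico (0 : ℝ) 1) ∧
  ∀ x y : Bool × ℕ, x ≠ y → q.off x.1 x.2 ≠ q.off y.1 y.2

@[fun_prop] lemma measurable_off (b : Bool) (i : ℕ) : Measurable fun q : CellState => q.off b i := by
  cases b <;> simp only [off] <;> simp <;> fun_prop

lemma measurableSet_simple : MeasurableSet {q : CellState | q.Simple} := by
  refine MeasurableSet.inter ?_ ?_
  · change MeasurableSet {q : CellState | ∀ b i, _}
    simp only [Set.ofPred_forall]
    refine MeasurableSet.iInter fun b => MeasurableSet.iInter fun i => ?_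
    exact measurable_off b i (measurableSet_Ico.prod measurableSet_Ico)
  · change MeasurableSet {q : CellState | ∀ x y, _}
    simp only [Set.ofPred_forall]
    refine MeasurableSet.iInter fun x => MeasurableSet.iInter fun y => MeasurableSet.iInter
      fun _ => ?_
    exact (measurableSet_eq_fun (measurable_off _ _) (measurable_off _ _)).compl

end CellState

lemma unitSq_compl : unitSq (Set.Ico (0 : ℝ) 1 ×ˢ Set.Ico (0 : ℝ) 1)ᶜ = 0 := by
  rw [unitSq, Measure.restrict_apply (measurableSet_Ico.prod measurableSet_Ico).compl]
  simp

instance : NullSingletonClass unitSq := by unfold unitSq; infer_instance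

lemma prod_diagonal_eq_zero (μ : Measure (ℝ × ℝ)) [IsProbabilityMeasure μ] [NullSingletonClass μ] :
    (μ.prod μ) {p | p.1 = p.2} = 0 := by
  rw [Measure.prod_apply (measurableSet_eq_fun measurable_fst measurable_snd)]
  have : ∀ x : ℝ × ℝ, Prod.mk x ⁻¹' {p : (ℝ × ℝ) × ℝ × ℝ | p.1 = p.2} = {x} := fun x => by
    ext y; simp [eq_comm]
  simp [this]

lemma ae_simple_cellLaw (l l' : NNReal) (ν : Measure (Fin 3)) [IsProbabilityMeasure ν] :
    ∀ᵐ q ∂(cellLaw l l' ν), q.Simple := by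
  set U : Measure (ℕ → ℝ × ℝ) := Measure.infinitePi fun _ : ℕ => unitSq with hU
  -- Up to the irrelevant coordinates, the two position sequences have law `U × U`.
  have hpos : MeasurePreserving CellState.pos (cellLaw l l' ν) U := by
    have h1 : MeasurePreserving (Prod.snd : OrdPart → _) (ordLaw l) U := measurePreserving_snd
    exact h1.comp measurePreserving_fst
  have hx : MeasurePreserving (fun f : FreePart => f.2.1) (freeLaw l' ν) U := by
    have h2 : MeasurePreserving (Prod.snd : FreePart → _) (freeLaw l' ν) _ :=
      measurePreserving_snd
    exact measurePreserving_fst.comp h2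
  have hxpos : MeasurePreserving CellState.xpos (cellLaw l l' ν) U := hx.comp measurePreserving_snd
  have hboth : MeasurePreserving (fun q : CellState => (q.pos, q.xpos)) (cellLaw l l' ν)
      (U.prod U) := by
    have h1 : MeasurePreserving (Prod.snd : OrdPart → _) (ordLaw l) U := measurePreserving_snd
    exact h1.prod hx
  have heval : ∀ i, MeasurePreserving (fun x : ℕ → ℝ × ℝ => x i) U unitSq := fun i =>
    measurePreserving_eval_infinitePi _ i
  have hoff : ∀ b i, MeasurePreserving (fun q : CellState => q.off b i) (cellLaw l l' ν)
      unitSq := by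
    intro b i
    cases b
    · exact (heval i).comp hpos
    · exact (heval i).comp hxpos
  have hpair : ∀ x y : Bool × ℕ, x ≠ y → MeasurePreserving
      (fun q : CellState => (q.off x.1 x.2, q.off y.1 y.2)) (cellLaw l l' ν)
      (unitSq.prod unitSq) := by
    have hseq : ∀ i j, i ≠ j → MeasurePreserving (fun x : ℕ → ℝ × ℝ => (x i, x j)) U
        (unitSq.prod unitSq) := fun i j hij =>
      ⟨by fun_prop, Measure.infinitePi_map_eval_prod hij⟩
    rintro ⟨b, i⟩ ⟨b', j⟩ hne
    cases b <;> cases b'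
    · exact (hseq i j (fun h => hne (by rw [h]))).comp hpos
    · exact ((heval i).prod (heval j)).comp hboth
    · have := Measure.measurePreserving_swap.comp (((heval j).prod (heval i)).comp hboth)
      exact this
    · exact (hseq i j (fun h => hne (by rw [h]))).comp hxpos
  simp only [CellState.Simple, eventually_and, ae_all_iff]
  refine ⟨fun b i => ?_, fun x y hxy => ?_⟩
  · have := (hoff b i).quasiMeasurePreserving.ae (p := fun o => o ∈ Set.Ico (0 : ℝ) 1 ×ˢ Set.Ico (0 : ℝ) 1)
      (by rw [ae_iff]; exact unitSq_compl)
    exact this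
  · have := (hpair x y hxy).quasiMeasurePreserving.ae (p := fun o => o.1 ≠ o.2)
      (by rw [ae_iff]; simpa using prod_diagonal_eq_zero unitSq)
    exact this

/-- All cells are simple. -/
def SimpleConf {n : ℕ} (ω : Conf n) : Prop := ∀ c, (ω c).Simple

lemma measurableSet_simpleConf {n : ℕ} [NeZero n] : MeasurableSet {ω : Conf n | SimpleConf ω} := by
  simp only [SimpleConf, Set.ofPred_forall]
  exact MeasurableSet.iInter fun c =>
    (measurable_pi_apply (X := fun _ : Tile n => CellState) c) CellState.measurableSet_simple

lemma ae_simpleConf {n : ℕ} [NeZero n] (l l' : NNReal) (ν : Measure (Fin 3))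
    [IsProbabilityMeasure ν] : ∀ᵐ ω ∂(confLaw n l l' ν), SimpleConf ω := by
  unfold SimpleConf
  rw [ae_all_iff]
  intro c
  have h : MeasurePreserving (fun ω : Conf n => ω c) (confLaw n l l' ν) (cellLaw l l' ν) :=
    measurePreserving_eval _ c
  exact h.quasiMeasurePreserving.ae (ae_simple_cellLaw l l' ν)

section

/-! ### The coloured Poisson processes of a configuration -/

lemma measurable_proj (s : ℝ) : Measurable (proj s) := by
  unfold proj
  refine (WithLp.measurable_toLp 2 _).comp ?_
  exact (AddCircle.measurable_mk'.comp measurable_fst).prodMk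
    (AddCircle.measurable_mk'.comp measurable_snd)

/-- The point of the torus at position `o` in the cell `c`. -/
def tilePt (s : ℝ) {n : ℕ} (c : Tile n) (o : ℝ × ℝ) : Torus s :=
  proj s (s / n * (c.1.val + o.1), s / n * (c.2.val + o.2))

lemma measurable_tilePt (s : ℝ) {n : ℕ} (c : Tile n) : Measurable (tilePt s c) :=
  (measurable_proj s).comp (by fun_prop)

lemma mem_Ico_div {s : ℝ} (hs : 0 < s) {n k : ℕ} (hk : k < n) {o : ℝ} (ho : o ∈ Set.Ico (0 : ℝ) 1) :
    s / n * (k + o) ∈ Set.Ico 0 s := by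
  have hn : (0 : ℝ) < n := by exact_mod_cast (Nat.zero_le k).trans_lt hk
  have hk' : (k : ℝ) + 1 ≤ n := by exact_mod_cast hk
  have h0 : (0 : ℝ) ≤ k := k.cast_nonneg
  refine ⟨mul_nonneg (by positivity) (by linarith [ho.1]), ?_⟩
  rw [div_mul_eq_mul_div, div_lt_iff₀ hn]
  have : (k : ℝ) + o < n := by linarith [ho.2]
  exact mul_lt_mul_of_pos_left this hs

lemma coord_inj {s : ℝ} (hs : 0 < s) {n k k' : ℕ} (hn : n ≠ 0) {o o' : ℝ}
    (ho : o ∈ Set.Ico (0 : ℝ) 1) (ho' : o' ∈ Set.Ico (0 : ℝ) 1)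
    (h : s / n * (k + o) = s / n * (k' + o')) : k = k' ∧ o = o' := by
  have hpos : s / n ≠ 0 := by positivity
  have h1 : (k : ℝ) + o = k' + o' := mul_left_cancel₀ hpos h
  have h2 : ⌊(k : ℝ) + o⌋ = ⌊(k' : ℝ) + o'⌋ := by rw [h1]
  rw [Int.floor_natCast_add, Int.floor_natCast_add, Int.floor_eq_zero_iff.2 ho,
    Int.floor_eq_zero_iff.2 ho'] at h2
  have h3 : k = k' := by exact_mod_cast (by simpa using h2 : (k : ℤ) = k')
  exact ⟨h3, by subst h3; linarith⟩

lemma tilePt_inj {s : ℝ} (hs : 0 < s) {n : ℕ} [NeZero n] {c c' : Tile n} {o o' : ℝ × ℝ}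
    (ho : o ∈ Set.Ico (0 : ℝ) 1 ×ˢ Set.Ico (0 : ℝ) 1)
    (ho' : o' ∈ Set.Ico (0 : ℝ) 1 ×ˢ Set.Ico (0 : ℝ) 1) (h : tilePt s c o = tilePt s c' o') :
    c = c' ∧ o = o' := by
  have : Fact (0 < s) := ⟨hs⟩
  have h' := (WithLp.toLp_injective 2) h
  rw [Prod.mk.injEq] at h'
  have hco : ∀ {k k' : ℕ} {u u' : ℝ}, k < n → k' < n → u ∈ Set.Ico (0 : ℝ) 1 →
      u' ∈ Set.Ico (0 : ℝ) 1 →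
      ((s / n * (k + u) : ℝ) : AddCircle s) = ((s / n * (k' + u') : ℝ) : AddCircle s) →
      k = k' ∧ u = u' := by
    intro k k' u u' hk hk' hu hu' heq
    refine coord_inj hs (NeZero.ne n) hu hu' ?_
    rwa [AddCircle.coe_eq_coe_iff_of_mem_Ico (a := 0)
      (by simpa using mem_Ico_div hs hk hu) (by simpa using mem_Ico_div hs hk' hu')] at heq
  have h1 := hco (ZMod.val_lt c.1) (ZMod.val_lt c'.1) ho.1 ho'.1 h'.1
  have h2 := hco (ZMod.val_lt c.2) (ZMod.val_lt c'.2) ho.2 ho'.2 h'.2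
  exact ⟨Prod.ext (ZMod.val_injective n h1.1) (ZMod.val_injective n h2.1),
    Prod.ext h1.2 h2.2⟩

open scoped Pointwise in
/-- The cells tile the square. -/
lemma sum_volume_cells {s : ℝ} (hs : 0 < s) {n : ℕ} [NeZero n] {A : Set (ℝ × ℝ)}
    (hA : MeasurableSet A) :
    ∑ c : Tile n, ENNReal.ofReal ((s / n) ^ 2) *
      unitSq {o | (s / n * (c.1.val + o.1), s / n * (c.2.val + o.2)) ∈ A} =
      volume (A ∩ Set.Ico 0 s ×ˢ Set.Ico 0 s) := by
  have hn : (0 : ℝ) < n := by exact_mod_cast NeZero.pos n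
  have ha : 0 < s / n := by positivity
  set F : Tile n → ℝ × ℝ → ℝ × ℝ := fun c o => (s / n * (c.1.val + o.1), s / n * (c.2.val + o.2))
    with hF
  have hFform : ∀ c o, F c o = (s / n) • (((c.1.val : ℝ), (c.2.val : ℝ)) + o) := fun c o => by
    ext <;> simp [hF] <;> ring
  have hinj : ∀ c, Function.Injective (F c) := by
    intro c o o' h
    rw [hFform, hFform] at h
    exact add_left_cancel (smul_right_injective _ ha.ne' h)
  have hemb : ∀ c, MeasurableEmbedding (F c) := fun c =>
    Measurable.measurableEmbedding (by fun_prop) (hinj c)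
  have hmeas : ∀ c, ENNReal.ofReal ((s / n) ^ 2) * unitSq {o | F c o ∈ A} =
      volume (A ∩ F c '' (Set.Ico 0 1 ×ˢ Set.Ico 0 1)) := by
    intro c
    have hpre : {o | F c o ∈ A} = F c ⁻¹' A := rfl
    have h1 : A ∩ F c '' (Set.Ico 0 1 ×ˢ Set.Ico 0 1) =
        (s / n) • ((fun o => ((c.1.val : ℝ), (c.2.val : ℝ)) + o) ''
          (F c ⁻¹' A ∩ Set.Ico 0 1 ×ˢ Set.Ico 0 1)) := by
      rw [Set.inter_comm, ← Set.image_inter_preimage, Set.inter_comm, ← Set.image_smul,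
        Set.image_image]
      exact Set.image_congr fun o _ => hFform c o
    rw [h1, Measure.addHaar_smul, Set.image_add_left, measure_preimage_add, hpre, unitSq,
      Measure.restrict_apply ((hemb c).measurable hA)]
    simp [abs_of_pos ha]
  have hunion : A ∩ Set.Ico 0 s ×ˢ Set.Ico 0 s =
      ⋃ c : Tile n, A ∩ F c '' (Set.Ico 0 1 ×ˢ Set.Ico 0 1) := by
    rw [← Set.inter_iUnion]
    congr 1
    apply Set.Subset.antisymm
    · rintro ⟨x, y⟩ ⟨hx, hy⟩
      have key : ∀ x ∈ Set.Ico (0 : ℝ) s, ∃ k : ZMod n, ∃ o ∈ Set.Ico (0 : ℝ) 1,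
          s / n * (k.val + o) = x := by
        intro x hx
        have hk : ⌊x / (s / n)⌋₊ < n := by
          rw [Nat.floor_lt (div_nonneg hx.1 ha.le), div_lt_iff₀ ha]
          calc x < s := hx.2
            _ = n * (s / n) := by field_simp
        refine ⟨(⌊x / (s / n)⌋₊ : ZMod n), x / (s / n) - ⌊x / (s / n)⌋₊, ⟨?_, ?_⟩, ?_⟩
        · exact sub_nonneg.2 (Nat.floor_le (div_nonneg hx.1 ha.le))
        · linarith [Nat.lt_floor_add_one (x / (s / n))]
        · rw [ZMod.val_natCast_of_lt hk]; field_simp; ring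
      obtain ⟨k, o, ho, hk⟩ := key x hx
      obtain ⟨k', o', ho', hk'⟩ := key y hy
      exact Set.mem_iUnion.2 ⟨(k, k'), (o, o'), ⟨ho, ho'⟩, by simp only [hF]; rw [hk, hk']⟩
    · refine Set.iUnion_subset fun c => ?_
      rintro _ ⟨o, ho, rfl⟩
      exact ⟨mem_Ico_div hs (ZMod.val_lt c.1) ho.1, mem_Ico_div hs (ZMod.val_lt c.2) ho.2⟩
  rw [hunion, measure_iUnion]
  · rw [tsum_fintype]
    exact Finset.sum_congr rfl fun c _ => hmeas c
  · intro c c' hcc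
    refine Set.disjoint_left.2 ?_
    rintro x ⟨-, o, ho, rfl⟩ ⟨-, o', ho', heq⟩
    simp only [hF, Prod.mk.injEq] at heq
    have h1 := coord_inj hs (NeZero.ne n) ho'.1 ho.1 heq.1
    have h2 := coord_inj hs (NeZero.ne n) ho'.2 ho.2 heq.2
    exact hcc (Prod.ext (ZMod.val_injective n h1.1.symm) (ZMod.val_injective n h2.1.symm))
  · intro c
    exact hA.inter ((hemb c).measurableSet_image.2 (measurableSet_Ico.prod measurableSet_Ico))

variable {n : ℕ} [NeZero n]

/-- The points of a configuration, indexed by their cell, their kind and their number. -/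
def actives (ω : Conf n) : Finset (Σ _ : Tile n × Bool, ℕ) :=
  Finset.univ.sigma fun q => Finset.range ((ω q.1).cnt q.2)

/-- The location of a point on the torus. -/
def loc (s : ℝ) (ω : Conf n) (x : Σ _ : Tile n × Bool, ℕ) : Torus s :=
  tilePt s x.1.1 ((ω x.1.1).off x.1.2 x.2)

/-- The mark of a point. -/
def markOf (ω : Conf n) (x : Σ _ : Tile n × Bool, ℕ) : Fin 3 := (ω x.1.1).mk' x.1.2 x.2

open Classical in
/-- The coloured points of a configuration, where the points whose mark satisfies `κ` are black.
Exceptional configurations, in which positions coincide, are replaced by the empty one. -/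
def colouring (s : ℝ) (κ : Fin 3 → Bool) (ω : Conf n) : ColouredPoints s where
  black := if SimpleConf ω then ((actives ω).filter fun x => κ (markOf ω x)).image (loc s ω) else ∅
  white := if SimpleConf ω then (actives ω).image (loc s ω) \
    ((actives ω).filter fun x => κ (markOf ω x)).image (loc s ω) else ∅
  disjoint := by split_ifs <;> simp [Finset.disjoint_sdiff]

lemma loc_injective {s : ℝ} (hs : 0 < s) {ω : Conf n} (hω : SimpleConf ω) :
    Function.Injective (loc s ω) := by
  rintro ⟨⟨c, b⟩, i⟩ ⟨⟨c', b'⟩, i'⟩ h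
  obtain ⟨h1, h2⟩ := tilePt_inj hs ((hω c).1 b i) ((hω c').1 b' i') h
  simp only at h1 h2
  subst h1
  by_contra hne
  exact (hω c).2 (b, i) (b', i') (fun hh => hne (by
    rw [Prod.mk.injEq] at hh; obtain ⟨rfl, rfl⟩ := hh; rfl)) h2

lemma sum_actives (ω : Conf n) (g : (Σ _ : Tile n × Bool, ℕ) → ℕ) :
    ∑ x ∈ actives ω, g x = ∑ c, ((∑ i ∈ Finset.range (ω c).num, g ⟨(c, false), i⟩) +
      ∑ i ∈ Finset.range (ω c).xnum, g ⟨(c, true), i⟩) := by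
  rw [actives, Finset.sum_sigma, Fintype.sum_prod_type]
  refine Finset.sum_congr rfl fun c _ => ?_
  rw [Fintype.sum_bool, add_comm]
  rfl

/-- The positions and marks of the points in `A` whose mark satisfies `κ`. -/
def selector (s : ℝ) (κ : Fin 3 → Bool) (A : Set (Torus s)) (c : Tile n) :
    Set ((ℝ × ℝ) × Fin 3) :=
  (tilePt s c ⁻¹' A) ×ˢ {m | κ m = true}

lemma measurableSet_selector {n : ℕ} {s : ℝ} (κ : Fin 3 → Bool) {A : Set (Torus s)} (hA : MeasurableSet A)
    (c : Tile n) : MeasurableSet (selector s κ A c) :=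
  (measurable_tilePt s c hA).prod (Set.toFinite _).measurableSet

lemma ptCount_selector (s : ℝ) (κ : Fin 3 → Bool) (A : Set (Torus s)) (ω : Conf n) :
    ptCount (selector s κ A) ω = ∑ x ∈ actives ω,
      (Set.indicator {x | loc s ω x ∈ A ∧ κ (markOf ω x) = true} 1 x) := by
  rw [sum_actives, ptCount]
  refine Finset.sum_congr rfl fun c _ => ?_
  rfl

lemma ncard_image_inter {s : ℝ} (hs : 0 < s) {ω : Conf n} (hω : SimpleConf ω) (κ : Fin 3 → Bool)
    (A : Set (Torus s)) : (loc s ω '' {x ∈ actives ω | κ (markOf ω x)} ∩ A).ncard =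
      ptCount (selector s κ A) ω := by
  classical
  rw [ptCount_selector]
  have : loc s ω '' {x ∈ actives ω | κ (markOf ω x)} ∩ A =
      (((actives ω).filter fun x => loc s ω x ∈ A ∧ κ (markOf ω x) = true).image (loc s ω) :
        Finset (Torus s)) := by
    ext z
    simp only [Set.mem_inter_iff, Set.mem_image, Finset.coe_image, Finset.coe_filter]
    constructor
    · rintro ⟨⟨x, hx, rfl⟩, hz⟩; exact ⟨x, ⟨hx.1, hz, hx.2⟩, rfl⟩
    · rintro ⟨x, hx, rfl⟩; exact ⟨⟨x, ⟨hx.1, hx.2.2⟩, rfl⟩, hx.2.1⟩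
  rw [this, Set.ncard_coe_finset, Finset.card_image_of_injective _ (loc_injective hs hω),
    Finset.card_filter]
  refine Finset.sum_congr rfl fun x _ => ?_
  simp [Set.indicator_apply]

lemma black_colouring {s : ℝ} {ω : Conf n} (hω : SimpleConf ω) (κ : Fin 3 → Bool) :
    ((colouring s κ ω).black : Set (Torus s)) = loc s ω '' {x ∈ actives ω | κ (markOf ω x)} := by
  classical
  simp only [colouring, if_pos hω]
  ext z; simp

lemma points_colouring {s : ℝ} {ω : Conf n} (hω : SimpleConf ω) (κ : Fin 3 → Bool) :
    (colouring s κ ω).points = loc s ω '' actives ω := by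
  classical
  simp only [colouring, if_pos hω, ColouredPoints.points]
  rw [← Finset.coe_union, Finset.union_sdiff_of_subset
    (Finset.image_subset_image (Finset.filter_subset _ _))]
  simp

lemma blackCount_colouring {s : ℝ} (hs : 0 < s) (κ : Fin 3 → Bool) (A : Set (Torus s)) :
    (fun ω : Conf n => (colouring s κ ω).blackCount A) =
      Set.indicator {ω | SimpleConf ω} (ptCount (selector s κ A)) := by
  ext ω
  by_cases hω : SimpleConf ω
  · rw [Set.indicator_of_mem (show ω ∈ {ω | SimpleConf ω} from hω), ← ncard_image_inter hs hω,
      ColouredPoints.blackCount, black_colouring hω]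
  · rw [Set.indicator_of_notMem (show ω ∉ {ω | SimpleConf ω} from hω)]
    simp [ColouredPoints.blackCount, colouring, hω]

lemma count_colouring {s : ℝ} (hs : 0 < s) (κ : Fin 3 → Bool) (A : Set (Torus s)) :
    (fun ω : Conf n => (colouring s κ ω).count A) =
      Set.indicator {ω | SimpleConf ω} (ptCount (selector s (fun _ => true) A)) := by
  ext ω
  by_cases hω : SimpleConf ω
  · rw [Set.indicator_of_mem (show ω ∈ {ω | SimpleConf ω} from hω), ← ncard_image_inter hs hω,
      ColouredPoints.count, points_colouring hω]
    simp
  · rw [Set.indicator_of_notMem (show ω ∉ {ω | SimpleConf ω} from hω)]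
    simp [ColouredPoints.count, ColouredPoints.points, colouring, hω]

lemma ptCount_selector_add (s : ℝ) (κ : Fin 3 → Bool) (A : Set (Torus s)) (ω : Conf n) :
    ptCount (selector s (fun _ => true) A) ω =
      ptCount (selector s κ A) ω + ptCount (selector s (fun m => !κ m) A) ω := by
  rw [ptCount_selector, ptCount_selector, ptCount_selector, ← Finset.sum_add_distrib]
  refine Finset.sum_congr rfl fun x _ => ?_
  by_cases h : loc s ω x ∈ A <;> cases h' : κ (markOf ω x) <;> simp [h, h']

lemma area_ne_top {s : ℝ} (A : Set (Torus s)) : area s A ≠ ⊤ := by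
  have : area s Set.univ < ⊤ := by
    rw [area, Measure.map_apply (measurable_proj s) MeasurableSet.univ, Set.preimage_univ,
      Measure.restrict_apply_univ, Measure.volume_eq_prod, Measure.prod_prod]
    simp [ENNReal.mul_lt_top_iff]
  exact ((measure_mono (Set.subset_univ A)).trans_lt this).ne

lemma ptMean_selector {s : ℝ} (hs : 0 < s) {l l' : NNReal} {ν : Measure (Fin 3)}
    [IsProbabilityMeasure ν] {κ : Fin 3 → Bool} {p : NNReal}
    (hp : (l : ℝ) * ν.real {m | κ m = true} + l' * (if κ 2 then 1 else 0) = (s / n) ^ 2 * p)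
    {A : Set (Torus s)} (hA : MeasurableSet A) :
    ptMean (n := n) l l' ν (selector s κ A) = p * (area s A).toNNReal := by
  have h1 : ∀ c : Tile n, (l : ENNReal) * (unitSq.prod ν) (selector s κ A c) +
      l' * unitSq {o | (o, (2 : Fin 3)) ∈ selector s κ A c} =
      ENNReal.ofReal ((s / n) ^ 2) * unitSq (tilePt s c ⁻¹' A) * p := by
    intro c
    have e1 : unitSq {o | (o, (2 : Fin 3)) ∈ selector s κ A c} =
        (if κ 2 then 1 else 0) * unitSq (tilePt s c ⁻¹' A) := by
      cases h : κ 2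
      · simp [selector, h]
      · simp only [selector, Set.mem_prod, Set.mem_preimage, Set.mem_ofPred_eq, h, and_true,
          if_true, one_mul]
        rfl
    rw [e1, selector, Measure.prod_prod]
    have e2 : (l : ENNReal) * ν {m | κ m = true} + l' * (if κ 2 then 1 else 0) =
        ENNReal.ofReal ((s / n) ^ 2) * p := by
      rw [← ENNReal.ofReal_coe_nnreal (p := p), ← ENNReal.ofReal_mul (by positivity), ← hp,
        ENNReal.ofReal_add (by positivity) (by positivity), ENNReal.ofReal_mul (by positivity),
        ENNReal.ofReal_mul (by positivity), ENNReal.ofReal_coe_nnreal, ENNReal.ofReal_coe_nnreal,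
        Measure.real, ENNReal.ofReal_toReal (measure_ne_top _ _)]
      congr 2
      split_ifs <;> simp
    calc _ = ((l : ENNReal) * ν {m | κ m = true} + l' * (if κ 2 then 1 else 0)) *
          unitSq (tilePt s c ⁻¹' A) := by ring
      _ = _ := by rw [e2]; ring
  have h2 : ((ptMean (n := n) l l' ν (selector s κ A) : NNReal) : ENNReal) = p * area s A := by
    rw [ptMean]
    push_cast
    simp_rw [ENNReal.coe_toNNReal (measure_ne_top _ _), h1]
    rw [← Finset.sum_mul, mul_comm, area, Measure.map_apply (measurable_proj s) hA,
      Measure.restrict_apply (measurable_proj s hA)]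
    congr 1
    exact sum_volume_cells hs (measurable_proj s hA)
  rw [← ENNReal.coe_inj, h2, ENNReal.coe_mul, ENNReal.coe_toNNReal (area_ne_top A)]

lemma measureReal_forall_eq {Ω ι : Type*} [MeasurableSpace Ω] {P : Measure Ω} [Fintype ι]
    {f : ι → Ω → ℕ} (hf : iIndepFun f P) (hm : ∀ i, Measurable (f i)) (k : ι → ℕ) :
    P.real {ω | ∀ i, f i ω = k i} = ∏ i, (P.map (f i)).real {k i} := by
  have h := hf.measure_inter_preimage_eq_mul Finset.univ (sets := fun i => {k i})
    fun i _ => measurableSet_singleton _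
  have e : {ω | ∀ i, f i ω = k i} = ⋂ i ∈ Finset.univ, f i ⁻¹' {k i} := by ext; simp
  rw [e, Measure.real, h, ENNReal.toReal_prod]
  refine Finset.prod_congr rfl fun i _ => ?_
  rw [Measure.real, Measure.map_apply (hm i) (measurableSet_singleton _)]

/-- Thinning of the Poisson distribution, for point masses. -/
lemma poissonMeasure_real_thinning {p : ℝ} (hp0 : 0 ≤ p) (hp1 : p ≤ 1) (m : NNReal) {k N : ℕ}
    (hk : k ≤ N) :
    (poissonMeasure (p.toNNReal * m)).real {k} *
      (poissonMeasure ((1 - p).toNNReal * m)).real {N - k} =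
      (poissonMeasure m).real {N} * (N.choose k * p ^ k * (1 - p) ^ (N - k)) := by
  obtain ⟨j, rfl⟩ := Nat.exists_eq_add_of_le hk
  simp only [poissonMeasure_real_singleton, NNReal.coe_mul, Real.coe_toNNReal _ hp0,
    Real.coe_toNNReal _ (sub_nonneg.2 hp1), Nat.add_sub_cancel_left]
  have h1 : Real.exp (-(p * m)) * Real.exp (-((1 - p) * m)) = Real.exp (-(m : ℝ)) := by
    rw [← Real.exp_add]; ring_nf
  have h2 : ((k + j).choose k : ℝ) * k.factorial * j.factorial = (k + j).factorial := by
    rw [Nat.choose_symm_add]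
    exact_mod_cast Nat.add_choose_mul_factorial_mul_factorial k j
  rw [← h1, ← h2]
  simp only [mul_pow, pow_add]
  generalize Real.exp (-((1 - p) * m)) = E1
  generalize (1 - p) = q
  have h3 : ((k + j).choose k : ℝ) ≠ 0 := by
    exact_mod_cast (Nat.choose_pos (Nat.le_add_right k j)).ne'
  field_simp

/-- A configuration gives rise to a coloured Poisson process. -/
theorem isColouredPoissonProcess_colouring {s : ℝ} (hs : 0 < s) {l l' : NNReal}
    {ν : Measure (Fin 3)} [IsProbabilityMeasure ν] {κ : Fin 3 → Bool} {p : ℝ} (hp0 : 0 ≤ p)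
    (hp1 : p ≤ 1) (hl : (l : ℝ) + l' = (s / n) ^ 2)
    (hp : (l : ℝ) * ν.real {m | κ m = true} + l' * (if κ 2 then 1 else 0) = (s / n) ^ 2 * p) :
    IsColouredPoissonProcess p (confLaw n l l' ν) (colouring s κ) := by
  set T : (Fin 3 → Bool) → Set (Torus s) → Conf n → ℕ := fun κ A => ptCount (selector s κ A)
    with hT
  have hTm : ∀ κ A, MeasurableSet A → Measurable (T κ A) := fun κ A hA =>
    measurable_ptCount fun c => measurableSet_selector κ hA c
  have hae : ∀ᵐ ω ∂(confLaw n l l' ν), SimpleConf ω := ae_simpleConf l l' ν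
  have hcount : ∀ A, (fun ω : Conf n => (colouring s κ ω).count A)
      =ᵐ[confLaw n l l' ν] T (fun _ => true) A := by
    intro A
    rw [count_colouring hs]
    filter_upwards [hae] with ω hω
    exact Set.indicator_of_mem (show ω ∈ {ω | SimpleConf ω} from hω) _
  have hblack : ∀ A, (fun ω : Conf n => (colouring s κ ω).blackCount A)
      =ᵐ[confLaw n l l' ν] T κ A := by
    intro A
    rw [blackCount_colouring hs]
    filter_upwards [hae] with ω hω
    exact Set.indicator_of_mem (show ω ∈ {ω | SimpleConf ω} from hω) _
  have hone : ∀ A, MeasurableSet A → ptMean (n := n) l l' ν (selector s (fun _ => true) A) =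
      (area s A).toNNReal := by
    intro A hA
    rw [ptMean_selector (p := 1) hs (by simpa using hl) hA, one_mul]
  have hpb : ∀ A, MeasurableSet A → ptMean (n := n) l l' ν (selector s κ A) =
      p.toNNReal * (area s A).toNNReal := by
    intro A hA
    exact ptMean_selector hs (by rw [Real.coe_toNNReal _ hp0]; exact hp) hA
  have hcompl : ν.real {m | (!κ m) = true} = 1 - ν.real {m | κ m = true} := by
    rw [← probReal_compl_eq_one_sub (Set.toFinite _).measurableSet]
    congr 1; ext m; simp
  have hpw : ∀ A, MeasurableSet A → ptMean (n := n) l l' ν (selector s (fun m => !κ m) A) =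
      (1 - p).toNNReal * (area s A).toNNReal := by
    intro A hA
    refine ptMean_selector hs ?_ hA
    rw [Real.coe_toNNReal _ (by linarith), hcompl]
    have : (if (!κ 2) = true then (1 : ℝ) else 0) = 1 - if κ 2 then 1 else 0 := by
      cases κ 2 <;> simp
    rw [this]
    linarith
  refine ⟨fun A hA => ?_, fun A hA => ?_, fun A hA => ?_, fun m A hA hd => ?_,
    fun m A hA hd N k => ?_⟩
  · rw [count_colouring hs]; exact (hTm _ A hA).indicator measurableSet_simpleConf
  · rw [blackCount_colouring hs]; exact (hTm _ A hA).indicator measurableSet_simpleConf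
  · rw [Measure.map_congr (hcount A), hT, ← hone A hA]
    exact map_ptCount l l' ν _ fun c => measurableSet_selector _ hA c
  · refine iIndepFun.congr (fun j => (hcount (A j)).symm) ?_
    refine iIndepFun_ptCount l l' ν _ (fun j c => measurableSet_selector _ (hA j) c) ?_
    intro j j' hj c
    exact Set.disjoint_prod.2 (Or.inl ((hd hj).preimage _))
  · have hev : ({ω | ∀ i, (colouring s κ ω).count (A i) = N i ∧
        (colouring s κ ω).blackCount (A i) = k i} : Set (Conf n)) =ᵐ[confLaw n l l' ν]
        {ω | ∀ i, T (fun _ => true) (A i) ω = N i ∧ T κ (A i) ω = k i} := by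
      have h1 := ae_all_iff.2 fun i => hcount (A i)
      have h2 := ae_all_iff.2 fun i => hblack (A i)
      filter_upwards [h1, h2] with ω h1 h2
      apply propext
      change (∀ i, _ ∧ _) ↔ ∀ i, _ ∧ _
      refine forall_congr' fun i => ?_
      rw [h1 i, h2 i]
    have hev' : ({ω | ∀ i, (colouring s κ ω).count (A i) = N i} : Set (Conf n))
        =ᵐ[confLaw n l l' ν] {ω | ∀ i, T (fun _ => true) (A i) ω = N i} := by
      have h1 := ae_all_iff.2 fun i => hcount (A i)
      filter_upwards [h1] with ω h1
      apply propext
      change (∀ i, _) ↔ ∀ i, _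
      refine forall_congr' fun i => ?_
      rw [h1 i]
    rw [measureReal_congr hev, measureReal_congr hev']
    by_cases hk : ∀ i, k i ≤ N i
    · set f : Fin m × Bool → Conf n → ℕ := fun x => T (fun a => κ a == x.2) (A x.1) with hf
      have hset : ({ω | ∀ i, T (fun _ => true) (A i) ω = N i ∧ T κ (A i) ω = k i} :
          Set (Conf n)) = {ω | ∀ x, f x ω = if x.2 then k x.1 else N x.1 - k x.1} := by
        ext ω
        change (∀ i, _ ∧ _) ↔ ∀ x, _
        rw [Prod.forall]
        refine forall_congr' fun i => ?_
        rw [Bool.forall_bool]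
        have e1 : f (i, true) ω = T κ (A i) ω := by simp [hf]
        have e2 : f (i, false) ω = T (fun a => !κ a) (A i) ω := by simp [hf]
        have e3 : T (fun _ => true) (A i) ω = T κ (A i) ω + T (fun a => !κ a) (A i) ω :=
          ptCount_selector_add s κ (A i) ω
        have := hk i
        simp only [e1, e2, e3, if_true, Bool.false_eq_true, if_false]
        omega
      have hind : iIndepFun f (confLaw n l l' ν) := by
        refine iIndepFun_ptCount l l' ν _ (fun x c => measurableSet_selector _ (hA x.1) c) ?_
        rintro ⟨i, b⟩ ⟨j, b'⟩ hne c
        by_cases hij : i = j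
        · subst hij
          refine Set.disjoint_prod.2 (Or.inr (Set.disjoint_left.2 ?_))
          intro a ha ha'
          have ha : (κ a == b) = true := ha
          have ha' : (κ a == b') = true := ha'
          exact hne (by rw [← beq_iff_eq.1 ha, ← beq_iff_eq.1 ha'])
        · exact Set.disjoint_prod.2 (Or.inl ((hd hij).preimage _))
      have hind' : iIndepFun (fun i => T (fun _ => true) (A i)) (confLaw n l l' ν) := by
        refine iIndepFun_ptCount l l' ν _ (fun x c => measurableSet_selector _ (hA x) c) ?_
        intro i j hij c
        exact Set.disjoint_prod.2 (Or.inl ((hd hij).preimage _))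
      rw [hset, measureReal_forall_eq hind fun x => hTm _ _ (hA x.1),
        measureReal_forall_eq hind' fun i => hTm _ _ (hA i), ← Finset.prod_mul_distrib,
        Fintype.prod_prod_type]
      refine Finset.prod_congr rfl fun i _ => ?_
      rw [Fintype.prod_bool]
      have e1 : f (i, true) = T κ (A i) := by simp [hf]
      have e2 : f (i, false) = T (fun a => !κ a) (A i) := by simp [hf]
      have hlaw : ∀ κ', (confLaw n l l' ν).map (T κ' (A i)) =
          poissonMeasure (ptMean l l' ν (selector s κ' (A i))) := fun κ' =>
        map_ptCount l l' ν _ fun c => measurableSet_selector _ (hA i) c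
      rw [e1, e2, hlaw, hlaw, hlaw, hpb _ (hA i), hpw _ (hA i), hone _ (hA i)]
      exact poissonMeasure_real_thinning hp0 hp1 _ (hk i)
    · push Not at hk
      obtain ⟨i, hi⟩ := hk
      have hempty : ({ω | ∀ i, T (fun _ => true) (A i) ω = N i ∧ T κ (A i) ω = k i} :
          Set (Conf n)) = ∅ := by
        refine Set.eq_empty_of_forall_notMem fun ω hω => ?_
        have h1 := hω i
        have h2 : T (fun _ => true) (A i) ω = T κ (A i) ω + T (fun a => !κ a) (A i) ω :=
          ptCount_selector_add s κ (A i) ω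
        omega
      rw [hempty, Finset.prod_eq_zero (Finset.mem_univ i)]
      · simp
      · simp [Nat.choose_eq_zero_of_lt hi]

end

section

/-! ### Exchanging two events by resampling -/

section Exchange

variable {S : Type*} [MeasurableSpace S] {μ : Measure S} [IsProbabilityMeasure μ]
  {comb : S → S → S} {G β : Set S}

/-- The resampling `comb y ·` makes `G` at least as likely as `β`, and not negligible. -/
def Exchangeable (μ : Measure S) (comb : S → S → S) (G β : Set S) (y : S) : Prop :=
  μ {y' | comb y y' ∈ β} ≤ μ {y' | comb y y' ∈ G} ∧ μ {y' | comb y y' ∈ G} ≠ 0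

open Classical in
/-- The density, with respect to `μ.prod μ`, at which `y` moves to `comb y y'`: from `β`, the move
is to a resample conditioned to lie in `G`, and the reverse moves have the same rate. -/
def exchangeRate (μ : Measure S) (comb : S → S → S) (G β : Set S) (y y' : S) : ENNReal :=
  if Exchangeable μ comb G β y ∧ (y ∈ β ∧ comb y y' ∈ G ∨ y ∈ G ∧ comb y y' ∈ β) then
    (μ {u | comb y u ∈ G})⁻¹ else 0

lemma measurable_exchangeRate (hc : Measurable fun p : S × S => comb p.1 p.2)
    (hG : MeasurableSet G) (hβ : MeasurableSet β) :
    Measurable fun p : S × S => exchangeRate μ comb G β p.1 p.2 := by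
  have hm : ∀ {A : Set S}, MeasurableSet A → Measurable fun y => μ {u | comb y u ∈ A} :=
    fun hA => measurable_measure_prodMk_left (hc hA)
  have h1 : MeasurableSet {p : S × S | Exchangeable μ comb G β p.1} :=
    measurable_fst ((measurableSet_le (hm hβ) (hm hG)).inter
      (hm hG (measurableSet_singleton 0)).compl)
  refine Measurable.ite (h1.inter ?_) ((hm hG).inv.comp measurable_fst) measurable_const
  exact ((measurable_fst hβ).inter (hc hG)).union ((measurable_fst hG).inter (hc hβ))

lemma lintegral_exchangeRate (hc : Measurable fun p : S × S => comb p.1 p.2)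
    (hG : MeasurableSet G) (hβ : MeasurableSet β) (hd : Disjoint G β) (y : S) :
    ∫⁻ y', exchangeRate μ comb G β y y' ∂μ ≤ 1 ∧
      (Exchangeable μ comb G β y → y ∈ β → ∫⁻ y', exchangeRate μ comb G β y y' ∂μ = 1) := by
  have hm : ∀ {A : Set S}, MeasurableSet A → MeasurableSet {u | comb y u ∈ A} :=
    fun hA => (hc.comp measurable_prodMk_left) hA
  by_cases hok : Exchangeable μ comb G β y
  swap
  · simp [exchangeRate, hok]
  have h0 := hok.2
  have htop : μ {u | comb y u ∈ G} ≠ ⊤ := measure_ne_top _ _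
  by_cases hyβ : y ∈ β
  · have hyG : y ∉ G := fun h => Set.disjoint_left.1 hd h hyβ
    have e : ∀ y', exchangeRate μ comb G β y y' =
        {u | comb y u ∈ G}.indicator (fun _ => (μ {u | comb y u ∈ G})⁻¹) y' := by
      intro y'
      by_cases h : comb y y' ∈ G
      · rw [exchangeRate, if_pos ⟨hok, Or.inl ⟨hyβ, h⟩⟩]
        exact (Set.indicator_of_mem (show y' ∈ {u | comb y u ∈ G} from h)
          fun _ => (μ {u | comb y u ∈ G})⁻¹).symm
      · rw [exchangeRate, if_neg (fun hh => hh.2.elim (fun h' => h h'.2) fun h' => hyG h'.1)]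
        exact (Set.indicator_of_notMem (show y' ∉ {u | comb y u ∈ G} from h)
          fun _ => (μ {u | comb y u ∈ G})⁻¹).symm
    have : ∫⁻ y', exchangeRate μ comb G β y y' ∂μ = 1 := by
      simp_rw [e]
      rw [lintegral_indicator_const (hm hG), ENNReal.inv_mul_cancel h0 htop]
    exact ⟨this.le, fun _ _ => this⟩
  refine ⟨?_, fun _ h => absurd h hyβ⟩
  by_cases hyG : y ∈ G
  · have e : ∀ y', exchangeRate μ comb G β y y' =
        {u | comb y u ∈ β}.indicator (fun _ => (μ {u | comb y u ∈ G})⁻¹) y' := by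
      intro y'
      by_cases h : comb y y' ∈ β
      · rw [exchangeRate, if_pos ⟨hok, Or.inr ⟨hyG, h⟩⟩]
        exact (Set.indicator_of_mem (show y' ∈ {u | comb y u ∈ β} from h)
          fun _ => (μ {u | comb y u ∈ G})⁻¹).symm
      · rw [exchangeRate, if_neg (fun hh => hh.2.elim (fun h' => hyβ h'.1) fun h' => h h'.2)]
        exact (Set.indicator_of_notMem (show y' ∉ {u | comb y u ∈ β} from h)
          fun _ => (μ {u | comb y u ∈ G})⁻¹).symm
    simp_rw [e]
    rw [lintegral_indicator_const (hm hβ)]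
    calc _ ≤ (μ {u | comb y u ∈ G})⁻¹ * μ {u | comb y u ∈ G} := mul_le_mul_right hok.1 _
      _ = 1 := ENNReal.inv_mul_cancel h0 htop
  · simp [exchangeRate, hyβ, hyG]

/-- A random point `Y` of law `μ` can be modified, without changing its law, in such a way that it
leaves `β` whenever it is there, by resampling: it moves to `G`. -/
theorem exists_exchange (hc : Measurable fun p : S × S => comb p.1 p.2)
    (hmp : MeasurePreserving (fun p : S × S => (comb p.1 p.2, comb p.2 p.1)) (μ.prod μ)
      (μ.prod μ))
    (hinv : ∀ y y', comb (comb y y') (comb y' y) = y)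
    (habs : ∀ y y' y'', comb (comb y y') y'' = comb y y'')
    (hG : MeasurableSet G) (hβ : MeasurableSet β) (hd : Disjoint G β)
    {Ω : Type*} [MeasurableSpace Ω] (P : Measure Ω) [IsProbabilityMeasure P] {Y : Ω → S}
    (hY : Measurable Y) (hlaw : P.map Y = μ) :
    ∃ P' : Measure ((Ω × S) × Bool), ∃ Y' : (Ω × S) × Bool → S,
      P'.map (fun x => x.1.1) = P ∧ Measurable Y' ∧ P'.map Y' = μ ∧
      ∀ᵐ x ∂P', Exchangeable μ comb G β (Y x.1.1) →
        (Y' x = Y x.1.1 ∧ Y x.1.1 ∉ β) ∨ (∃ y', Y' x = comb (Y x.1.1) y') ∧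
          (Y x.1.1 ∈ β ∧ Y' x ∈ G ∨ Y x.1.1 ∈ G ∧ Y' x ∈ β) := by
  classical
  set w := exchangeRate μ comb G β with hw
  have hwm : Measurable fun p : S × S => w p.1 p.2 := measurable_exchangeRate hc hG hβ
  set W : S → ENNReal := fun y => ∫⁻ y', w y y' ∂μ with hW
  have hWm : Measurable W := hwm.lintegral_prod_right'
  have hW1 : ∀ y, W y ≤ 1 := fun y => (lintegral_exchangeRate hc hG hβ hd y).1
  -- The Boolean tells whether the move is made.
  set D : (Ω × S) × Bool → ENNReal := fun x =>
    if x.2 = true then w (Y x.1.1) x.1.2 else 1 - W (Y x.1.1) with hD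
  set Y' : (Ω × S) × Bool → S := fun x =>
    if x.2 = true then comb (Y x.1.1) x.1.2 else Y x.1.1 with hY'
  have hb : MeasurableSet {x : (Ω × S) × Bool | x.2 = true} :=
    measurable_snd (measurableSet_singleton true)
  have hYp : Measurable fun x : (Ω × S) × Bool => (Y x.1.1, x.1.2) := by fun_prop
  have hDm : Measurable D := Measurable.ite hb (hwm.comp hYp)
    ((measurable_const.sub hWm).comp (by fun_prop))
  have hY'm : Measurable Y' := Measurable.ite hb (hc.comp hYp) (by fun_prop)
  set P' := ((P.prod μ).prod Measure.count).withDensity D with hP'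
  have hint : ∀ F : (Ω × S) × Bool → ENNReal, Measurable F → ∫⁻ x, F x ∂P' =
      ∫⁻ ω, ∫⁻ y', (w (Y ω) y' * F ((ω, y'), true) + (1 - W (Y ω)) * F ((ω, y'), false)) ∂μ
        ∂P := by
    intro F hF
    rw [hP', lintegral_withDensity_eq_lintegral_mul _ hDm hF,
      lintegral_prod _ (hDm.mul hF).aemeasurable, lintegral_prod _
        (hDm.mul hF).lintegral_prod_right'.aemeasurable]
    simp only [lintegral_count, tsum_fintype, Fintype.sum_bool, Pi.mul_apply, hD]
    simp
  -- The moves are reversible, so that they preserve the law.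
  have hsymm : ∀ y y', w (comb y y') (comb y' y) = w y y' := by
    intro y y'
    have hok : Exchangeable μ comb G β (comb y y') ↔ Exchangeable μ comb G β y := by
      simp only [Exchangeable, habs]
    simp only [hw, exchangeRate, habs]
    refine if_congr (and_congr hok ?_) rfl rfl
    rw [← habs y y' (comb y' y), hinv, or_comm, and_comm (a := comb y y' ∈ G),
      and_comm (a := comb y y' ∈ β)]
  have hwy : ∀ y, Measurable fun y' => w y y' := fun y => hwm.comp measurable_prodMk_left
  refine ⟨P', Y', ?_, hY'm, ?_, ?_⟩
  · refine Measure.ext fun A hA => ?_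
    have hA' : MeasurableSet ((fun x : (Ω × S) × Bool => x.1.1) ⁻¹' A) :=
      measurable_fst.comp measurable_fst hA
    rw [Measure.map_apply (by fun_prop) hA, ← lintegral_indicator_one hA',
      hint _ (measurable_one.indicator hA'), ← lintegral_indicator_one hA]
    refine lintegral_congr fun ω => ?_
    have : ∀ y' : S, ∀ b : Bool, ((fun x : (Ω × S) × Bool => x.1.1) ⁻¹' A).indicator
        (1 : (Ω × S) × Bool → ENNReal) ((ω, y'), b) = A.indicator 1 ω := fun y' b => rfl
    simp only [this]
    simp_rw [← add_mul]
    rw [lintegral_mul_const _ (show Measurable fun y' => w (Y ω) y' + (1 - W (Y ω)) from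
      (hwy (Y ω)).add measurable_const),
      lintegral_add_right _ measurable_const]
    simp only [lintegral_const, measure_univ, mul_one]
    rw [add_tsub_cancel_of_le (hW1 (Y ω)), one_mul]
  · refine Measure.ext_of_lintegral _ fun f hf => ?_
    rw [lintegral_map hf hY'm, hint (fun x => f (Y' x)) (hf.comp hY'm)]
    simp only [hY', if_true, Bool.false_eq_true, if_false]
    have h1 : ∫⁻ ω, ∫⁻ y', (w (Y ω) y' * f (comb (Y ω) y') + (1 - W (Y ω)) * f (Y ω)) ∂μ ∂P =
        ∫⁻ y, ∫⁻ y', (w y y' * f (comb y y') + (1 - W y) * f y) ∂μ ∂μ := by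
      conv_rhs => rw [← hlaw]
      rw [lintegral_map _ hY]
      · rw [hlaw]
      · have hm : Measurable fun p : S × S =>
            w p.1 p.2 * f (comb p.1 p.2) + (1 - W p.1) * f p.1 :=
          (hwm.mul (hf.comp hc)).add (((measurable_const.sub hWm).comp measurable_fst).mul
            (hf.comp measurable_fst))
        rw [hlaw]
        exact hm.lintegral_prod_right'
    have h2 : ∫⁻ y, ∫⁻ y', w y y' * f (comb y y') ∂μ ∂μ = ∫⁻ y, W y * f y ∂μ := by
      have hm : Measurable fun p : S × S => w p.1 p.2 * f (comb p.1 p.2) :=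
        hwm.mul (hf.comp hc)
      have hm' : Measurable fun p : S × S => w p.1 p.2 * f p.1 :=
        hwm.mul (hf.comp measurable_fst)
      rw [← lintegral_prod _ hm.aemeasurable, ← hmp.lintegral_comp hm]
      simp only [hsymm, hinv]
      rw [lintegral_prod _ hm'.aemeasurable]
      refine lintegral_congr fun y => ?_
      simp only
      rw [lintegral_mul_const _ (show Measurable fun y' => w y y' from hwy y)]
    have h3 : ∀ y, ∫⁻ y', (w y y' * f (comb y y') + (1 - W y) * f y) ∂μ =
        (∫⁻ y', w y y' * f (comb y y') ∂μ) + (1 - W y) * f y := by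
      intro y
      rw [lintegral_add_right _ measurable_const]
      simp
    have h4 : Measurable fun y => (1 - W y) * f y := (measurable_const.sub hWm).mul hf
    rw [h1]
    simp_rw [h3]
    rw [lintegral_add_right _ h4, h2, ← lintegral_add_right _ h4]
    refine lintegral_congr fun y => ?_
    rw [← add_mul, add_tsub_cancel_of_le (hW1 y), one_mul]
  · rw [hP', ae_withDensity_iff hDm]
    refine ae_of_all _ ?_
    rintro ⟨⟨ω, y'⟩, b⟩ hne hok
    cases b
    · left
      refine ⟨by simp [hY'], fun hyβ => hne ?_⟩
      simp only [hD, Bool.false_eq_true, if_false]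
      rw [hW]
      simp only
      rw [(lintegral_exchangeRate hc hG hβ hd (Y ω)).2 hok hyβ, tsub_self]
    · right
      simp only [hD, if_true, hw, exchangeRate] at hne
      have h := (ite_ne_right_iff.1 hne).1.2
      exact ⟨⟨y', by simp [hY']⟩, by simpa [hY'] using h⟩

end Exchange

end

section

/-! ### Resampling near a cell -/

section ProdSwap

variable {A B : Type*} [MeasurableSpace A] [MeasurableSpace B] {α : Measure A} {β : Measure B}
  [SFinite α] [SFinite β]

lemma lintegral_prod_prod {H : (A × B) × A × B → ENNReal} (hH : Measurable H) :
    ∫⁻ p, H p ∂((α.prod β).prod (α.prod β)) =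
      ∫⁻ o, ∫⁻ o', ∫⁻ f, ∫⁻ f', H ((o, f), (o', f')) ∂β ∂β ∂α ∂α := by
  have h1 : Measurable fun q : A × B => ∫⁻ q', H (q, q') ∂(α.prod β) := hH.lintegral_prod_right'
  rw [lintegral_prod _ hH.aemeasurable, lintegral_prod _ h1.aemeasurable]
  refine lintegral_congr fun o => ?_
  have h2 : Measurable fun x : (B × A) × B => H ((o, x.1.1), (x.1.2, x.2)) := by fun_prop
  have h3 : Measurable fun x : B × A => ∫⁻ f', H ((o, x.1), (x.2, f')) ∂β :=
    h2.lintegral_prod_right'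
  calc ∫⁻ f, ∫⁻ q', H ((o, f), q') ∂(α.prod β) ∂β
      = ∫⁻ f, ∫⁻ o', ∫⁻ f', H ((o, f), (o', f')) ∂β ∂α ∂β :=
        lintegral_congr fun f => lintegral_prod _ (by fun_prop)
    _ = _ := lintegral_lintegral_swap h3.aemeasurable

lemma measurePreserving_swapFst :
    MeasurePreserving (fun p : (A × B) × A × B => ((p.2.1, p.1.2), (p.1.1, p.2.2)))
      ((α.prod β).prod (α.prod β)) ((α.prod β).prod (α.prod β)) := by
  refine ⟨by fun_prop, Measure.ext_of_lintegral _ fun F hF => ?_⟩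
  rw [lintegral_map hF (by fun_prop), lintegral_prod_prod (by fun_prop), lintegral_prod_prod hF]
  have h1 : Measurable fun x : ((A × A) × B) × B => F ((x.1.1.2, x.1.2), (x.1.1.1, x.2)) := by
    fun_prop
  exact lintegral_lintegral_swap
    (h1.lintegral_prod_right'.lintegral_prod_right').aemeasurable

/-- Exchanging none, either or both of the components of two independent samples. -/
lemma measurePreserving_swapIf (u v : Prop) [Decidable u] [Decidable v] :
    MeasurePreserving (fun p : (A × B) × A × B =>
      ((if u then p.2.1 else p.1.1, if v then p.2.2 else p.1.2),
        (if u then p.1.1 else p.2.1, if v then p.1.2 else p.2.2)))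
      ((α.prod β).prod (α.prod β)) ((α.prod β).prod (α.prod β)) := by
  by_cases hu : u <;> by_cases hv : v <;> simp only [hu, hv, if_true, if_false]
  · exact Measure.measurePreserving_swap
  · exact measurePreserving_swapFst
  · exact Measure.measurePreserving_swap.comp measurePreserving_swapFst
  · exact MeasurePreserving.id _

end ProdSwap

/-- The cell `c` lies in the block of `9 × 9` cells centred at `t`. -/
def Tile.Near {n : ℕ} (t c : Tile n) : Prop :=
  ∃ u v : ℤ, |u| ≤ 4 ∧ |v| ≤ 4 ∧ c = t + ((u : ZMod n), (v : ZMod n))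

lemma Tile.near_self {n : ℕ} (t : Tile n) : t.Near t := ⟨0, 0, by simp, by simp, by simp⟩

/-- The position of a cell modulo `9`. -/
def Tile.residue {n : ℕ} (t : Tile n) : Fin 9 × Fin 9 :=
  ((ZMod.cast t.1 : ZMod 9), (ZMod.cast t.2 : ZMod 9))

lemma eq_of_cast_eq {n : ℕ} (hn : 9 ∣ n) {x x' y : ZMod n} {u u' : ℤ} (hu : |u| ≤ 4)
    (hu' : |u'| ≤ 4) (h : y = x + u) (h' : y = x' + u')
    (hc : (ZMod.cast x : ZMod 9) = ZMod.cast x') : x = x' := by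
  have h1 : x - x' = ((u' - u : ℤ) : ZMod n) := by
    push_cast; linear_combination h' - h
  have h2 : ((u' - u : ℤ) : ZMod 9) = 0 := by
    have := congrArg (ZMod.cast : ZMod n → ZMod 9) h1
    rw [ZMod.cast_sub hn, hc, sub_self, ZMod.cast_intCast hn] at this
    exact this.symm
  rw [ZMod.intCast_zmod_eq_zero_iff_dvd] at h2
  rw [abs_le] at hu hu'
  have h3 : u' - u = 0 := by
    obtain ⟨k, hk⟩ := h2
    push_cast at hk
    omega
  rw [h3, Int.cast_zero] at h1
  exact sub_eq_zero.1 h1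

/-- Blocks centred at distinct cells of the same residue are disjoint. -/
lemma Tile.eq_of_near {n : ℕ} (hn : 9 ∣ n) {t t' c : Tile n} (h : t.Near c) (h' : t'.Near c)
    (hr : t.residue = t'.residue) : t = t' := by
  obtain ⟨u, v, hu, hv, rfl⟩ := h
  obtain ⟨u', v', hu', hv', heq⟩ := h'
  rw [Prod.ext_iff] at heq
  have hr' := Prod.ext_iff.1 hr
  exact Prod.ext (eq_of_cast_eq hn hu hu' rfl heq.1 hr'.1)
    (eq_of_cast_eq hn hv hv' rfl heq.2 hr'.2)

variable {n : ℕ}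

open Classical in
/-- Replace the data of the cell `t`, and all data in its block except the positions of the
ordinary points, by those of `y'`. -/
def resample (t : Tile n) (y y' : Conf n) : Conf n := fun c =>
  (if c = t then (y' c).1 else (y c).1, if t.Near c then (y' c).2 else (y c).2)

lemma measurable_resample (t : Tile n) :
    Measurable fun p : Conf n × Conf n => resample t p.1 p.2 := by
  classical
  refine measurable_pi_lambda _ fun c => ?_
  refine Measurable.prodMk ?_ ?_
  · by_cases h : c = t
    · simp only [if_pos h]; fun_prop
    · simp only [if_neg h]; fun_prop
  · by_cases h : t.Near c
    · simp only [if_pos h]; fun_prop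
    · simp only [if_neg h]; fun_prop

lemma resample_resample (t : Tile n) (y y' y'' : Conf n) :
    resample t (resample t y y') y'' = resample t y y'' := by
  funext c
  simp only [resample]
  split_ifs <;> rfl

lemma resample_resample_swap (t : Tile n) (y y' : Conf n) :
    resample t (resample t y y') (resample t y' y) = y := by
  funext c
  simp only [resample]
  split_ifs <;> rfl

lemma resample_of_ne {t c : Tile n} (hc : c ≠ t) (y y' : Conf n) :
    (resample t y y' c).1 = (y c).1 := by simp [resample, hc]

lemma resample_of_not_near {t c : Tile n} (hc : ¬ t.Near c) (y y' : Conf n) :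
    resample t y y' c = y c := by
  have : c ≠ t := fun h => hc (h ▸ t.near_self)
  simp [resample, hc, this]

lemma measurePreserving_resample [NeZero n] (l l' : NNReal) (ν : Measure (Fin 3))
    [IsProbabilityMeasure ν] (t : Tile n) :
    MeasurePreserving (fun p : Conf n × Conf n => (resample t p.1 p.2, resample t p.2 p.1))
      ((confLaw n l l' ν).prod (confLaw n l l' ν)) ((confLaw n l l' ν).prod (confLaw n l l' ν)) := by
  classical
  have h1 := measurePreserving_arrowProdEquivProdArrow CellState CellState (Tile n)
    (fun _ => cellLaw l l' ν) (fun _ => cellLaw l l' ν)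
  have h2 := measurePreserving_pi
    (fun _ : Tile n => (cellLaw l l' ν).prod (cellLaw l l' ν))
    (fun _ : Tile n => (cellLaw l l' ν).prod (cellLaw l l' ν))
    (fun c => measurePreserving_swapIf (α := ordLaw l) (β := freeLaw l' ν) (c = t) (t.Near c))
  exact (h1.comp h2).comp (h1.symm _)

/-! ### Good and bad cells -/

/-- The configuration is good at `t` if all cells of the block of `t` contain an extra point, and
all ordinary points in the block have mark `2`. The labels, which carry the residue of `t`, force
the blocks of distinct good cells to be disjoint. -/
def goodAt (t : Tile n) : Set (Conf n) :=
  {y | ∀ c, t.Near c → 1 ≤ (y c).xnum ∧ (∀ i < (y c).num, (y c).mark i = 2) ∧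
    (y c).label = t.residue}

lemma measurableSet_goodAt [NeZero n] (t : Tile n) : MeasurableSet (goodAt t) := by
  change MeasurableSet {y : Conf n | ∀ c, t.Near c → _ ∧ _ ∧ _}
  simp only [Set.ofPred_forall, Set.ofPred_and]
  refine MeasurableSet.iInter fun c => MeasurableSet.iInter fun _ => ?_
  refine MeasurableSet.inter (measurableSet_le (by fun_prop) (by fun_prop))
    (MeasurableSet.inter (MeasurableSet.iInter fun i => ?_)
      (measurableSet_eq_fun (by fun_prop) (by fun_prop)))
  convert (measurableSet_lt (measurable_const (a := i))
    (show Measurable fun y : Conf n => (y c).num by fun_prop)).compl.union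
    (measurableSet_eq_fun (show Measurable fun y : Conf n => (y c).mark i by fun_prop)
      (measurable_const (a := (2 : Fin 3)))) using 1
  ext y
  exact imp_iff_not_or

/-- The relation between the initial configuration `y₀` and the configuration `y` obtained by
treating the cells in `L`, a bad one by the exchange with a good one. The cells in `fixed` have
become good, and the cells in `broken` were good. Away from these the configuration is unchanged,
and outside of them each treated cell was not bad, at the time of its treatment. -/
structure Coupled (bad : Tile n → Set (Conf n)) (L : Set (Tile n)) (y₀ y : Conf n)
    (fixed broken : Set (Tile n)) : Prop where
  fixed_subset : fixed ⊆ L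
  broken_subset : broken ⊆ L
  fixed_good : ∀ t ∈ fixed, ∀ c, t.Near c → 1 ≤ (y c).xnum ∧
    (∀ i < (y c).num, (y c).mark i = 2) ∧ ∃ t' ∈ fixed, t'.Near c ∧ (y c).label = t'.residue
  broken_good : ∀ t ∈ broken, ∀ c, t.Near c → 1 ≤ (y₀ c).xnum ∧
    ∀ i < (y₀ c).num, (y₀ c).mark i = 2
  ord_eq : ∀ c, c ∉ fixed → c ∉ broken → (y c).1 = (y₀ c).1
  eq_of_not_near : ∀ c, (∀ t ∈ fixed ∪ broken, ¬ t.Near c) → y c = y₀ c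
  not_bad : ∀ t ∈ L, t ∉ fixed → t ∉ broken →
    ∃ z ∉ bad t, ∀ c, c ∉ fixed → c ∉ broken → (z c).1 = (y₀ c).1

lemma Coupled.refl (bad : Tile n → Set (Conf n)) (y : Conf n) : Coupled bad ∅ y y ∅ ∅ where
  fixed_subset := subset_rfl
  broken_subset := subset_rfl
  fixed_good := by simp
  broken_good := by simp
  ord_eq := by simp
  eq_of_not_near := by simp
  not_bad := by simp

/-- Treating one more cell. -/
lemma Coupled.step (hn : 9 ∣ n) {bad : Tile n → Set (Conf n)} {L : Set (Tile n)} {y₀ y y' : Conf n}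
    {fixed broken : Set (Tile n)} (h : Coupled bad L y₀ y fixed broken) {t : Tile n} (ht : t ∉ L)
    (hy : (y' = y ∧ y ∉ bad t \ goodAt t) ∨ (∃ z, y' = resample t y z) ∧
      (y ∈ bad t \ goodAt t ∧ y' ∈ goodAt t ∨ y ∈ goodAt t ∧ y' ∈ bad t \ goodAt t)) :
    ∃ fixed' broken', Coupled bad (insert t L) y₀ y' fixed' broken' := by
  have mono : ∀ {fixed' broken'}, fixed ⊆ fixed' → broken ⊆ broken' →
      (t ∉ fixed' → t ∉ broken' →
        ∃ z ∉ bad t, ∀ c, c ∉ fixed' → c ∉ broken' → (z c).1 = (y₀ c).1) →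
      ∀ u ∈ insert t L, u ∉ fixed' → u ∉ broken' →
        ∃ z ∉ bad u, ∀ c, c ∉ fixed' → c ∉ broken' → (z c).1 = (y₀ c).1 := by
    intro fixed' broken' hf hb hnew u hu huf hub
    rcases Set.mem_insert_iff.1 hu with rfl | hu
    · exact hnew huf hub
    · obtain ⟨z, hz, hzc⟩ := h.not_bad u hu (fun hh => huf (hf hh)) (fun hh => hub (hb hh))
      exact ⟨z, hz, fun c hcf hcb => hzc c (fun hh => hcf (hf hh)) (fun hh => hcb (hb hh))⟩
  have hLf : fixed ⊆ insert t L := h.fixed_subset.trans (Set.subset_insert _ _)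
  have hLb : broken ⊆ insert t L := h.broken_subset.trans (Set.subset_insert _ _)
  -- The case in which `t` is good at the end.
  have hfix : y' ∈ goodAt t → (y' = y ∨ ∃ z, y' = resample t y z) →
      Coupled bad (insert t L) y₀ y' (insert t fixed) broken := by
    intro hgood hmove
    have hne : ∀ c, c ≠ t → (y' c).1 = (y c).1 := by
      rintro c hc
      rcases hmove with rfl | ⟨z, rfl⟩
      · rfl
      · exact resample_of_ne hc y z
    have hnn : ∀ c, ¬ t.Near c → y' c = y c := by
      rintro c hc
      rcases hmove with rfl | ⟨z, rfl⟩
      · rfl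
      · exact resample_of_not_near hc y z
    refine ⟨Set.insert_subset (Set.mem_insert _ _) hLf, hLb, ?_, h.broken_good, ?_, ?_, ?_⟩
    · intro u hu c huc
      by_cases htc : t.Near c
      · obtain ⟨h1, h2, h3⟩ := hgood c htc
        exact ⟨h1, h2, t, Set.mem_insert _ _, htc, h3⟩
      · rcases Set.mem_insert_iff.1 hu with rfl | hu
        · exact absurd huc htc
        · rw [hnn c htc]
          obtain ⟨h1, h2, t', h3, h4⟩ := h.fixed_good u hu c huc
          exact ⟨h1, h2, t', Set.mem_insert_of_mem _ h3, h4⟩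
    · intro c hcf hcb
      rw [Set.mem_insert_iff, not_or] at hcf
      rw [hne c hcf.1, h.ord_eq c hcf.2 hcb]
    · intro c hc
      rw [hnn c (hc t (Or.inl (Set.mem_insert _ _)))]
      exact h.eq_of_not_near c fun u hu => hc u (hu.imp (Set.mem_insert_of_mem _) id)
    · exact mono (Set.subset_insert _ _) subset_rfl fun hh => absurd (Set.mem_insert _ _) hh
  rcases hy with ⟨rfl, hnb⟩ | ⟨⟨z, rfl⟩, ⟨-, hgood⟩ | ⟨hgood, -⟩⟩
  · by_cases hg : y' ∈ goodAt t
    · exact ⟨_, _, hfix hg (Or.inl rfl)⟩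
    · refine ⟨fixed, broken, hLf, hLb, h.fixed_good, h.broken_good, h.ord_eq, h.eq_of_not_near,
        mono subset_rfl subset_rfl fun _ _ => ⟨y', fun hb => hnb ⟨hb, hg⟩, h.ord_eq⟩⟩
  · exact ⟨_, _, hfix hgood (Or.inr ⟨z, rfl⟩)⟩
  · -- By the labels, the block of `t` is disjoint from the blocks of the fixed cells.
    have hsep : ∀ u ∈ fixed, ∀ c, u.Near c → ¬ t.Near c := by
      intro u hu c huc htc
      obtain ⟨-, -, t', ht', hnear, hlab⟩ := h.fixed_good u hu c huc
      have := Tile.eq_of_near hn htc hnear ((hgood c htc).2.2.symm.trans hlab)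
      exact ht (this ▸ h.fixed_subset ht')
    refine ⟨fixed, insert t broken, hLf, Set.insert_subset (Set.mem_insert _ _) hLb, ?_, ?_, ?_,
      ?_, ?_⟩
    · intro u hu c huc
      rw [resample_of_not_near (hsep u hu c huc)]
      exact h.fixed_good u hu c huc
    · intro u hu c huc
      rcases Set.mem_insert_iff.1 hu with rfl | hu
      · by_cases hbr : ∃ v ∈ broken, v.Near c
        · obtain ⟨v, hv, hvc⟩ := hbr
          exact h.broken_good v hv c hvc
        · have : y c = y₀ c := by
            refine h.eq_of_not_near c fun v hv hvc => ?_
            rcases hv with hv | hv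
            · exact hsep v hv c hvc huc
            · exact hbr ⟨v, hv, hvc⟩
          rw [← this]
          exact ⟨(hgood c huc).1, (hgood c huc).2.1⟩
      · exact h.broken_good u hu c huc
    · intro c hcf hcb
      rw [Set.mem_insert_iff, not_or] at hcb
      rw [resample_of_ne hcb.1, h.ord_eq c hcf hcb.2]
    · intro c hc
      rw [resample_of_not_near (hc t (Or.inr (Set.mem_insert _ _)))]
      exact h.eq_of_not_near c fun u hu => hc u (hu.imp id (Set.mem_insert_of_mem _))
    · exact mono subset_rfl (Set.subset_insert _ _) fun _ hh => absurd (Set.mem_insert _ _) hh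

/-- The coupling: two configurations with the same law that are coupled, along all cells of `L`,
with high probability. -/
theorem exists_coupled [NeZero n] (hn : 9 ∣ n) (l l' : NNReal) (ν : Measure (Fin 3))
    [IsProbabilityMeasure ν] {bad : Tile n → Set (Conf n)} (hbad : ∀ t, MeasurableSet (bad t))
    {θ : ENNReal} (hθ : ∀ t, confLaw n l l' ν
      {y | ¬ Exchangeable (confLaw n l l' ν) (resample t) (goodAt t) (bad t \ goodAt t) y} ≤ θ)
    (L : Finset (Tile n)) :
    ∃ (Ω : Type) (_ : MeasurableSpace Ω) (P : Measure Ω) (Y₀ Y : Ω → Conf n),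
      IsProbabilityMeasure P ∧ Measurable Y₀ ∧ Measurable Y ∧
      P.map Y₀ = confLaw n l l' ν ∧ P.map Y = confLaw n l l' ν ∧
      P {ω | ¬ ∃ fixed broken, Coupled bad L (Y₀ ω) (Y ω) fixed broken} ≤ L.card * θ := by
  classical
  induction L using Finset.induction_on with
  | empty =>
    refine ⟨Conf n, inferInstance, confLaw n l l' ν, id, id, inferInstance, measurable_id,
      measurable_id, Measure.map_id, Measure.map_id, ?_⟩
    have : {ω : Conf n | ¬ ∃ fixed broken,
        Coupled bad (∅ : Finset (Tile n)) (id ω) (id ω) fixed broken} = ∅ := by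
      refine Set.eq_empty_of_forall_notMem fun ω hω => hω ⟨∅, ∅, ?_⟩
      rw [Finset.coe_empty]
      exact Coupled.refl bad ω
    rw [this]; simp
  | insert t L ht ih =>
    obtain ⟨Ω, _, P, Y₀, Y, _, hY₀, hY, hlaw₀, hlaw, hfail⟩ := ih
    obtain ⟨P', Y', hfst, hY', hlaw', hae⟩ := exists_exchange (measurable_resample t)
      (measurePreserving_resample l l' ν t) (resample_resample_swap t) (resample_resample t)
      (measurableSet_goodAt t) ((hbad t).diff (measurableSet_goodAt t)) Set.disjoint_sdiff_right P
      hY hlaw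
    have hm : Measurable fun x : (Ω × Conf n) × Bool => x.1.1 := by fun_prop
    have hP' : IsProbabilityMeasure P' := ⟨by
      rw [← Set.preimage_univ (f := fun x : (Ω × Conf n) × Bool => x.1.1),
        ← Measure.map_apply hm MeasurableSet.univ, hfst, measure_univ]⟩
    refine ⟨_, inferInstance, P', fun x => Y₀ x.1.1, Y', hP', hY₀.comp hm, hY', ?_, hlaw', ?_⟩
    · rw [← hlaw₀, ← hfst, Measure.map_map hY₀ hm]; rfl
    have hsub : {x : (Ω × Conf n) × Bool | ¬ ∃ fixed broken,
        Coupled bad (insert t L : Finset (Tile n)) (Y₀ x.1.1) (Y' x) fixed broken} ⊆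
        ((fun x => x.1.1) ⁻¹' {ω | ¬ ∃ fixed broken, Coupled bad L (Y₀ ω) (Y ω) fixed broken} ∪
        (fun x => x.1.1) ⁻¹' (Y ⁻¹' {y | ¬ Exchangeable (confLaw n l l' ν) (resample t) (goodAt t)
          (bad t \ goodAt t) y})) ∪
        {x | ¬ (Exchangeable (confLaw n l l' ν) (resample t) (goodAt t) (bad t \ goodAt t)
          (Y x.1.1) →
        (Y' x = Y x.1.1 ∧ Y x.1.1 ∉ bad t \ goodAt t) ∨
          (∃ y', Y' x = resample t (Y x.1.1) y') ∧
          (Y x.1.1 ∈ bad t \ goodAt t ∧ Y' x ∈ goodAt t ∨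
            Y x.1.1 ∈ goodAt t ∧ Y' x ∈ bad t \ goodAt t))} := by
      intro x hx
      by_contra hcon
      simp only [Set.mem_union, not_or] at hcon
      obtain ⟨⟨h1, h2⟩, h3⟩ := hcon
      obtain ⟨fixed, broken, hc⟩ := not_not.1 h1
      refine hx ?_
      rw [Finset.coe_insert]
      exact hc.step hn (by simpa using ht) (not_not.1 h3 (not_not.1 h2))
    refine (measure_mono hsub).trans ((measure_union_le _ _).trans ?_)
    rw [ae_iff.1 hae, add_zero]
    refine (measure_union_le _ _).trans ?_
    rw [Finset.card_insert_of_notMem ht, Nat.cast_add, Nat.cast_one, add_mul, one_mul]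
    refine add_le_add ?_ ?_
    · refine (Measure.le_map_apply hm.aemeasurable _).trans ?_
      rw [hfst]; exact hfail
    · refine (Measure.le_map_apply hm.aemeasurable _).trans ?_
      rw [hfst]
      refine (Measure.le_map_apply hY.aemeasurable _).trans ?_
      rw [hlaw]; exact hθ t

end

/-! ### Estimates of probabilities -/

/-- The tail of the Poisson distribution. -/
lemma poissonMeasure_Ici_le (l : NNReal) (m : ℕ) :
    poissonMeasure l {k | m ≤ k} ≤ (l : ENNReal) ^ m := by
  have hterm : ∀ k, poissonMeasure l {k + m} ≤ (l : ENNReal) ^ m * poissonMeasure l {k} := by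
    intro k
    rw [poissonMeasure_singleton, poissonMeasure_singleton, ← ENNReal.ofReal_coe_nnreal (p := l),
      ← ENNReal.ofReal_pow l.coe_nonneg, ← ENNReal.ofReal_mul (by positivity)]
    refine ENNReal.ofReal_le_ofReal ?_
    have hf : (k.factorial : ℝ) ≤ (k + m).factorial := by
      exact_mod_cast Nat.factorial_le (Nat.le_add_right k m)
    rw [pow_add]
    calc Real.exp (-l) * ((l : ℝ) ^ k * l ^ m) / (k + m).factorial
        ≤ Real.exp (-l) * ((l : ℝ) ^ k * l ^ m) / k.factorial := by gcongr
      _ = _ := by ring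
  have hset : {k | m ≤ k} = ⋃ k : ℕ, {k + m} := by
    ext j
    simp only [Set.mem_ofPred_eq, Set.mem_iUnion, Set.mem_singleton_iff]
    exact ⟨fun h => ⟨j - m, by omega⟩, by rintro ⟨k, rfl⟩; omega⟩
  have hone : ∑' k, poissonMeasure l {k} = 1 := by
    rw [← measure_univ (μ := poissonMeasure l), ← Measure.tsum_indicator_apply_singleton _ _ .univ]
    simp
  rw [hset]
  refine (measure_iUnion_le _).trans ((ENNReal.tsum_le_tsum hterm).trans ?_)
  rw [ENNReal.tsum_mul_left, hone, mul_one]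

/-- Resampling one coordinate of an infinite product. -/
lemma measurePreserving_update {E : Type*} [MeasurableSpace E] (ν : Measure E)
    [IsProbabilityMeasure ν] (i : ℕ) :
    MeasurePreserving (fun p : (ℕ → E) × E => Function.update p.1 i p.2)
      ((Measure.infinitePi fun _ : ℕ => ν).prod ν) (Measure.infinitePi fun _ : ℕ => ν) := by
  have hm : Measurable fun p : (ℕ → E) × E => Function.update p.1 i p.2 := by
    refine measurable_pi_lambda _ fun j => ?_
    by_cases h : j = i
    · subst h; simp only [Function.update_self]; fun_prop
    · simp only [Function.update_of_ne h]; fun_prop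
  refine ⟨hm, Measure.eq_infinitePi _ fun s t ht => ?_⟩
  rw [Measure.map_apply hm (MeasurableSet.pi s.countable_toSet fun j _ => ht j)]
  have hpre : (fun p : (ℕ → E) × E => Function.update p.1 i p.2) ⁻¹' Set.pi s t =
      Set.pi (s.erase i : Finset ℕ) t ×ˢ (if i ∈ s then t i else Set.univ) := by
    ext ⟨x, u⟩
    simp only [Set.mem_preimage, Set.mem_pi, Finset.mem_coe, Set.mem_prod, Finset.mem_erase]
    constructor
    · intro h
      refine ⟨fun j hj => by simpa [Function.update_of_ne hj.1] using h j hj.2, ?_⟩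
      split_ifs with hi
      · simpa using h i hi
      · trivial
    · rintro ⟨h1, h2⟩ j hj
      by_cases hji : j = i
      · subst hji; simpa [hj] using h2
      · simpa [Function.update_of_ne hji] using h1 j ⟨hji, hj⟩
  rw [hpre, Measure.prod_prod, Measure.infinitePi_pi _ fun j _ => ht j]
  split_ifs with hi
  · rw [mul_comm, Finset.mul_prod_erase s (fun j => ν (t j)) hi]
  · rw [measure_univ, mul_one, Finset.erase_eq_of_notMem hi]

lemma infinitePi_le_of_update {E : Type*} [MeasurableSpace E] {ν : Measure E}
    [IsProbabilityMeasure ν] (i : ℕ) {A : Set (ℕ → E)} (hA : MeasurableSet A) {ε : ENNReal}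
    (h : ∀ x, ν {u | Function.update x i u ∈ A} ≤ ε) :
    (Measure.infinitePi fun _ : ℕ => ν) A ≤ ε := by
  have hmp := measurePreserving_update ν i
  rw [← hmp.measure_preimage hA.nullMeasurableSet,
    Measure.prod_apply (hmp.measurable hA)]
  calc _ ≤ ∫⁻ _, ε ∂(Measure.infinitePi fun _ : ℕ => ν) := lintegral_mono fun x => h x
    _ = ε := by simp

/-- The points of the line whose square lies in a given short interval. -/
lemma volume_sq_mem_Ico_le (A : ℝ) {η : ℝ} (hη : 0 ≤ η) :
    volume {x : ℝ | A ≤ x ^ 2 ∧ x ^ 2 < A + η} ≤ ENNReal.ofReal (2 * √η) := by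
  rcases le_total 0 A with hA | hA
  · have hsub : {x : ℝ | A ≤ x ^ 2 ∧ x ^ 2 < A + η} ⊆
        Set.Icc (-√(A + η)) (-√A) ∪ Set.Icc (√A) (√(A + η)) := by
      rintro x ⟨h1, h2⟩
      have h3 : √A ≤ |x| := by rw [← Real.sqrt_sq_eq_abs]; exact Real.sqrt_le_sqrt h1
      have h4 : |x| ≤ √(A + η) := by rw [← Real.sqrt_sq_eq_abs]; exact Real.sqrt_le_sqrt h2.le
      rcases le_total 0 x with hx | hx
      · rw [abs_of_nonneg hx] at h3 h4; exact Or.inr ⟨h3, h4⟩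
      · rw [abs_of_nonpos hx] at h3 h4; exact Or.inl ⟨by linarith, by linarith⟩
    have hs : √(A + η) - √A ≤ √η := by
      have : √(A + η) ≤ √A + √η := by
        rw [Real.sqrt_le_left (by positivity), add_sq, Real.sq_sqrt hA, Real.sq_sqrt hη]
        have : 0 ≤ √A * √η := by positivity
        linarith
      linarith
    calc _ ≤ volume (Set.Icc (-√(A + η)) (-√A) ∪ Set.Icc (√A) (√(A + η))) := measure_mono hsub
      _ ≤ volume (Set.Icc (-√(A + η)) (-√A)) + volume (Set.Icc (√A) (√(A + η))) :=
        measure_union_le _ _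
      _ ≤ ENNReal.ofReal (√η) + ENNReal.ofReal (√η) := by
        rw [Real.volume_Icc, Real.volume_Icc]
        gcongr; linarith
      _ = _ := by rw [← ENNReal.ofReal_add (by positivity) (by positivity)]; ring_nf
  · have hsub : {x : ℝ | A ≤ x ^ 2 ∧ x ^ 2 < A + η} ⊆ Set.Icc (-√η) (√η) := by
      rintro x ⟨-, h2⟩
      have : |x| ≤ √η := by
        rw [← Real.sqrt_sq_eq_abs]; exact Real.sqrt_le_sqrt (by linarith)
      exact abs_le.1 this
    refine (measure_mono hsub).trans ?_
    rw [Real.volume_Icc]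
    exact ENNReal.ofReal_le_ofReal (by linarith)

/-- A uniform point of the unit square rarely lies in a given thin annulus. -/
lemma unitSq_annulus_le {a : ℝ} (ha : 0 < a) {η : ℝ} (hη : 0 ≤ η) (p : ℂ) (R : ℝ) :
    unitSq {o | R ≤ ‖p - (⟨a * o.1, a * o.2⟩ : ℂ)‖ ^ 2 ∧
      ‖p - (⟨a * o.1, a * o.2⟩ : ℂ)‖ ^ 2 < R + η} ≤ ENNReal.ofReal (2 * √η / a) := by
  set A : Set (ℝ × ℝ) := {o | R ≤ (p.re - a * o.1) ^ 2 + (p.im - a * o.2) ^ 2 ∧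
      (p.re - a * o.1) ^ 2 + (p.im - a * o.2) ^ 2 < R + η} with hA
  have hf : Measurable fun o : ℝ × ℝ => (p.re - a * o.1) ^ 2 + (p.im - a * o.2) ^ 2 := by fun_prop
  have hAm : MeasurableSet A := (measurableSet_le measurable_const hf).inter
    (measurableSet_lt hf measurable_const)
  have e : {o : ℝ × ℝ | R ≤ ‖p - (⟨a * o.1, a * o.2⟩ : ℂ)‖ ^ 2 ∧
      ‖p - (⟨a * o.1, a * o.2⟩ : ℂ)‖ ^ 2 < R + η} = A := by
    ext o
    simp only [normSq_eq, Complex.sub_re, Complex.sub_im, hA]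
  have hsq : unitSq = (volume.restrict (Set.Ico (0 : ℝ) 1)).prod
      (volume.restrict (Set.Ico (0 : ℝ) 1)) := by
    rw [unitSq, Measure.volume_eq_prod, Measure.prod_restrict]
  have hprob : IsProbabilityMeasure (volume.restrict (Set.Ico (0 : ℝ) 1)) := ⟨by simp⟩
  rw [e, hsq, Measure.prod_apply_symm hAm]
  refine (lintegral_mono (g := fun _ => ENNReal.ofReal (2 * √η / a)) fun v => ?_).trans (by simp)
  refine (Measure.restrict_apply_le _ _).trans ?_
  have hpre : (fun u => (u, v)) ⁻¹' A = (fun u => (-a) * u) ⁻¹' ((fun x => p.re + x) ⁻¹'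
      {x | R - (p.im - a * v) ^ 2 ≤ x ^ 2 ∧ x ^ 2 < R - (p.im - a * v) ^ 2 + η}) := by
    ext u
    simp only [hA, Set.mem_preimage, Set.mem_ofPred_eq]
    rw [show p.re + -a * u = p.re - a * u by ring]
    constructor <;> rintro ⟨h1, h2⟩ <;> constructor <;> linarith
  rw [hpre, Real.volume_preimage_mul_left (neg_ne_zero.2 ha.ne'), measure_preimage_add]
  refine (mul_le_mul_right (volume_sq_mem_Ico_le _ hη) _).trans ?_
  rw [← ENNReal.ofReal_mul (by positivity), abs_inv, abs_neg, abs_of_pos ha]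
  exact ENNReal.ofReal_le_ofReal (le_of_eq (by ring))

lemma measurable_criticalParam {α : Type*} [MeasurableSpace α] (ζ η : ℝ) (j : Bool ⊕ ℤ)
    {f g : α → ℂ} (hf : Measurable f) (hg : Measurable g) :
    Measurable fun x => criticalParam ζ η (f x) (g x) j := by
  have h1 : Measurable fun x => (f x).re := Complex.measurable_re.comp hf
  have h2 : Measurable fun x => (f x).im := Complex.measurable_im.comp hf
  have h3 : Measurable fun x => (g x).re := Complex.measurable_re.comp hg
  have h4 : Measurable fun x => (g x).im := Complex.measurable_im.comp hg
  cases j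
  · simp only [criticalParam]
    exact (((hg.norm.pow_const 2).sub ((h1.mul h3).add (h2.mul h4))).sub
      measurable_const).div (((h1.mul h4).sub (h2.mul h3)).const_mul 2)
  · simp only [criticalParam]
    exact measurable_const.div hf.norm

/-- The excess of the squared distance from a critical point to `e'` over that to the origin. -/
def excess (ζ η : ℝ) (d e e' : ℂ) (j : Bool ⊕ ℤ) : ℝ :=
  ‖bisPt d (criticalParam ζ η d e j) - e'‖ ^ 2 - ‖bisPt d (criticalParam ζ η d e j)‖ ^ 2

lemma measurable_excess {α : Type*} [MeasurableSpace α] (ζ η : ℝ) (j : Bool ⊕ ℤ)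
    {f g h : α → ℂ} (hf : Measurable f) (hg : Measurable g) (hh : Measurable h) :
    Measurable fun x => excess ζ η (f x) (g x) (h x) j := by
  have hc := Complex.measurable_ofReal.comp (measurable_criticalParam ζ η j hf hg)
  have hb : Measurable fun x => bisPt (f x) (criticalParam ζ η (f x) (g x) j) :=
    (hf.div_const 2).add (hc.mul (hf.const_mul Complex.I))
  exact ((hb.sub hh).norm.pow_const 2).sub (hb.norm.pow_const 2)

section

/-! ### Bad cells are rare, good cells are not too rare -/

variable {n : ℕ}

/-- The position in the plane, relative to the corner of the cell `t`, of the ordinary point with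
number `q.2` of the cell at displacement `q.1` from `t`. -/
def relPos (a : ℝ) (t : Tile n) (y : Conf n) (q : (ℤ × ℤ) × ℕ) : ℂ :=
  ⟨a * (q.1.1 + ((y (t + ((q.1.1 : ZMod n), (q.1.2 : ZMod n)))).pos q.2).1),
    a * (q.1.2 + ((y (t + ((q.1.1 : ZMod n), (q.1.2 : ZMod n)))).pos q.2).2)⟩

/-- The points near the cell `t`: their cells are at most at distance `H` from `t`, in either
coordinate. -/
def nearSites (H : ℕ) (t : Tile n) (y : Conf n) : Set ((ℤ × ℤ) × ℕ) :=
  {q | |q.1.1| ≤ H ∧ |q.1.2| ≤ H ∧ q.2 < (y (t + ((q.1.1 : ZMod n), (q.1.2 : ZMod n)))).num}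

/-- The configuration is bad at `t` if some ordinary point of the cell `t` is in degenerate
position with respect to three other points near `t`. -/
def badAt (a ζ η : ℝ) (K H : ℕ) (t : Tile n) : Set (Conf n) :=
  {y | ∃ i < (y t).num, ∃ q₁ ∈ nearSites H t y, ∃ q₂ ∈ nearSites H t y, ∃ q₃ ∈ nearSites H t y,
    q₁ ≠ (0, i) ∧ q₂ ≠ (0, i) ∧ q₃ ≠ (0, i) ∧
    Degenerate ζ η K (relPos a t y q₂ - relPos a t y q₁) (relPos a t y q₃ - relPos a t y q₁)
      (relPos a t y (0, i) - relPos a t y q₁)}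

lemma measurable_toComplex : Measurable fun o : ℝ × ℝ => (⟨o.1, o.2⟩ : ℂ) :=
  Complex.measurableEquivRealProd.symm.measurable

lemma measurable_relPos (a : ℝ) (t : Tile n) (q : (ℤ × ℤ) × ℕ) :
    Measurable fun y : Conf n => relPos a t y q := by
  refine measurable_toComplex.comp (g := fun o : ℝ × ℝ => (⟨o.1, o.2⟩ : ℂ))
    (f := fun y : Conf n =>
      (a * (q.1.1 + ((y (t + ((q.1.1 : ZMod n), (q.1.2 : ZMod n)))).pos q.2).1),
      a * (q.1.2 + ((y (t + ((q.1.1 : ZMod n), (q.1.2 : ZMod n)))).pos q.2).2))) ?_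
  fun_prop

lemma degenerate_iff (ζ η : ℝ) (K : ℕ) (d e e' : ℂ) : Degenerate ζ η K d e e' ↔
    ∃ j ∈ criticalIndices K, 0 ≤ excess ζ η d e e' j ∧ excess ζ η d e e' j < η := Iff.rfl

lemma measurableSet_degenerate {α : Type*} [MeasurableSpace α] (ζ η : ℝ) (K : ℕ)
    {f g h : α → ℂ} (hf : Measurable f) (hg : Measurable g) (hh : Measurable h) :
    MeasurableSet {x | Degenerate ζ η K (f x) (g x) (h x)} := by
  have e : {x | Degenerate ζ η K (f x) (g x) (h x)} = ⋃ j ∈ criticalIndices K,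
      ({x | 0 ≤ excess ζ η (f x) (g x) (h x) j} ∩ {x | excess ζ η (f x) (g x) (h x) j < η}) := by
    ext x
    simp only [degenerate_iff, Set.mem_iUnion, exists_prop, Set.mem_inter_iff, Set.mem_ofPred_eq]
  rw [e]
  refine Finset.measurableSet_biUnion _ fun j _ => ?_
  have hm : Measurable fun x => excess ζ η (f x) (g x) (h x) j :=
    measurable_excess ζ η j hf hg hh
  exact (measurableSet_le measurable_const hm).inter (measurableSet_lt hm measurable_const)

lemma measurableSet_badAt [NeZero n] (a ζ η : ℝ) (K H : ℕ) (t : Tile n) :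
    MeasurableSet (badAt a ζ η K H t) := by
  have hs : ∀ q, MeasurableSet {y : Conf n | q ∈ nearSites H t y} := by
    intro q
    have : {y : Conf n | q ∈ nearSites H t y} = {_y | |q.1.1| ≤ H} ∩ ({_y | |q.1.2| ≤ H} ∩
        {y | q.2 < (y (t + ((q.1.1 : ZMod n), (q.1.2 : ZMod n)))).num}) := rfl
    rw [this]
    exact (MeasurableSet.const _).inter ((MeasurableSet.const _).inter
      (measurableSet_lt measurable_const (by fun_prop)))
  have e : badAt a ζ η K H t = ⋃ i, ⋃ q₁, ⋃ q₂, ⋃ q₃,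
      ({y : Conf n | i < (y t).num} ∩ ({y | q₁ ∈ nearSites H t y} ∩ ({y | q₂ ∈ nearSites H t y} ∩
      ({y | q₃ ∈ nearSites H t y} ∩ ({_y | q₁ ≠ (0, i) ∧ q₂ ≠ (0, i) ∧ q₃ ≠ (0, i)} ∩
      {y | Degenerate ζ η K (relPos a t y q₂ - relPos a t y q₁)
        (relPos a t y q₃ - relPos a t y q₁) (relPos a t y (0, i) - relPos a t y q₁)}))))) := by
    ext y
    simp only [badAt, Set.mem_iUnion, Set.mem_inter_iff, Set.mem_ofPred_eq]
    constructor
    · rintro ⟨i, hi, q₁, h1, q₂, h2, q₃, h3, n1, n2, n3, hd⟩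
      exact ⟨i, q₁, q₂, q₃, hi, h1, h2, h3, ⟨n1, n2, n3⟩, hd⟩
    · rintro ⟨i, q₁, q₂, q₃, hi, h1, h2, h3, ⟨n1, n2, n3⟩, hd⟩
      exact ⟨i, hi, q₁, h1, q₂, h2, q₃, h3, n1, n2, n3, hd⟩
  rw [e]
  refine MeasurableSet.iUnion fun i => MeasurableSet.iUnion fun q₁ => MeasurableSet.iUnion
    fun q₂ => MeasurableSet.iUnion fun q₃ => ?_
  refine (measurableSet_lt measurable_const (by fun_prop)).inter ((hs _).inter ((hs _).inter
    ((hs _).inter ((MeasurableSet.const _).inter (measurableSet_degenerate ζ η K ?_ ?_ ?_)))))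
  all_goals exact (measurable_relPos a t _).sub (measurable_relPos a t _)

lemma card_criticalIndices (K : ℕ) : (criticalIndices K).card = 2 * K + 3 := by
  rw [criticalIndices, Finset.card_disjSum]
  simp; omega

/-- A fresh uniform point is rarely in degenerate position with respect to given points. -/
lemma unitSq_degenerate_le {a : ℝ} (ha : 0 < a) (ζ : ℝ) {η : ℝ} (hη : 0 ≤ η) (K : ℕ)
    (p d e : ℂ) :
    unitSq {o | Degenerate ζ η K d e ((⟨a * o.1, a * o.2⟩ : ℂ) - p)} ≤
      (2 * K + 3 : ℕ) * ENNReal.ofReal (2 * √η / a) := by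
  have hsub : {o : ℝ × ℝ | Degenerate ζ η K d e ((⟨a * o.1, a * o.2⟩ : ℂ) - p)} ⊆
      ⋃ j ∈ criticalIndices K, {o | ‖bisPt d (criticalParam ζ η d e j)‖ ^ 2 ≤
        ‖(bisPt d (criticalParam ζ η d e j) + p) - (⟨a * o.1, a * o.2⟩ : ℂ)‖ ^ 2 ∧
        ‖(bisPt d (criticalParam ζ η d e j) + p) - (⟨a * o.1, a * o.2⟩ : ℂ)‖ ^ 2 <
          ‖bisPt d (criticalParam ζ η d e j)‖ ^ 2 + η} := by
    rintro o ⟨j, hj, h1, h2⟩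
    refine Set.mem_iUnion₂.2 ⟨j, hj, ?_⟩
    have : bisPt d (criticalParam ζ η d e j) - ((⟨a * o.1, a * o.2⟩ : ℂ) - p) =
        (bisPt d (criticalParam ζ η d e j) + p) - (⟨a * o.1, a * o.2⟩ : ℂ) := by ring
    rw [this] at h1 h2
    exact ⟨by linarith, by linarith⟩
  refine (measure_mono hsub).trans ((measure_biUnion_finset_le _ _).trans ?_)
  refine (Finset.sum_le_card_nsmul _ _ _ fun j _ => unitSq_annulus_le ha hη _ _).trans ?_
  rw [card_criticalIndices, nsmul_eq_mul]

/-- The places at which the points near a cell are looked for, when no cell contains more than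
`k₀` of them. -/
def sitePlaces (H k₀ : ℕ) : Finset ((ℤ × ℤ) × ℕ) :=
  (Finset.Icc (-H : ℤ) H ×ˢ Finset.Icc (-H : ℤ) H) ×ˢ Finset.range k₀

lemma card_sitePlaces (H k₀ : ℕ) : (sitePlaces H k₀).card = (2 * H + 1) ^ 2 * k₀ := by
  simp only [sitePlaces, Finset.card_product, Int.card_Icc, Finset.card_range]
  have : ((H : ℤ) + 1 - -H).toNat = 2 * H + 1 := by omega
  rw [this]; ring

lemma eq_zero_of_add_eq {H : ℕ} (hn : H < n) {t : Tile n} {z : ℤ × ℤ} (h1 : |z.1| ≤ H)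
    (h2 : |z.2| ≤ H) (h : t + ((z.1 : ZMod n), (z.2 : ZMod n)) = t) : z = 0 := by
  have key : ∀ u : ℤ, |u| ≤ H → ((u : ZMod n) = 0) → u = 0 := by
    intro u hu h0
    rw [ZMod.intCast_zmod_eq_zero_iff_dvd] at h0
    exact Int.eq_zero_of_abs_lt_dvd h0 (by omega)
  have h' := add_eq_left.1 h
  rw [Prod.ext_iff] at h'
  exact Prod.ext (key _ h1 h'.1) (key _ h2 h'.2)

/-- Given the other cells, resampling a cell is unlikely to make it bad. -/
lemma resample_bad_le [NeZero n] {l l' : NNReal} {ν : Measure (Fin 3)} [IsProbabilityMeasure ν]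
    {a : ℝ} (ha : 0 < a) (ζ : ℝ) {η : ℝ} (hη : 0 ≤ η) (K : ℕ) {H k₀ : ℕ} (hn : H < n) (t : Tile n)
    (y : Conf n) (hy : ∀ c, c ≠ t → (y c).num < k₀) :
    confLaw n l l' ν {y' | resample t y y' ∈ badAt a ζ η K H t} ≤ (l : ENNReal) ^ k₀ +
      (k₀ * ((2 * H + 1) ^ 2 * k₀) ^ 3 * (2 * K + 3) : ℕ) * ENNReal.ofReal (2 * √η / a) := by
  classical
  -- The positions, in terms of those of the points of the cell `t`.
  set f : (ℕ → ℝ × ℝ) → (ℤ × ℤ) × ℕ → ℂ := fun x q => if q.1 = 0 then ⟨a * (x q.2).1, a * (x q.2).2⟩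
    else relPos a t y q with hf
  have hfm : ∀ q, Measurable fun x => f x q := by
    intro q
    simp only [hf]
    split_ifs
    · refine measurable_toComplex.comp (g := fun o : ℝ × ℝ => (⟨o.1, o.2⟩ : ℂ))
        (f := fun x : ℕ → ℝ × ℝ => (a * (x q.2).1, a * (x q.2).2)) ?_
      fun_prop
    · exact measurable_const
  set D : ℕ → (ℤ × ℤ) × ℕ → (ℤ × ℤ) × ℕ → (ℤ × ℤ) × ℕ → Set (ℕ → ℝ × ℝ) := fun i q₁ q₂ q₃ =>
    {x | Degenerate ζ η K (f x q₂ - f x q₁) (f x q₃ - f x q₁) (f x (0, i) - f x q₁)} with hD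
  have hDm : ∀ i q₁ q₂ q₃, MeasurableSet (D i q₁ q₂ q₃) := fun i q₁ q₂ q₃ =>
    measurableSet_degenerate ζ η K ((hfm _).sub (hfm _)) ((hfm _).sub (hfm _))
      ((hfm _).sub (hfm _))
  set ε : ENNReal := (2 * K + 3 : ℕ) * ENNReal.ofReal (2 * √η / a) with hε
  have hDle : ∀ i q₁ q₂ q₃, q₁ ≠ (0, i) → q₂ ≠ (0, i) → q₃ ≠ (0, i) →
      (Measure.infinitePi fun _ : ℕ => unitSq) (D i q₁ q₂ q₃) ≤ ε := by
    intro i q₁ q₂ q₃ h1 h2 h3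
    refine infinitePi_le_of_update i (hDm _ _ _ _) fun x => ?_
    have hupd : ∀ q u, q ≠ (0, i) → f (Function.update x i u) q = f x q := by
      rintro ⟨z, j⟩ u hq
      simp only [hf]
      split_ifs with hz
      · have : j ≠ i := fun hj => hq (by rw [hj, show z = 0 from hz])
        rw [Function.update_of_ne this]
      · rfl
    have hself : ∀ u, f (Function.update x i u) (0, i) = ⟨a * u.1, a * u.2⟩ := by
      intro u; simp [hf]
    have e : {u | Function.update x i u ∈ D i q₁ q₂ q₃} = {o | Degenerate ζ η K
        (f x q₂ - f x q₁) (f x q₃ - f x q₁) ((⟨a * o.1, a * o.2⟩ : ℂ) - f x q₁)} := by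
      ext u
      simp only [hD, Set.mem_ofPred_eq, hupd _ u h1, hupd _ u h2, hupd _ u h3, hself]
    rw [e]
    exact unitSq_degenerate_le ha ζ hη K _ _ _
  set Q := sitePlaces H k₀ with hQ
  -- Some point `i` of `t` is in degenerate position with respect to three other points.
  set E : Set (ℕ → ℝ × ℝ) := ⋃ i ∈ Finset.range k₀, ⋃ p ∈ (Q ×ˢ Q ×ˢ Q).filter
    (fun p => p.1 ≠ (0, i) ∧ p.2.1 ≠ (0, i) ∧ p.2.2 ≠ (0, i)), D i p.1 p.2.1 p.2.2 with hE
  have hEm : MeasurableSet E := Finset.measurableSet_biUnion _ fun i _ =>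
    Finset.measurableSet_biUnion _ fun p _ => hDm _ _ _ _
  have hEle : (Measure.infinitePi fun _ : ℕ => unitSq) E ≤
      (k₀ * ((2 * H + 1) ^ 2 * k₀) ^ 3 : ℕ) * ε := by
    refine (measure_biUnion_finset_le _ _).trans ?_
    refine (Finset.sum_le_card_nsmul _ _ ((((2 * H + 1) ^ 2 * k₀) ^ 3 : ℕ) * ε)
      fun i _ => ?_).trans ?_
    · refine (measure_biUnion_finset_le _ _).trans ?_
      refine (Finset.sum_le_card_nsmul _ _ ε fun p hp => ?_).trans ?_
      · obtain ⟨-, h1, h2, h3⟩ := Finset.mem_filter.1 hp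
        exact hDle i _ _ _ h1 h2 h3
      · rw [nsmul_eq_mul]
        gcongr
        refine (Finset.card_filter_le _ _).trans ?_
        rw [Finset.card_product, Finset.card_product, hQ, card_sitePlaces]
        exact le_of_eq (by ring)
    · rw [Finset.card_range, nsmul_eq_mul, ← mul_assoc]
      push_cast
      rfl
  -- Only the ordinary points of the cell `t` matter.
  set R : Set OrdPart := Prod.fst ⁻¹' {k | k₀ ≤ k} ∪ Prod.snd ⁻¹' E with hR
  have hRm : MeasurableSet R := (measurable_fst .of_discrete).union (measurable_snd hEm)
  have hmp : MeasurePreserving (fun y' : Conf n => (y' t).1) (confLaw n l l' ν) (ordLaw l) :=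
    (measurePreserving_fst (μ := ordLaw l) (ν := freeLaw l' ν)).comp
      (measurePreserving_eval (fun _ : Tile n => cellLaw l l' ν) t)
  have hsub : {y' | resample t y y' ∈ badAt a ζ η K H t} ⊆ (fun y' : Conf n => (y' t).1) ⁻¹' R := by
    rintro y' ⟨i, hi, q₁, hq₁, q₂, hq₂, q₃, hq₃, n1, n2, n3, hd⟩
    by_contra hnot
    simp only [hR, Set.mem_preimage, Set.mem_union, not_or, Set.mem_ofPred_eq, not_le] at hnot
    obtain ⟨hN, hE'⟩ := hnot
    have hnum : ∀ c, (resample t y y' c).num < k₀ := by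
      intro c
      by_cases hc : c = t
      · subst hc
        have : (resample c y y' c).1 = (y' c).1 := by simp [resample]
        rw [CellState.num, this]; exact hN
      · rw [CellState.num, resample_of_ne hc]; exact hy c hc
    have hmem : ∀ q ∈ nearSites H t (resample t y y'), q ∈ Q := by
      rintro q ⟨h1, h2, h3⟩
      rw [abs_le] at h1 h2
      simp only [hQ, sitePlaces, Finset.mem_product, Finset.mem_Icc, Finset.mem_range]
      exact ⟨⟨h1, h2⟩, h3.trans (hnum _)⟩
    have hpos : ∀ q : (ℤ × ℤ) × ℕ, |q.1.1| ≤ H → |q.1.2| ≤ H →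
        relPos a t (resample t y y') q = f (y' t).1.2 q := by
      intro q h1 h2
      by_cases hz : q.1 = 0
      · have : (resample t y y' t).1 = (y' t).1 := by simp [resample]
        simp only [hf, relPos, if_pos hz, hz, Prod.fst_zero, Prod.snd_zero, Int.cast_zero, zero_add,
          CellState.pos]
        rw [show ((0 : ZMod n), (0 : ZMod n)) = 0 from rfl, add_zero, this]
      · have hne : t + ((q.1.1 : ZMod n), (q.1.2 : ZMod n)) ≠ t := fun hh =>
          hz (eq_zero_of_add_eq hn h1 h2 hh)
        simp only [hf, relPos, if_neg hz, CellState.pos]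
        rw [resample_of_ne hne]
    refine hE' (Set.mem_iUnion₂.2 ⟨i, Finset.mem_range.2 (hi.trans (hnum t)),
      Set.mem_iUnion₂.2 ⟨(q₁, q₂, q₃), Finset.mem_filter.2 ⟨?_, n1, n2, n3⟩, ?_⟩⟩)
    · exact Finset.mem_product.2 ⟨hmem _ hq₁, Finset.mem_product.2 ⟨hmem _ hq₂, hmem _ hq₃⟩⟩
    · rw [hpos q₁ hq₁.1 hq₁.2.1, hpos q₂ hq₂.1 hq₂.2.1, hpos q₃ hq₃.1 hq₃.2.1,
        hpos (0, i) (by simp) (by simp)] at hd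
      exact hd
  calc _ ≤ confLaw n l l' ν ((fun y' : Conf n => (y' t).1) ⁻¹' R) := measure_mono hsub
    _ = ordLaw l R := hmp.measure_preimage hRm.nullMeasurableSet
    _ ≤ ordLaw l (Prod.fst ⁻¹' {k | k₀ ≤ k}) + ordLaw l (Prod.snd ⁻¹' E) := measure_union_le _ _
    _ ≤ (l : ENNReal) ^ k₀ + (k₀ * ((2 * H + 1) ^ 2 * k₀) ^ 3 : ℕ) * ε := by
      have hf1 : MeasurePreserving (Prod.fst : OrdPart → ℕ) (ordLaw l) (poissonMeasure l) :=
        measurePreserving_fst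
      have hf2 : MeasurePreserving (Prod.snd : OrdPart → _) (ordLaw l)
          (Measure.infinitePi fun _ : ℕ => unitSq) := measurePreserving_snd
      rw [hf1.measure_preimage MeasurableSet.of_discrete.nullMeasurableSet,
        hf2.measure_preimage hEm.nullMeasurableSet]
      exact add_le_add (poissonMeasure_Ici_le l k₀) hEle
    _ = _ := by rw [hε, ← mul_assoc]; push_cast; rfl

end

section

variable {n : ℕ}

open Classical in
lemma card_near_le [NeZero n] (t : Tile n) :
    (Finset.univ.filter fun c => t.Near c).card ≤ 81 := by
  have hsub : (Finset.univ.filter fun c => t.Near c) ⊆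
      (Finset.Icc (-4 : ℤ) 4 ×ˢ Finset.Icc (-4 : ℤ) 4).image
        fun z : ℤ × ℤ => t + ((z.1 : ZMod n), (z.2 : ZMod n)) := by
    intro c hc
    obtain ⟨u, v, hu, hv, rfl⟩ := (Finset.mem_filter.1 hc).2
    exact Finset.mem_image.2 ⟨(u, v), by
      rw [Finset.mem_product, Finset.mem_Icc, Finset.mem_Icc]
      exact ⟨abs_le.1 hu, abs_le.1 hv⟩, rfl⟩
  refine (Finset.card_le_card hsub).trans (Finset.card_image_le.trans ?_)
  simp

/-- The probability that a cell contains no ordinary point, contains an extra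
point, has its first `k₀` marks equal to `2`, and has a given label. -/
def goodWeight (l l' : NNReal) (ν : Measure (Fin 3)) (k₀ : ℕ) : ENNReal :=
  poissonMeasure l {0} * (poissonMeasure l' {k | 1 ≤ k} * (ν {2} ^ k₀ * 81⁻¹))

/-- Given the other cells, resampling makes a cell good with a probability that is not too
small. -/
lemma le_resample_good [NeZero n] {l l' : NNReal} {ν : Measure (Fin 3)} [IsProbabilityMeasure ν]
    {k₀ : ℕ} (t : Tile n) (y : Conf n) (hy : ∀ c, c ≠ t → (y c).num < k₀) :
    goodWeight l l' ν k₀ ^ 81 ≤ confLaw n l l' ν {y' | resample t y y' ∈ goodAt t} := by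
  classical
  set S : Set CellState := ((Prod.fst ⁻¹' {0} : Set OrdPart)) ×ˢ
    ({k : ℕ | 1 ≤ k} ×ˢ ((Set.univ : Set (ℕ → ℝ × ℝ)) ×ˢ
      ((Set.pi (Finset.range k₀) fun _ => {2}) ×ˢ {t.residue}))) with hS
  have hSval : cellLaw l l' ν S = goodWeight l l' ν k₀ := by
    have hf1 : MeasurePreserving (Prod.fst : OrdPart → ℕ) (ordLaw l) (poissonMeasure l) :=
      measurePreserving_fst
    rw [hS, cellLaw, Measure.prod_prod, freeLaw, Measure.prod_prod, Measure.prod_prod,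
      Measure.prod_prod, Measure.infinitePi_pi _ fun _ _ => measurableSet_singleton _,
      hf1.measure_preimage MeasurableSet.of_discrete.nullMeasurableSet, goodWeight,
      uniformOn_univ]
    simp
  have hsub : Set.pi Set.univ (fun c => if t.Near c then S else Set.univ) ⊆
      {y' | resample t y y' ∈ goodAt t} := by
    intro y' hy' c hc
    have h1 : y' c ∈ S := by simpa [hc] using hy' c trivial
    obtain ⟨h0, h2, -, h3, h4⟩ := h1
    have hfree : (resample t y y' c).2 = (y' c).2 := by simp [resample, hc]
    refine ⟨by rw [CellState.xnum, hfree]; exact h2, fun i hi => ?_, by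
      rw [CellState.label, hfree]; exact h4⟩
    rw [CellState.mark, hfree]
    refine h3 i ?_
    rw [Finset.mem_coe, Finset.mem_range]
    -- The ordinary points are those of `y'` in the cell `t`, where there are none, and those of
    -- `y` elsewhere, where there are fewer than `k₀`.
    by_cases hct : c = t
    · have h5 : (resample t y y' c).1 = (y' c).1 := by simp [resample, hct]
      rw [CellState.num, h5] at hi
      have h6 : (y' c).1.1 = 0 := h0
      omega
    · rw [CellState.num, resample_of_ne hct] at hi
      exact hi.trans (hy c hct)
  refine le_trans ?_ (measure_mono hsub)
  rw [confLaw, Measure.pi_pi]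
  have hle : goodWeight l l' ν k₀ ≤ 1 := by rw [← hSval]; exact prob_le_one
  calc goodWeight l l' ν k₀ ^ 81
      ≤ goodWeight l l' ν k₀ ^ (Finset.univ.filter fun c => t.Near c).card :=
        pow_le_pow_right_of_le_one' hle (card_near_le t)
    _ = ∏ c, (cellLaw l l' ν) (if t.Near c then S else Set.univ) := by
        rw [← Finset.prod_const, Finset.prod_filter]
        refine Finset.prod_congr rfl fun c _ => ?_
        split_ifs
        · exact hSval.symm
        · exact measure_univ.symm

/-- All configurations are exchangeable, up to those in which some cell is crowded. -/
lemma not_exchangeable_le [NeZero n] {l l' : NNReal} {ν : Measure (Fin 3)}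
    [IsProbabilityMeasure ν] {a : ℝ} (ha : 0 < a) (ζ : ℝ) {η : ℝ} (hη : 0 ≤ η) (K : ℕ) {H k₀ : ℕ}
    (hn : H < n)
    (hle : (l : ENNReal) ^ k₀ + (k₀ * ((2 * H + 1) ^ 2 * k₀) ^ 3 * (2 * K + 3) : ℕ) *
      ENNReal.ofReal (2 * √η / a) ≤ goodWeight l l' ν k₀ ^ 81)
    (hpos : goodWeight l l' ν k₀ ≠ 0) (t : Tile n) :
    confLaw n l l' ν {y | ¬ Exchangeable (confLaw n l l' ν) (resample t) (goodAt t)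
      (badAt a ζ η K H t \ goodAt t) y} ≤ (n ^ 2 : ℕ) * (l : ENNReal) ^ k₀ := by
  have hsub : {y | ¬ Exchangeable (confLaw n l l' ν) (resample t) (goodAt t)
      (badAt a ζ η K H t \ goodAt t) y} ⊆ ⋃ c ∈ (Finset.univ : Finset (Tile n)),
        (fun y : Conf n => (y c).1.1) ⁻¹' {k | k₀ ≤ k} := by
    intro y hy
    by_contra hcon
    refine hy ?_
    have hnum : ∀ c, c ≠ t → (y c).num < k₀ := by
      intro c _
      by_contra hc
      exact hcon (Set.mem_iUnion₂.2 ⟨c, Finset.mem_univ c, not_lt.1 hc⟩)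
    have hgood := le_resample_good (l := l) (l' := l') (ν := ν) t y hnum
    refine ⟨?_, fun h0 => ?_⟩
    · refine le_trans (measure_mono fun y' h => h.1) ((resample_bad_le ha ζ hη K hn t y hnum).trans
        (hle.trans hgood))
    · rw [h0, nonpos_iff_eq_zero] at hgood
      exact hpos (pow_eq_zero_iff (by norm_num) |>.1 hgood)
  refine (measure_mono hsub).trans ((measure_biUnion_finset_le _ _).trans ?_)
  refine (Finset.sum_le_card_nsmul _ _ ((l : ENNReal) ^ k₀) fun c _ => ?_).trans ?_
  · have hmp : MeasurePreserving (fun y : Conf n => (y c).1.1) (confLaw n l l' ν)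
        (poissonMeasure l) :=
      ((measurePreserving_fst (μ := poissonMeasure l)
        (ν := Measure.infinitePi fun _ : ℕ => unitSq)).comp
        (measurePreserving_fst (μ := ordLaw l) (ν := freeLaw l' ν))).comp
        (measurePreserving_eval (fun _ : Tile n => cellLaw l l' ν) c)
    rw [hmp.measure_preimage MeasurableSet.of_discrete.nullMeasurableSet]
    exact poissonMeasure_Ici_le l k₀
  · rw [Finset.card_univ, Fintype.card_prod, ZMod.card, nsmul_eq_mul, sq]

end

section

/-! ### Periodic lifts to the plane -/

/-- The covering map, on the complex plane. -/
def planeProj (s : ℝ) (x : ℂ) : Torus s := proj s (x.re, x.im)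

lemma norm_coe_le_abs {s : ℝ} (x : ℝ) : ‖(x : AddCircle s)‖ ≤ |x| := by
  rw [← Real.norm_eq_abs]
  exact QuotientAddGroup.norm_mk_le_norm

lemma dist_planeProj (s : ℝ) (u v : ℂ) : dist (planeProj s u) (planeProj s v) =
    √(‖((u.re - v.re : ℝ) : AddCircle s)‖ ^ 2 + ‖((u.im - v.im : ℝ) : AddCircle s)‖ ^ 2) := by
  rw [WithLp.prod_dist_eq_of_L2]
  simp only [planeProj, proj, dist_eq_norm, AddCircle.coe_sub]
  rfl

lemma dist_eq_sqrt (u v : ℂ) : dist u v = √(|u.re - v.re| ^ 2 + |u.im - v.im| ^ 2) := by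
  rw [Complex.dist_eq_re_im, sq_abs, sq_abs]

lemma dist_planeProj_le (s : ℝ) (u v : ℂ) : dist (planeProj s u) (planeProj s v) ≤ dist u v := by
  rw [dist_planeProj, dist_eq_sqrt]
  gcongr <;> exact norm_coe_le_abs _

/-- Distances in the torus are attained by lifts. -/
lemma exists_dist_planeProj_eq (s : ℝ) (u w : ℂ) : ∃ k l : ℤ,
    dist u ⟨w.re + k * s, w.im + l * s⟩ = dist (planeProj s u) (planeProj s w) := by
  refine ⟨round (s⁻¹ * (u.re - w.re)), round (s⁻¹ * (u.im - w.im)), ?_⟩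
  rw [dist_planeProj, dist_eq_sqrt, AddCircle.norm_eq, AddCircle.norm_eq]
  simp only [sub_add_eq_sub_sub]

variable {n : ℕ}

/-- The cell of the torus below a cell of the plane. -/
def tileOf (n : ℕ) (z : ℤ × ℤ) : Tile n := ((z.1 : ZMod n), (z.2 : ZMod n))

lemma near_tileOf {z t : ℤ × ℤ} (h : InBlock z t) : (tileOf n t).Near (tileOf n z) :=
  ⟨z.1 - t.1, z.2 - t.2, h.1, h.2, by simp [tileOf]⟩

/-- The lift to the cell `z` of a point of a configuration. -/
def liftPt (a : ℝ) (y : Conf n) (z : ℤ × ℤ) (b : Bool) (i : ℕ) : ℂ :=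
  ⟨a * (z.1 + ((y (tileOf n z)).off b i).1), a * (z.2 + ((y (tileOf n z)).off b i).2)⟩

/-- The lifts of the points of a configuration whose mark satisfies `κ`. -/
def sites (a : ℝ) (y : Conf n) (κ : Fin 3 → Bool) : Set ℂ :=
  {x | ∃ z b i, i < (y (tileOf n z)).cnt b ∧ κ ((y (tileOf n z)).mk' b i) = true ∧
    x = liftPt a y z b i}

lemma gridIdx_liftPt {a : ℝ} (ha : 0 < a) {y : Conf n} (hy : SimpleConf y) (z : ℤ × ℤ) (b : Bool)
    (i : ℕ) : gridIdx a (liftPt a y z b i) = z := by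
  have ho := (hy (tileOf n z)).1 b i
  have key : ∀ (k : ℤ) (o : ℝ), o ∈ Set.Ico (0 : ℝ) 1 → ⌊a * (k + o) / a⌋ = k := by
    intro k o ho
    rw [mul_div_cancel_left₀ _ ha.ne', Int.floor_intCast_add, Int.floor_eq_zero_iff.2 ho, add_zero]
  exact Prod.ext (key _ _ ho.1) (key _ _ ho.2)

lemma liftPt_inj {a : ℝ} (ha : 0 < a) {y : Conf n} (hy : SimpleConf y) {z z' : ℤ × ℤ} {b b' : Bool}
    {i i' : ℕ} (h : liftPt a y z b i = liftPt a y z' b' i') : z = z' ∧ b = b' ∧ i = i' := by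
  have hz : z = z' := by rw [← gridIdx_liftPt ha hy z b i, h, gridIdx_liftPt ha hy]
  subst hz
  refine ⟨rfl, ?_⟩
  have h' := Complex.ext_iff.1 h
  have h1 := add_left_cancel (mul_left_cancel₀ ha.ne' h'.1)
  have h2 := add_left_cancel (mul_left_cancel₀ ha.ne' h'.2)
  by_contra hne
  exact (hy (tileOf n z)).2 (b, i) (b', i') (fun hh => hne (Prod.mk.inj hh)) (Prod.ext h1 h2)

lemma liftPt_add_period {s : ℝ} (hn : n ≠ 0) (y : Conf n) (z : ℤ × ℤ) (b : Bool) (i : ℕ)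
    (k l : ℤ) : liftPt (s / n) y (z.1 + k * n, z.2 + l * n) b i =
      ⟨(liftPt (s / n) y z b i).re + k * s, (liftPt (s / n) y z b i).im + l * s⟩ := by
  have ht : tileOf n (z.1 + k * n, z.2 + l * n) = tileOf n z := by simp [tileOf]
  have hn' : (n : ℝ) ≠ 0 := by exact_mod_cast hn
  simp only [liftPt, ht]
  push_cast
  refine Complex.ext ?_ ?_ <;> simp only <;> field_simp <;> ring

lemma planeProj_liftPt {s : ℝ} [NeZero n] (y : Conf n) (z : ℤ × ℤ) (b : Bool) (i : ℕ) :
    planeProj s (liftPt (s / n) y z b i) = loc s y ⟨(tileOf n z, b), i⟩ := by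
  have hn : (n : ℝ) ≠ 0 := by exact_mod_cast NeZero.ne n
  have key : ∀ (k : ℤ) (o : ℝ), ((s / n * (k + o) : ℝ) : AddCircle s) =
      ((s / n * ((k : ZMod n).val + o) : ℝ) : AddCircle s) := by
    intro k o
    have hk : (((k : ZMod n).val : ℤ) : ZMod n) = (k : ZMod n) := by simp
    rw [ZMod.intCast_eq_intCast_iff_dvd_sub] at hk
    obtain ⟨m, hm⟩ := hk
    have hm' : (k : ℝ) = ((k : ZMod n).val : ℝ) + n * m := by
      have : (k : ℤ) = ((k : ZMod n).val : ℤ) + n * m := by linarith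
      exact_mod_cast this
    have e : s / n * ((k : ℝ) + o) = s / n * ((k : ZMod n).val + o) + m • s := by
      rw [hm', zsmul_eq_mul]
      generalize ((k : ZMod n).val : ℝ) = v
      field_simp
      ring
    rw [e, AddCircle.coe_add, AddCircle.coe_zsmul, AddCircle.coe_period, smul_zero, add_zero]
  simp only [planeProj, loc, tilePt, proj, liftPt, tileOf]
  rw [key, key]

lemma planeProj_mem {s : ℝ} [NeZero n] {y : Conf n} {κ : Fin 3 → Bool} {x : ℂ}
    (hx : x ∈ sites (s / n) y κ) : planeProj s x ∈ loc s y '' {p ∈ actives y | κ (markOf y p)} := by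
  obtain ⟨z, b, i, hi, hκ, rfl⟩ := hx
  rw [planeProj_liftPt]
  refine ⟨⟨(tileOf n z, b), i⟩, ⟨?_, hκ⟩, rfl⟩
  simpa [actives] using hi

/-- Every point of a configuration has a lift that realises the distance to a given point. -/
lemma exists_site {s : ℝ} [NeZero n] {y : Conf n} {κ : Fin 3 → Bool} {p : Torus s}
    (hp : p ∈ loc s y '' {p ∈ actives y | κ (markOf y p)}) (u : ℂ) :
    ∃ x ∈ sites (s / n) y κ, planeProj s x = p ∧ dist u x = dist (planeProj s u) p := by
  obtain ⟨⟨⟨c, b⟩, i⟩, ⟨hi, hκ⟩, rfl⟩ := hp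
  set z : ℤ × ℤ := ((c.1.val : ℤ), (c.2.val : ℤ)) with hz
  have hc : tileOf n z = c := by simp [tileOf, hz]
  have hpz : planeProj s (liftPt (s / n) y z b i) = loc s y ⟨(c, b), i⟩ := by
    rw [planeProj_liftPt, hc]
  obtain ⟨k, l, hkl⟩ := exists_dist_planeProj_eq s u (liftPt (s / n) y z b i)
  have ht : tileOf n (z.1 + k * n, z.2 + l * n) = c := by rw [← hc]; simp [tileOf]
  refine ⟨liftPt (s / n) y (z.1 + k * n, z.2 + l * n) b i,
    ⟨_, b, i, by rw [ht]; simpa [actives] using hi, by rw [ht]; exact hκ, rfl⟩, ?_, ?_⟩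
  · rw [planeProj_liftPt, ht]
  · rw [liftPt_add_period (NeZero.ne n), hkl, hpz]

lemma exists_nearest_of_isBlack {s : ℝ} [NeZero n] {y : Conf n} (hy : SimpleConf y)
    {κ : Fin 3 → Bool} {u : ℂ} (h : IsBlack (colouring s κ y) (planeProj s u)) :
    ∃ b ∈ sites (s / n) y κ, ∀ z ∈ sites (s / n) y (fun _ => true), dist u b ≤ dist u z := by
  obtain ⟨p, hp, hcell⟩ := h
  rw [← Finset.mem_coe, black_colouring hy] at hp
  obtain ⟨b, hb, -, hd⟩ := exists_site hp u
  refine ⟨b, hb, fun z hz => ?_⟩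
  rw [hd]
  refine (hcell (planeProj s z) ?_).trans (dist_planeProj_le s u z)
  rw [points_colouring hy]
  obtain ⟨q, hq, h⟩ := planeProj_mem hz
  exact ⟨q, hq.1, h⟩

lemma isRobustlyBlack_of_mem_leadSet {s c : ℝ} [NeZero n] {y : Conf n} (hy : SimpleConf y)
    {κ : Fin 3 → Bool} {u : ℂ}
    (h : u ∈ leadSet (sites (s / n) y κ) (sites (s / n) y fun m => !κ m) c) :
    IsRobustlyBlack (colouring s κ y) c (planeProj s u) := by
  classical
  obtain ⟨b, hb, hlead⟩ := h
  refine ⟨planeProj s b, ?_, fun w hw => ?_⟩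
  · rw [← Finset.mem_coe, black_colouring hy]
    exact planeProj_mem hb
  · have hw' : w ∈ loc s y '' {p ∈ actives y | (fun m => !κ m) (markOf y p)} := by
      simp only [colouring, if_pos hy, Finset.mem_sdiff, Finset.mem_image, Finset.mem_filter,
        not_exists, not_and] at hw
      obtain ⟨⟨q, hq, rfl⟩, hnot⟩ := hw
      refine ⟨q, ⟨hq, ?_⟩, rfl⟩
      by_contra hκ
      exact hnot q ⟨hq, by simpa using hκ⟩ rfl
    obtain ⟨x, hx, -, hd⟩ := exists_site (κ := fun m => !κ m) hw' u
    rw [← hd]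
    linarith [hlead x hx, dist_planeProj_le s u b]

lemma finite_sites {a : ℝ} (ha : 0 < a) {y : Conf n} (hy : SimpleConf y) (κ : Fin 3 → Bool)
    (x : ℂ) (ρ : ℝ) : (sites a y κ ∩ Metric.closedBall x ρ).Finite := by
  set I : Set (ℤ × ℤ) := Set.Icc ⌊(x.re - ρ) / a⌋ ⌊(x.re + ρ) / a⌋ ×ˢ
    Set.Icc ⌊(x.im - ρ) / a⌋ ⌊(x.im + ρ) / a⌋ with hI
  have hfin : I.Finite := (Set.finite_Icc _ _).prod (Set.finite_Icc _ _)
  refine (hfin.biUnion (t := fun z => ⋃ b : Bool, (fun i => liftPt a y z b i) ''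
    Set.Iio ((y (tileOf n z)).cnt b)) fun z _ => Set.finite_iUnion fun b =>
      (Set.finite_Iio _).image _).subset ?_
  rintro v ⟨⟨z, b, i, hi, -, rfl⟩, hv⟩
  refine Set.mem_biUnion (x := z) ?_ (Set.mem_iUnion.2 ⟨b, i, hi, rfl⟩)
  rw [Metric.mem_closedBall, Complex.dist_eq] at hv
  have h1 := abs_le.1 ((Complex.abs_re_le_norm _).trans hv)
  have h2 := abs_le.1 ((Complex.abs_im_le_norm _).trans hv)
  rw [Complex.sub_re] at h1
  rw [Complex.sub_im] at h2
  have hz := gridIdx_liftPt ha hy z b i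
  rw [← hz]
  refine ⟨⟨?_, ?_⟩, ⟨?_, ?_⟩⟩ <;> refine Int.floor_le_floor (by gcongr; linarith)

end

section

/-! ### Coupled configurations are comparable -/

/-- The marks of the points that are black in the first colouring. -/
def firstBlack (m : Fin 3) : Bool := m == 0

/-- The marks of the points that are black in the second colouring. -/
def secondBlack (m : Fin 3) : Bool := m != 1

variable {n : ℕ}

lemma relPos_eq_liftPt_sub (a : ℝ) {y : Conf n} (w : Conf n) (t z : ℤ × ℤ) (i : ℕ)
    (h : (w (tileOf n z)).1 = (y (tileOf n z)).1) :
    relPos a (tileOf n t) w (z - t, i) = liftPt a y z false i - ⟨a * t.1, a * t.2⟩ := by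
  have ht : tileOf n t + (((z - t).1 : ZMod n), ((z - t).2 : ZMod n)) = tileOf n z := by
    simp [tileOf]
  have hp : (w (tileOf n z)).pos = (y (tileOf n z)).pos := congrArg Prod.snd h
  have e : relPos a (tileOf n t) w (z - t, i) =
      ⟨a * ((z - t).1 + ((w (tileOf n z)).pos i).1), a * ((z - t).2 + ((w (tileOf n z)).pos i).2)⟩ := by
    rw [← ht]; rfl
  rw [e, hp]
  refine Complex.ext ?_ ?_
  · simp only [liftPt, CellState.off, Complex.sub_re, Prod.fst_sub]
    push_cast
    ring_nf
  · simp only [liftPt, CellState.off, Complex.sub_im, Prod.snd_sub]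
    push_cast
    ring_nf

lemma abs_gridIdx_sub_le {a ρ : ℝ} (ha : 0 < a) {H : ℕ} (hH : ρ / a + 1 ≤ H) {x x' : ℂ}
    (h : dist x x' ≤ ρ) : |((gridIdx a x) - (gridIdx a x')).1| ≤ H ∧
      |((gridIdx a x) - (gridIdx a x')).2| ≤ H := by
  have key : ∀ u v : ℝ, |u - v| ≤ ρ → |⌊u / a⌋ - ⌊v / a⌋| ≤ (H : ℤ) := by
    intro u v huv
    have h1 := abs_le.1 huv
    have h2 : u / a - v / a ≤ ρ / a := by rw [← sub_div]; gcongr; exact h1.2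
    have h3 : v / a - u / a ≤ ρ / a := by rw [← sub_div]; gcongr; linarith
    have f1 := Int.floor_le (u / a)
    have f2 := Int.lt_floor_add_one (u / a)
    have f3 := Int.floor_le (v / a)
    have f4 := Int.lt_floor_add_one (v / a)
    rw [abs_le]
    constructor
    · have : (-(H : ℝ)) ≤ (⌊u / a⌋ : ℝ) - ⌊v / a⌋ := by linarith
      exact_mod_cast this
    · have : (⌊u / a⌋ : ℝ) - ⌊v / a⌋ ≤ H := by linarith
      exact_mod_cast this
  rw [Complex.dist_eq] at h
  exact ⟨key _ _ ((Complex.abs_re_le_norm (x - x')).trans h),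
    key _ _ ((Complex.abs_im_le_norm (x - x')).trans h)⟩

/-- Every horizontal run of `h` cells contains an ordinary point. -/
def NoGap (h : ℕ) (y : Conf n) : Prop := ∀ c : Tile n, ∃ k < h, (y (c + ((k : ZMod n), 0))).num ≠ 0

lemma exists_site_close {a r : ℝ} (ha : 0 < a) {h : ℕ} (hr : (h + 1) * a ≤ r) {y : Conf n}
    (hy : SimpleConf y) (hgap : NoGap h y) (x : ℂ) :
    ∃ z ∈ sites a y (fun _ => true), dist x z ≤ r := by
  obtain ⟨k, hk, hnum⟩ := hgap (tileOf n (gridIdx a x))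
  set z : ℤ × ℤ := ((gridIdx a x).1 + k, (gridIdx a x).2) with hz
  have ht : tileOf n z = tileOf n (gridIdx a x) + ((k : ZMod n), 0) := by simp [tileOf, hz]
  rw [← ht] at hnum
  refine ⟨liftPt a y z false 0, ⟨z, false, 0, Nat.pos_of_ne_zero hnum, rfl, rfl⟩, ?_⟩
  have hidx := gridIdx_liftPt ha hy z false 0
  set v := liftPt a y z false 0
  have hidx1 : ⌊v.re / a⌋ = ⌊x.re / a⌋ + k := (Prod.ext_iff.1 hidx).1
  have hidx2 : ⌊v.im / a⌋ = ⌊x.im / a⌋ := (Prod.ext_iff.1 hidx).2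
  have hk' : (k : ℝ) + 1 ≤ h := by exact_mod_cast hk
  have hk0 : (0 : ℝ) ≤ k := k.cast_nonneg
  have f1 := Int.floor_le (x.re / a)
  have f2 := Int.lt_floor_add_one (x.re / a)
  have f3 := Int.floor_le (v.re / a)
  have f4 := Int.lt_floor_add_one (v.re / a)
  have f5 := Int.floor_le (x.im / a)
  have f6 := Int.lt_floor_add_one (x.im / a)
  have f7 := Int.floor_le (v.im / a)
  have f8 := Int.lt_floor_add_one (v.im / a)
  rw [hidx1] at f3 f4
  rw [hidx2] at f7 f8
  push_cast at f3 f4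
  have e1 : |x.re - v.re| ≤ h * a := by
    rw [abs_le]
    have h1 : (x.re - v.re) / a ≤ h := by rw [sub_div]; linarith
    have h2 : -(h : ℝ) ≤ (x.re - v.re) / a := by rw [sub_div]; linarith
    rw [div_le_iff₀ ha] at h1
    rw [le_div_iff₀ ha] at h2
    exact ⟨by linarith, h1⟩
  have e2 : |x.im - v.im| ≤ a := by
    rw [abs_le]
    have h1 : (x.im - v.im) / a ≤ 1 := by rw [sub_div]; linarith
    have h2 : -(1 : ℝ) ≤ (x.im - v.im) / a := by rw [sub_div]; linarith
    rw [div_le_iff₀ ha] at h1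
    rw [le_div_iff₀ ha] at h2
    exact ⟨by linarith, by linarith⟩
  have e3 := Complex.norm_le_abs_re_add_abs_im (x - v)
  rw [Complex.sub_re, Complex.sub_im] at e3
  rw [Complex.dist_eq]
  nlinarith

/-- Coupled configurations give rise to comparable coloured point sets in the plane. -/
theorem Coupled.compares {a r ζ η : ℝ} {K H h : ℕ} (ha : 0 < a) (hr : (h + 1) * a ≤ r)
    (hH : 6 * r / a + 1 ≤ H) {y₀ y : Conf n} (hy₀ : SimpleConf y₀) (hy : SimpleConf y)
    (hgap : NoGap h y₀) {fixed broken : Set (Tile n)}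
    (hc : Coupled (badAt a ζ η K H) Set.univ y₀ y fixed broken) :
    Compares a r ζ η K (sites a y₀ firstBlack) (sites a y₀ fun _ => true) (sites a y secondBlack)
      (sites a y fun m => !secondBlack m) (tileOf n ⁻¹' fixed) (tileOf n ⁻¹' broken) := by
  have hB : ∀ b ∈ sites a y₀ firstBlack, ∃ z i, i < (y₀ (tileOf n z)).num ∧
      (y₀ (tileOf n z)).mark i = 0 ∧ b = liftPt a y₀ z false i := by
    rintro b ⟨z, β, i, hi, hκ, rfl⟩
    cases β
    · exact ⟨z, i, hi, beq_iff_eq.1 hκ, rfl⟩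
    · exact absurd (show firstBlack 2 = true from hκ) (by decide)
  have hW : ∀ w ∈ sites a y (fun m => !secondBlack m), ∃ z i, i < (y (tileOf n z)).num ∧
      (y (tileOf n z)).mark i = 1 ∧ w = liftPt a y z false i := by
    rintro b ⟨z, β, i, hi, hκ, rfl⟩
    cases β
    · refine ⟨z, i, hi, ?_, rfl⟩
      have hκ' : (!secondBlack ((y (tileOf n z)).mark i)) = true := hκ
      simpa [secondBlack] using hκ'
    · exact absurd (show (!secondBlack 2) = true from hκ) (by decide)
  -- Ordinary points are not moved outside of the exceptional squares.
  have hlift : ∀ z i, (y (tileOf n z)).1 = (y₀ (tileOf n z)).1 →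
      liftPt a y z false i = liftPt a y₀ z false i := by
    intro z i heq
    have : (y (tileOf n z)).pos = (y₀ (tileOf n z)).pos := congrArg Prod.snd heq
    simp [liftPt, CellState.off, this]
  have hnumeq : ∀ z, (y (tileOf n z)).1 = (y₀ (tileOf n z)).1 →
      (y (tileOf n z)).num = (y₀ (tileOf n z)).num := fun z heq => congrArg Prod.fst heq
  have hWfix : ∀ t ∈ fixed, ∀ z i, t.Near (tileOf n z) → i < (y (tileOf n z)).num →
      (y (tileOf n z)).mark i ≠ 1 := by
    intro t ht z i hnear hi h1
    have := (hc.fixed_good t ht _ hnear).2.1 i hi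
    rw [h1] at this
    exact absurd this (by decide)
  have hBbr : ∀ t ∈ broken, ∀ z i, t.Near (tileOf n z) → i < (y₀ (tileOf n z)).num →
      (y₀ (tileOf n z)).mark i ≠ 0 := by
    intro t ht z i hnear hi h1
    have := (hc.broken_good t ht _ hnear).2 i hi
    rw [h1] at this
    exact absurd this (by decide)
  have hdisj : Disjoint (sites a y secondBlack) (sites a y fun m => !secondBlack m) := by
    refine Set.disjoint_left.2 ?_
    rintro x ⟨z, β, i, hi, hκ, rfl⟩ ⟨z', β', i', hi', hκ', heq⟩
    obtain ⟨rfl, rfl, rfl⟩ := liftPt_inj ha hy heq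
    have hκ' : (!secondBlack ((y (tileOf n z)).mk' β i)) = true := hκ'
    rw [hκ] at hκ'
    exact absurd hκ' (by decide)
  have hblack : ∀ b ∈ sites a y₀ firstBlack,
      gridIdx a b ∈ tileOf n ⁻¹' fixed ∨ b ∈ sites a y secondBlack := by
    intro b hb
    obtain ⟨z, i, hi, hm, rfl⟩ := hB b hb
    rw [gridIdx_liftPt ha hy₀]
    by_cases hf : tileOf n z ∈ fixed
    · exact Or.inl hf
    right
    have hbr : ∀ t ∈ broken, ¬ t.Near (tileOf n z) := fun t ht hnear =>
      hBbr t ht z i hnear hi hm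
    have heq := hc.ord_eq _ hf fun hh => hbr _ hh (Tile.near_self _)
    refine ⟨z, false, i, by rw [← hnumeq z heq] at hi; exact hi, ?_, (hlift z i heq).symm⟩
    change secondBlack ((y (tileOf n z)).mark i) = true
    by_cases hfn : ∃ t ∈ fixed, t.Near (tileOf n z)
    · obtain ⟨t, ht, hnear⟩ := hfn
      rw [(hc.fixed_good t ht _ hnear).2.1 i (by rw [hnumeq z heq]; exact hi)]
      decide
    · rw [hc.eq_of_not_near _ (by
        rintro t (ht | ht) hnear
        · exact hfn ⟨t, ht, hnear⟩
        · exact hbr t ht hnear), hm]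
      decide
  refine ⟨?_, finite_sites ha hy₀ _, finite_sites ha hy _, exists_site_close ha hr hy₀ hgap, ?_, ?_,
    ?_, ?_, hblack, ?_, hdisj, ?_⟩
  · rintro x ⟨z, b, i, hi, -, rfl⟩
    exact ⟨z, b, i, hi, rfl, rfl⟩
  · intro t ht z hz
    exact ⟨liftPt a y z true 0, ⟨z, true, 0, (hc.fixed_good _ ht _ (near_tileOf hz)).1, rfl, rfl⟩,
      gridIdx_liftPt ha hy _ _ _⟩
  · intro t ht w hw hz
    obtain ⟨z, i, hi, hm, rfl⟩ := hW w hw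
    rw [gridIdx_liftPt ha hy] at hz
    exact hWfix _ ht z i (near_tileOf hz) hi hm
  · intro t ht z hz
    exact ⟨liftPt a y₀ z true 0, ⟨z, true, 0, (hc.broken_good _ ht _ (near_tileOf hz)).1, rfl, rfl⟩,
      gridIdx_liftPt ha hy₀ _ _ _⟩
  · intro t ht b hb hz
    obtain ⟨z, i, hi, hm, rfl⟩ := hB b hb
    rw [gridIdx_liftPt ha hy₀] at hz
    exact hBbr _ ht z i (near_tileOf hz) hi hm
  · intro w hw
    obtain ⟨z, i, hi, hm, rfl⟩ := hW w hw
    rw [gridIdx_liftPt ha hy]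
    by_cases hbr : tileOf n z ∈ broken
    · exact Or.inl hbr
    right
    have hf : tileOf n z ∉ fixed := fun hh => hWfix _ hh z i (Tile.near_self _) hi hm
    have heq := hc.ord_eq _ hf hbr
    exact ⟨z, false, i, by rw [hnumeq z heq] at hi; exact hi, rfl, hlift z i heq⟩
  · intro w' hw' hbr b hb hbf hbd b' hb' hbf' hbd' w hw hdeg
    have hw'2 := hw'
    obtain ⟨t, i, hi, hm, rfl⟩ := hW w' hw'
    rw [gridIdx_liftPt ha hy] at hbr
    have hf : tileOf n t ∉ fixed := fun hh => hWfix _ hh t i (Tile.near_self _) hi hm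
    obtain ⟨q, hq, hqeq⟩ := hc.not_bad (tileOf n t) trivial hf hbr
    -- The ordinary points outside of the exceptional squares are points of `q`.
    have hplace : ∀ v, (∃ z j, j < (y₀ (tileOf n z)).num ∧ v = liftPt a y₀ z false j ∧
        tileOf n z ∉ fixed ∧ tileOf n z ∉ broken) → dist v (liftPt a y t false i) ≤ 6 * r →
        v ≠ liftPt a y t false i →
        ∃ p ∈ nearSites H (tileOf n t) q, p ≠ (0, i) ∧
          relPos a (tileOf n t) q p = v - ⟨a * t.1, a * t.2⟩ := by
      rintro v ⟨z, j, hj, rfl, hzf, hzb⟩ hd hne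
      have heq := hqeq _ hzf hzb
      have hidx := abs_gridIdx_sub_le ha hH hd
      rw [gridIdx_liftPt ha hy₀, gridIdx_liftPt ha hy] at hidx
      have ht : tileOf n t + (((z - t).1 : ZMod n), ((z - t).2 : ZMod n)) = tileOf n z := by
        simp [tileOf]
      refine ⟨(z - t, j), ⟨hidx.1, hidx.2, ?_⟩, ?_, relPos_eq_liftPt_sub a q t z j heq⟩
      · simp only [ht]
        rw [CellState.num, heq]; exact hj
      · intro hh
        rw [Prod.mk.injEq, sub_eq_zero] at hh
        obtain ⟨rfl, rfl⟩ := hh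
        exact hne (hlift _ _ (hc.ord_eq _ hzf hzb)).symm
    have hBplace : ∀ b ∈ sites a y₀ firstBlack, gridIdx a b ∉ tileOf n ⁻¹' fixed →
        (∃ z j, j < (y₀ (tileOf n z)).num ∧ b = liftPt a y₀ z false j ∧
        tileOf n z ∉ fixed ∧ tileOf n z ∉ broken) ∧ b ≠ liftPt a y t false i := by
      intro b hb hbf
      have hb2 := (hblack b hb).resolve_left hbf
      refine ⟨?_, fun hh => Set.disjoint_left.1 hdisj hb2 (hh ▸ hw'2)⟩
      obtain ⟨z, j, hj, hmj, rfl⟩ := hB b hb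
      rw [gridIdx_liftPt ha hy₀] at hbf
      exact ⟨z, j, hj, rfl, hbf, fun hh => hBbr _ hh z j (Tile.near_self _) hj hmj⟩
    have hr0 : 0 ≤ r := le_trans (by positivity) hr
    obtain ⟨p₁, hp₁, hn₁, e₁⟩ := hplace b (hBplace b hb hbf).1 (by linarith) (hBplace b hb hbf).2
    obtain ⟨p₂, hp₂, hn₂, e₂⟩ := hplace b' (hBplace b' hb' hbf').1 (by linarith)
      (hBplace b' hb' hbf').2
    have hw3 : ∃ p ∈ nearSites H (tileOf n t) q, p ≠ (0, i) ∧
          relPos a (tileOf n t) q p = w - ⟨a * t.1, a * t.2⟩ := by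
      rcases hw with rfl | ⟨hwW, hwbr, hwne, hwd⟩
      · exact ⟨p₂, hp₂, hn₂, e₂⟩
      · refine hplace w ?_ hwd hwne
        obtain ⟨z, j, hj, hmj, rfl⟩ := hW w hwW
        rw [gridIdx_liftPt ha hy] at hwbr
        have hzf : tileOf n z ∉ fixed := fun hh => hWfix _ hh z j (Tile.near_self _) hj hmj
        have heq := hc.ord_eq _ hzf hwbr
        exact ⟨z, j, by rw [hnumeq z heq] at hj; exact hj, hlift z j heq, hzf, hwbr⟩
    obtain ⟨p₃, hp₃, hn₃, e₃⟩ := hw3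
    have hteq := hqeq _ hf hbr
    have hteq' : (q (tileOf n t)).1 = (y (tileOf n t)).1 := by rw [hteq, hc.ord_eq _ hf hbr]
    have e₀ : relPos a (tileOf n t) q (0, i) = liftPt a y t false i - ⟨a * t.1, a * t.2⟩ := by
      rw [← relPos_eq_liftPt_sub a q t t i hteq', sub_self]
    refine hq ⟨i, ?_, p₁, hp₁, p₂, hp₂, p₃, hp₃, hn₁, hn₂, hn₃, ?_⟩
    · rw [CellState.num, hteq']; exact hi
    · rw [e₁, e₂, e₃, e₀, sub_sub_sub_cancel_right, sub_sub_sub_cancel_right,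
        sub_sub_sub_cancel_right]
      exact hdeg

end

/-! ### Paths -/

/-- The identification of the plane with the complex plane, as a linear map. -/
def toComplex : ℝ × ℝ →ₗ[ℝ] ℂ := Complex.equivRealProdLm.symm.toLinearMap

lemma proj_eq_planeProj (s : ℝ) (x : ℝ × ℝ) : proj s x = planeProj s (toComplex x) := by
  have h1 : (toComplex x).re = x.1 := by simp [toComplex]
  have h2 : (toComplex x).im = x.2 := by simp [toComplex]
  rw [planeProj, h1, h2]

lemma proj_image_segment (s : ℝ) (u v : ℝ × ℝ) :
    proj s '' segment ℝ u v = planeProj s '' segment ℝ (toComplex u) (toComplex v) := by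
  have h : toComplex '' segment ℝ u v = segment ℝ (toComplex u) (toComplex v) :=
    image_segment ℝ toComplex.toAffineMap u v
  rw [← h, Set.image_image]
  exact Set.image_congr fun x _ => proj_eq_planeProj s x

lemma isConnected_polyline {v : ℕ → ℂ} (N : ℕ) :
    IsConnected (⋃ i ∈ Set.Iio (N + 1), segment ℝ (v i) (v (i + 1))) := by
  refine IsConnected.biUnion_of_chain ⟨0, Nat.succ_pos N⟩ Set.ordConnected_Iio
    (fun i _ => (convex_segment _ _).isConnected ⟨v i, left_mem_segment ℝ _ _⟩) fun i _ _ => ?_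
  exact ⟨v (i + 1), right_mem_segment ℝ _ _, left_mem_segment ℝ _ _⟩

lemma isCompact_polyline {v : ℕ → ℂ} (N : ℕ) :
    IsCompact (⋃ i ∈ Set.Iio (N + 1), segment ℝ (v i) (v (i + 1))) := by
  refine (Set.finite_Iio _).isCompact_biUnion fun i _ => ?_
  rw [segment_eq_image_lineMap]
  exact isCompact_Icc.image (AffineMap.lineMap_continuous)

lemma IsRobustlyBlack.mono {s : ℝ} {C : ColouredPoints s} {c c' : ℝ} {x : Torus s}
    (h : IsRobustlyBlack C c x) (hc : c' ≤ c) : IsRobustlyBlack C c' x := by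
  obtain ⟨b, hb, hw⟩ := h
  exact ⟨b, hb, fun w hw' => by linarith [hw w hw']⟩

lemma BlackPathsShadowed.mono {s : ℝ} {C₁ C₂ : ColouredPoints s} {c c' r r' : ℝ}
    (h : BlackPathsShadowed C₁ C₂ c r) (hc : c' ≤ c) (hr : r ≤ r') :
    BlackPathsShadowed C₁ C₂ c' r' := by
  intro γ hγ
  obtain ⟨γ', h1, h2, h3⟩ := h γ hγ
  refine ⟨γ', fun x hx => (h1 x hx).mono hc, fun y hy => ?_, fun x hx => ?_⟩
  · obtain ⟨x, hx, hd⟩ := h2 y hy; exact ⟨x, hx, hd.trans hr⟩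
  · obtain ⟨y, hy, hd⟩ := h3 x hx; exact ⟨y, hy, hd.trans hr⟩

/-- The trace of a path, through the vertices of the path in the complex plane. -/
lemma trace_eq (s : ℝ) (γ : PLPath) {v : ℕ → ℂ}
    (hv : ∀ i : Fin (γ.len + 2), v i = toComplex (γ.vertex i)) :
    γ.trace s = planeProj s '' ⋃ i ∈ Set.Iio (γ.len + 1), segment ℝ (v i) (v (i + 1)) := by
  simp only [PLPath.trace, proj_image_segment, Set.image_iUnion]
  ext x
  simp only [Set.mem_iUnion, Set.mem_Iio, exists_prop]
  have e1 : ∀ i : Fin (γ.len + 1), toComplex (γ.vertex i.castSucc) = v i := fun i => by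
    rw [← hv]; rfl
  have e2 : ∀ i : Fin (γ.len + 1), toComplex (γ.vertex i.succ) = v (i + 1) := fun i => by
    rw [← hv]; rfl
  constructor
  · rintro ⟨i, hi⟩
    rw [e1, e2] at hi
    exact ⟨i, i.2, hi⟩
  · rintro ⟨i, hi, hx⟩
    refine ⟨⟨i, hi⟩, ?_⟩
    rw [e1, e2]
    exact hx

/-- Comparable lifts give shadowed paths. -/
theorem blackPathsShadowed_of_compares {s r ζ η c : ℝ} {n K : ℕ} [NeZero n] {y₀ y : Conf n}
    (hy₀ : SimpleConf y₀) (hy : SimpleConf y) {κ₁ κ₂ : Fin 3 → Bool} {fixed broken : Set (ℤ × ℤ)}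
    (h : Compares (s / n) r ζ η K (sites (s / n) y₀ κ₁) (sites (s / n) y₀ fun _ => true)
      (sites (s / n) y κ₂) (sites (s / n) y fun m => !κ₂ m) fixed broken)
    (ha : 0 < s / n) (hc : 0 ≤ c) (hca : c ≤ s / n / 8) (hζ : 0 < ζ) (hζa : ζ ≤ s / n / 16)
    (har : s / n ≤ r) (hcη : c * (4 * r + c) * (8 * r) ≤ η * (s / n)) (hK : r / ζ + 1 ≤ K) :
    BlackPathsShadowed (colouring s κ₁ y₀) (colouring s κ₂ y) c r := by
  intro γ hγ
  set v : ℕ → ℂ := fun i => if hi : i < γ.len + 2 then toComplex (γ.vertex ⟨i, hi⟩) else 0 with hvdef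
  have hv : ∀ i : Fin (γ.len + 2), v i = toComplex (γ.vertex i) := fun i => by
    simp [hvdef]
  have htr := trace_eq s γ hv
  rw [htr] at hγ ⊢
  obtain ⟨N, p, hp, hvis⟩ := h.exists_shadow ha hc hca hζ hζa har hcη hK
    (isCompact_polyline γ.len) (isConnected_polyline γ.len)
    fun x hx => exists_nearest_of_isBlack hy₀ (hγ _ ⟨x, hx, rfl⟩)
  set γ' : PLPath := ⟨N, fun i => ((p i).re, (p i).im)⟩ with hγ'
  have hp' : ∀ i : Fin (γ'.len + 2), p i = toComplex (γ'.vertex i) := fun i => by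
    apply Complex.ext <;> simp [toComplex] <;> rfl
  refine ⟨γ', ?_, ?_, ?_⟩
  all_goals rw [trace_eq s γ' hp']
  · rintro _ ⟨x, hx, rfl⟩
    obtain ⟨i, hi, hx⟩ := Set.mem_iUnion₂.1 hx
    exact isRobustlyBlack_of_mem_leadSet hy (hp i hi x hx).1
  · rintro _ ⟨x, hx, rfl⟩
    obtain ⟨i, hi, hx⟩ := Set.mem_iUnion₂.1 hx
    obtain ⟨u, hu, hd⟩ := (hp i hi x hx).2
    exact ⟨_, ⟨u, hu, rfl⟩, (dist_planeProj_le s x u).trans hd⟩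
  · rintro _ ⟨x, hx, rfl⟩
    obtain ⟨i, hi, hd⟩ := hvis x hx
    refine ⟨_, ⟨p i, ?_, rfl⟩, (dist_planeProj_le s x (p i)).trans hd⟩
    rcases Nat.lt_or_ge i (N + 1) with hlt | hge
    · exact Set.mem_iUnion₂.2 ⟨i, hlt, left_mem_segment ℝ _ _⟩
    · have : i = N + 1 := le_antisymm hi hge
      rw [this]
      exact Set.mem_iUnion₂.2 ⟨N, Nat.lt_succ_self N, right_mem_segment ℝ _ _⟩

/-! ### The coupling at a fixed scale -/

lemma IsColouredPoissonProcess.comp {s p : ℝ} {Ω Ω' : Type*} [MeasurableSpace Ω]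
    [MeasurableSpace Ω'] {P : Measure Ω} {μ : Measure Ω'} [IsProbabilityMeasure P]
    [IsProbabilityMeasure μ] {X : Ω' → ColouredPoints s} (h : IsColouredPoissonProcess p μ X)
    {Y : Ω → Ω'} (hY : Measurable Y) (hlaw : P.map Y = μ) :
    IsColouredPoissonProcess p P fun ω => X (Y ω) := by
  have hmp : MeasurePreserving Y P μ := ⟨hY, hlaw⟩
  refine ⟨fun A hA => (h.measurable_count A hA).comp hY,
    fun A hA => (h.measurable_blackCount A hA).comp hY, fun A hA => ?_, fun m A hA hd => ?_,
    fun m A hA hd N k => ?_⟩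
  · rw [← h.map_count A hA, ← hlaw, Measure.map_map (h.measurable_count A hA) hY]
    rfl
  · have hi := h.indep_count m A hA hd
    change iIndepFun (fun i => (fun ω => (X ω).count (A i)) ∘ Y) P
    rw [iIndepFun_iff_map_fun_eq_pi_map
      (fun i => ((h.measurable_count (A i) (hA i)).comp hY).aemeasurable)]
    rw [iIndepFun_iff_map_fun_eq_pi_map
      (fun i => (h.measurable_count (A i) (hA i)).aemeasurable)] at hi
    have e : ∀ i, P.map ((fun ω => (X ω).count (A i)) ∘ Y) = μ.map fun ω => (X ω).count (A i) :=
      fun i => by rw [← hlaw, Measure.map_map (h.measurable_count (A i) (hA i)) hY]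
    change P.map ((fun ω i => (X ω).count (A i)) ∘ Y) =
      Measure.pi fun i => P.map ((fun ω => (X ω).count (A i)) ∘ Y)
    simp_rw [e]
    rw [← hi, ← hlaw, Measure.map_map
      (measurable_pi_lambda _ fun i => h.measurable_count (A i) (hA i)) hY]
  · have h1 : MeasurableSet {ω | ∀ i, (X ω).count (A i) = N i} := by
      simp only [Set.ofPred_forall]
      exact MeasurableSet.iInter fun i =>
        h.measurable_count (A i) (hA i) (measurableSet_singleton (N i))
    have h2 : MeasurableSet {ω | ∀ i, (X ω).count (A i) = N i ∧ (X ω).blackCount (A i) = k i} := by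
      simp only [Set.ofPred_forall]
      exact MeasurableSet.iInter fun i =>
        (h.measurable_count (A i) (hA i) (measurableSet_singleton (N i))).inter
          (h.measurable_blackCount (A i) (hA i) (measurableSet_singleton (k i)))
    have hc := h.colours m A hA hd N k
    rw [Measure.real, Measure.real, ← hmp.measure_preimage h1.nullMeasurableSet,
      ← hmp.measure_preimage h2.nullMeasurableSet] at hc
    exact hc

/-- Long empty runs of cells are unlikely. -/
lemma not_noGap_le {n : ℕ} [NeZero n] (l l' : NNReal) (ν : Measure (Fin 3))
    [IsProbabilityMeasure ν] {h : ℕ} (hh : h ≤ n) :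
    confLaw n l l' ν {y | ¬ NoGap h y} ≤ (n ^ 2 : ℕ) * ENNReal.ofReal (Real.exp (-l)) ^ h := by
  classical
  set S : Set CellState := (fun q => q.1.1) ⁻¹' {0} with hS
  have hSval : cellLaw l l' ν S = ENNReal.ofReal (Real.exp (-l)) := by
    have hmp : MeasurePreserving (fun q : CellState => q.1.1) (cellLaw l l' ν)
        (poissonMeasure l) :=
      (measurePreserving_fst (μ := poissonMeasure l)
        (ν := Measure.infinitePi fun _ : ℕ => unitSq)).comp
        (measurePreserving_fst (μ := ordLaw l) (ν := freeLaw l' ν))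
    rw [hS, hmp.measure_preimage MeasurableSet.of_discrete.nullMeasurableSet,
      poissonMeasure_singleton]
    simp
  set I : Tile n → Finset (Tile n) := fun c =>
    (Finset.range h).image fun k : ℕ => c + ((k : ZMod n), 0) with hI
  have hcard : ∀ c, (I c).card = h := by
    intro c
    rw [hI, Finset.card_image_of_injOn, Finset.card_range]
    intro k hk k' hk' heq
    rw [Finset.mem_coe, Finset.mem_range] at hk hk'
    have h1 := (Prod.ext_iff.1 (add_left_cancel heq)).1
    have h2 := congrArg ZMod.val h1
    rwa [ZMod.val_natCast_of_lt (hk.trans_le hh), ZMod.val_natCast_of_lt (hk'.trans_le hh)] at h2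
  have hsub : {y : Conf n | ¬ NoGap h y} ⊆ ⋃ c ∈ (Finset.univ : Finset (Tile n)),
      Set.pi Set.univ fun c' => if c' ∈ I c then S else Set.univ := by
    intro y hy
    obtain ⟨c, hc⟩ := not_forall.1 hy
    refine Set.mem_iUnion₂.2 ⟨c, Finset.mem_univ c, fun c' _ => ?_⟩
    change y c' ∈ if c' ∈ I c then S else Set.univ
    split_ifs with hc'
    · obtain ⟨k, hk, rfl⟩ := Finset.mem_image.1 hc'
      by_contra hne
      exact hc ⟨k, Finset.mem_range.1 hk, hne⟩
    · trivial
  refine (measure_mono hsub).trans ((measure_biUnion_finset_le _ _).trans ?_)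
  refine (Finset.sum_le_card_nsmul _ _ (ENNReal.ofReal (Real.exp (-l)) ^ h) fun c _ => ?_).trans ?_
  · rw [confLaw, Measure.pi_pi]
    refine le_of_eq ?_
    calc ∏ c', (cellLaw l l' ν) (if c' ∈ I c then S else Set.univ)
        = ∏ c', if c' ∈ I c then ENNReal.ofReal (Real.exp (-l)) else 1 := by
          refine Finset.prod_congr rfl fun c' _ => ?_
          split_ifs
          · exact hSval
          · exact measure_univ
      _ = _ := by rw [Finset.prod_ite_mem, Finset.univ_inter, Finset.prod_const, hcard]
  · rw [Finset.card_univ, Fintype.card_prod, ZMod.card, nsmul_eq_mul, sq]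

/-- The coupling at a fixed scale, with a bound for the probability of failure. -/
theorem exists_coupling {s : ℝ} (hs : 0 < s) {n : ℕ} [NeZero n] (hn : 9 ∣ n) {l l' : NNReal}
    {ν : Measure (Fin 3)} [IsProbabilityMeasure ν] {p₁ p₂ : ℝ} (hp₁ : p₁ ∈ Set.Icc (0 : ℝ) 1)
    (hp₂ : p₂ ∈ Set.Icc (0 : ℝ) 1) (hl : (l : ℝ) + l' = (s / n) ^ 2)
    (hν₁ : (l : ℝ) * ν.real {m | firstBlack m = true} = (s / n) ^ 2 * p₁)
    (hν₂ : (l : ℝ) * ν.real {m | secondBlack m = true} + l' = (s / n) ^ 2 * p₂)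
    {r η c : ℝ} {K H h k₀ : ℕ} (hr : (h + 1) * (s / n) ≤ r) (hH : 6 * r / (s / n) + 1 ≤ H)
    (hHn : H < n) (hhn : h ≤ n) (hη : 0 ≤ η) (hc : 0 ≤ c) (hca : c ≤ s / n / 8)
    (hcη : c * (4 * r + c) * (8 * r) ≤ η * (s / n)) (hK : r / (s / n / 16) + 1 ≤ K)
    (hle : (l : ENNReal) ^ k₀ + (k₀ * ((2 * H + 1) ^ 2 * k₀) ^ 3 * (2 * K + 3) : ℕ) *
      ENNReal.ofReal (2 * √η / (s / n)) ≤ goodWeight l l' ν k₀ ^ 81)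
    (hpos : goodWeight l l' ν k₀ ≠ 0) :
    ∃ (Ω : Type) (_ : MeasurableSpace Ω) (P : Measure Ω) (X₁ X₂ : Ω → ColouredPoints s),
      IsProbabilityMeasure P ∧ IsColouredPoissonProcess p₁ P X₁ ∧
      IsColouredPoissonProcess p₂ P X₂ ∧
      P {ω | ¬ BlackPathsShadowed (X₁ ω) (X₂ ω) c r} ≤
        (n ^ 2 : ℕ) * ((n ^ 2 : ℕ) * (l : ENNReal) ^ k₀) +
          (n ^ 2 : ℕ) * ENNReal.ofReal (Real.exp (-l)) ^ h := by
  have hn0 : (0 : ℝ) < n := by exact_mod_cast NeZero.pos n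
  have ha : 0 < s / n := by positivity
  obtain ⟨Ω, _, P, Y₀, Y, _, hY₀, hY, hlaw₀, hlaw, hfail⟩ := exists_coupled hn l l' ν
    (bad := badAt (s / n) (s / n / 16) η K H) (measurableSet_badAt _ _ _ _ _)
    (not_exchangeable_le ha _ hη K hHn hle hpos) Finset.univ
  refine ⟨Ω, inferInstance, P, fun ω => colouring s firstBlack (Y₀ ω),
    fun ω => colouring s secondBlack (Y ω), inferInstance, ?_, ?_, ?_⟩
  · refine (isColouredPoissonProcess_colouring hs hp₁.1 hp₁.2 hl ?_).comp hY₀ hlaw₀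
    rw [show firstBlack 2 = false by decide]
    simpa using hν₁
  · refine (isColouredPoissonProcess_colouring hs hp₂.1 hp₂.2 hl ?_).comp hY hlaw
    rw [show secondBlack 2 = true by decide]
    simpa using hν₂
  have hsub : {ω | ¬ BlackPathsShadowed (colouring s firstBlack (Y₀ ω))
      (colouring s secondBlack (Y ω)) c r} ⊆
      (({ω | ¬ ∃ fixed broken, Coupled (badAt (s / n) (s / n / 16) η K H)
        ((Finset.univ : Finset (Tile n)) : Set (Tile n)) (Y₀ ω) (Y ω) fixed broken} ∪
      Y₀ ⁻¹' {y | ¬ NoGap h y}) ∪ Y₀ ⁻¹' {y | ¬ SimpleConf y}) ∪ Y ⁻¹' {y | ¬ SimpleConf y} := by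
    intro ω hω
    by_contra hcon
    simp only [Set.mem_union, not_or] at hcon
    obtain ⟨⟨⟨h1, h2⟩, h3⟩, h4⟩ := hcon
    obtain ⟨fixed, broken, hcoup⟩ := not_not.1 h1
    rw [Finset.coe_univ] at hcoup
    have h3 : SimpleConf (Y₀ ω) := not_not.1 h3
    have h4 : SimpleConf (Y ω) := not_not.1 h4
    have hh0 : (0 : ℝ) ≤ h := h.cast_nonneg
    refine hω (blackPathsShadowed_of_compares h3 h4
      (hcoup.compares ha hr hH h3 h4 (not_not.1 h2)) ha hc hca (by positivity) le_rfl ?_ hcη hK)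
    nlinarith
  have hsimple : confLaw n l l' ν {y | ¬ SimpleConf y} = 0 := ae_iff.1 (ae_simpleConf l l' ν)
  refine (measure_mono hsub).trans ((measure_union_le _ _).trans ?_)
  have hzero : ∀ Z : Ω → Conf n, Measurable Z → P.map Z = confLaw n l l' ν →
      P (Z ⁻¹' {y | ¬ SimpleConf y}) = 0 := fun Z hZ hZlaw =>
    nonpos_iff_eq_zero.1 ((Measure.le_map_apply hZ.aemeasurable _).trans
      (by rw [hZlaw, hsimple]))
  rw [hzero Y hY hlaw, add_zero]
  refine (measure_union_le _ _).trans ?_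
  rw [hzero Y₀ hY₀ hlaw₀, add_zero]
  refine (measure_union_le _ _).trans (add_le_add (hfail.trans (le_of_eq ?_)) ?_)
  · rw [Finset.card_univ, Fintype.card_prod, ZMod.card, sq]
  · refine (Measure.le_map_apply hY₀.aemeasurable _).trans ?_
    rw [hlaw₀]
    exact not_noGap_le l l' ν hhn

/-! ### The choice of the parameters -/

lemma goodWeight_eq (l l' : NNReal) (ν : Measure (Fin 3)) [IsProbabilityMeasure ν] (k₀ : ℕ) :
    goodWeight l l' ν k₀ = ENNReal.ofReal
      (Real.exp (-l) * (1 - Real.exp (-l')) * ν.real {2} ^ k₀ / 81) := by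
  have h1 : poissonMeasure l' {k | 1 ≤ k} = ENNReal.ofReal (1 - Real.exp (-l')) := by
    have : {k : ℕ | 1 ≤ k} = {0}ᶜ := by ext k; simp [Nat.one_le_iff_ne_zero]
    rw [this, ← ofReal_measureReal, probReal_compl_eq_one_sub (measurableSet_singleton 0),
      poissonMeasure_real_singleton]
    simp
  have h2 : (0 : ℝ) ≤ 1 - Real.exp (-l') := sub_nonneg.2 (Real.exp_le_one_iff.2 (by simp))
  rw [goodWeight, h1, poissonMeasure_singleton, ← ofReal_measureReal (μ := ν) (s := {2}),
    ← ENNReal.ofReal_pow measureReal_nonneg,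
    show (81 : ENNReal)⁻¹ = ENNReal.ofReal (81⁻¹) by
      rw [ENNReal.ofReal_inv_of_pos (by norm_num)]; norm_num,
    ← ENNReal.ofReal_mul (by positivity), ← ENNReal.ofReal_mul h2,
    ← ENNReal.ofReal_mul (by positivity)]
  congr 1
  simp
  ring

/-- A probability measure on the marks with given weights. -/
lemma exists_markLaw {w : Fin 3 → ℝ} (hw : ∀ i, 0 ≤ w i) (hsum : ∑ i, w i = 1) :
    ∃ ν : Measure (Fin 3), IsProbabilityMeasure ν ∧
      ∀ S : Finset (Fin 3), ν.real S = ∑ i ∈ S, w i := by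
  have h : ∑ i, ENNReal.ofReal (w i) = 1 := by
    rw [← ENNReal.ofReal_sum_of_nonneg fun i _ => hw i, hsum, ENNReal.ofReal_one]
  refine ⟨(PMF.ofFintype _ h).toMeasure, inferInstance, fun S => ?_⟩
  rw [Measure.real, PMF.toMeasure_apply_finset]
  simp only [PMF.ofFintype_apply]
  rw [← ENNReal.ofReal_sum_of_nonneg fun i _ => hw i,
    ENNReal.toReal_ofReal (Finset.sum_nonneg fun i _ => hw i)]

/-- The law of the marks for which the black points of the two colourings have intensities `p₁`
and `p₂`, when a proportion `(p₂ - p₁) / 2` of all points is extra. -/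
lemma exists_markLaw_of_lt {p₁ p₂ : ℝ} (hp₁ : 0 < p₁) (hp : p₁ < p₂) (hp₂ : p₂ < 1) :
    ∃ ν : Measure (Fin 3), IsProbabilityMeasure ν ∧
      (1 - (p₂ - p₁) / 2) * ν.real {m | firstBlack m = true} = p₁ ∧
      (1 - (p₂ - p₁) / 2) * ν.real {m | secondBlack m = true} + (p₂ - p₁) / 2 = p₂ ∧
      ν.real {2} = (p₂ - p₁) / 2 / (1 - (p₂ - p₁) / 2) := by
  set e := (p₂ - p₁) / 2 with he
  have h1e : 0 < 1 - e := by linarith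
  obtain ⟨ν, hν, hS⟩ := exists_markLaw (w := ![p₁ / (1 - e), (1 - p₂) / (1 - e), e / (1 - e)])
    (by
      intro i
      fin_cases i
      · exact div_nonneg hp₁.le h1e.le
      · exact div_nonneg (by linarith) h1e.le
      · exact div_nonneg (by linarith) h1e.le)
    (by rw [Fin.sum_univ_three]; simp; field_simp; linarith)
  refine ⟨ν, hν, ?_, ?_, ?_⟩
  · have : {m | firstBlack m = true} = (({0} : Finset (Fin 3)) : Set (Fin 3)) := by
      ext m; fin_cases m <;> simp [firstBlack]
    rw [this, hS]
    simp; field_simp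
  · have : {m | secondBlack m = true} = (({0, 2} : Finset (Fin 3)) : Set (Fin 3)) := by
      ext m; fin_cases m <;> simp [secondBlack]
    rw [this, hS, Finset.sum_pair (by decide)]
    simp; field_simp; linarith
  · have := hS {2}
    rw [Finset.coe_singleton] at this
    rw [this]; simp

lemma eventually_log_pow_le (C : ℝ) (m : ℕ) {α : ℝ} (hα : 0 < α) :
    ∀ᶠ s : ℝ in atTop, C * Real.log s ^ m ≤ s ^ α := by
  have h := ((isLittleO_log_rpow_rpow_atTop (m : ℝ) hα).const_mul_left C).bound one_pos
  filter_upwards [h, eventually_ge_atTop 1] with s hs h1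
  rw [Real.rpow_natCast, one_mul, Real.norm_of_nonneg (Real.rpow_nonneg (by linarith) _)] at hs
  exact (le_abs_self _).trans hs

/-- At every scale there are coloured Poisson processes with both parameters. -/
lemma exists_processes {p₁ p₂ : ℝ} (hp₁ : 0 < p₁) (hp : p₁ < p₂) (hp₂ : p₂ < 1) {s : ℝ}
    (hs : 0 < s) :
    ∃ (Ω : Type) (_ : MeasurableSpace Ω) (P : Measure Ω) (X₁ X₂ : Ω → ColouredPoints s),
      IsProbabilityMeasure P ∧ IsColouredPoissonProcess p₁ P X₁ ∧
      IsColouredPoissonProcess p₂ P X₂ := by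
  obtain ⟨ν, hν, h1, h2, -⟩ := exists_markLaw_of_lt hp₁ hp hp₂
  set e := (p₂ - p₁) / 2 with he
  have h1e : 0 ≤ 1 - e := by linarith
  have h0e : 0 ≤ e := by linarith
  set l : NNReal := ⟨s ^ 2 * (1 - e), by positivity⟩ with hl
  set l' : NNReal := ⟨s ^ 2 * e, by positivity⟩ with hl'
  have hlv : (l : ℝ) = s ^ 2 * (1 - e) := rfl
  have hlv' : (l' : ℝ) = s ^ 2 * e := rfl
  refine ⟨Conf 1, inferInstance, confLaw 1 l l' ν, colouring s firstBlack,
    colouring s secondBlack, inferInstance,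
    isColouredPoissonProcess_colouring hs hp₁.le (by linarith) ?_ ?_,
    isColouredPoissonProcess_colouring hs (by linarith) hp₂.le ?_ ?_⟩
  · rw [hlv, hlv']; simp; ring
  · rw [show firstBlack 2 = false by decide, hlv]
    simp only [Nat.cast_one, div_one, Bool.false_eq_true, if_false, mul_zero, add_zero]
    rw [mul_assoc, h1]
  · rw [hlv, hlv']; simp; ring
  · rw [show secondBlack 2 = true by decide, hlv, hlv']
    simp only [Nat.cast_one, div_one, if_true, mul_one]
    rw [mul_assoc, ← mul_add, h2]

/-- The number of cells in a row: a multiple of `9`, for which the cells have side about `a₀`. -/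
lemma exists_mesh {a₀ s : ℝ} (ha₀ : 0 < a₀) (hs : 9 * a₀ ≤ s) :
    ∃ n : ℕ, 9 ∣ n ∧ 0 < n ∧ s / n ≤ a₀ ∧ a₀ / 2 ≤ s / n := by
  have hs0 : 0 < s := by linarith
  set k := ⌊s / (9 * a₀)⌋₊ with hk
  have h1 : s / (9 * a₀) < k + 1 := Nat.lt_floor_add_one _
  have h2 : (k : ℝ) ≤ s / (9 * a₀) := Nat.floor_le (by positivity)
  rw [div_lt_iff₀ (by positivity)] at h1
  rw [le_div_iff₀ (by positivity)] at h2
  have hn : (0 : ℝ) < (9 * (k + 1) : ℕ) := by positivity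
  refine ⟨9 * (k + 1), Dvd.intro _ rfl, by positivity, ?_, ?_⟩
  · rw [div_le_iff₀ hn]; push_cast; linarith
  · rw [le_div_iff₀ hn]; push_cast; nlinarith

lemma le_pow_ceil_log {q κ α s : ℝ} (hq : 0 < q) (hq1 : q < 1) (hκ : 0 < κ)
    (hκq : κ * (-Real.log q) ≤ α) (hs : 1 ≤ s) :
    q * s ^ (-α) ≤ q ^ ⌈κ * Real.log s⌉₊ := by
  have hL : 0 ≤ Real.log s := Real.log_nonneg hs
  have hk : (⌈κ * Real.log s⌉₊ : ℝ) < κ * Real.log s + 1 := Nat.ceil_lt_add_one (by positivity)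
  rw [← Real.rpow_natCast q, Real.rpow_def_of_pos hq, Real.rpow_def_of_pos (by linarith)]
  nth_rewrite 1 [← Real.exp_log hq]
  rw [← Real.exp_add]
  refine Real.exp_le_exp.2 ?_
  have h1 := mul_le_mul_of_nonneg_right hκq hL
  have h2 := mul_le_mul_of_nonneg_left hk.le (neg_pos.2 (Real.log_neg hq hq1)).le
  linarith

lemma pow_ceil_log_le {b κ l s : ℝ} (hl : 0 ≤ l) (hκ : 0 < κ) (hb : 0 ≤ b)
    (hlb : l ≤ Real.exp (-(b / κ))) (hs : 1 ≤ s) : l ^ ⌈κ * Real.log s⌉₊ ≤ s ^ (-b) := by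
  have hk : κ * Real.log s ≤ (⌈κ * Real.log s⌉₊ : ℝ) := Nat.le_ceil _
  calc l ^ ⌈κ * Real.log s⌉₊ ≤ Real.exp (-(b / κ)) ^ ⌈κ * Real.log s⌉₊ := by gcongr
    _ = Real.exp (⌈κ * Real.log s⌉₊ * -(b / κ)) := by rw [← Real.exp_nat_mul]
    _ ≤ Real.exp (Real.log s * -b) := by
      refine Real.exp_le_exp.2 ?_
      have h1 := mul_le_mul_of_nonneg_right hk (div_nonneg hb hκ.le)
      have h2 : κ * Real.log s * (b / κ) = Real.log s * b := by field_simp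
      linarith
    _ = _ := (Real.rpow_def_of_pos (by linarith) _).symm

/-- Good cells have a probability of at least `s ^ (-ε / 8)`, up to constants. -/
lemma le_goodReal_pow {l l' l₀' q ε s : ℝ} {k₀ : ℕ} (hl : l ≤ 1) (hl₀' : 0 < l₀')
    (hl' : l₀' ≤ l') (hq : 0 < q) (hs : 0 < s) (hqk : q * s ^ (-(ε / 648)) ≤ q ^ k₀) :
    (Real.exp (-1) * (1 - Real.exp (-l₀')) / 81 * q) ^ 81 * s ^ (-(ε / 8)) ≤
      (Real.exp (-l) * (1 - Real.exp (-l')) * q ^ k₀ / 81) ^ 81 := by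
  have hx : 0 < 1 - Real.exp (-l₀') := sub_pos.2 (Real.exp_lt_one_iff.2 (by linarith))
  have hp : 0 < s ^ (-(ε / 648)) := Real.rpow_pos_of_pos hs _
  have e3 : Real.exp (-1) ≤ Real.exp (-l) := Real.exp_le_exp.2 (by linarith)
  have e4 : 1 - Real.exp (-l₀') ≤ 1 - Real.exp (-l') := by
    have := Real.exp_le_exp.2 (neg_le_neg hl'); linarith
  have e5 : (s ^ (-(ε / 648))) ^ 81 = s ^ (-(ε / 8)) := by
    rw [← Real.rpow_natCast (s ^ (-(ε / 648))) 81, ← Real.rpow_mul hs.le]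
    congr 1
    push_cast; ring
  rw [← e5, ← mul_pow]
  refine pow_le_pow_left₀ (by positivity) ?_ 81
  calc Real.exp (-1) * (1 - Real.exp (-l₀')) / 81 * q * s ^ (-(ε / 648))
      = Real.exp (-1) * (1 - Real.exp (-l₀')) * (q * s ^ (-(ε / 648))) / 81 := by ring
    _ ≤ Real.exp (-l) * (1 - Real.exp (-l')) * q ^ k₀ / 81 := by
      have h1 := hx.le.trans e4
      gcongr

/-- The number of positions of bad points is polylogarithmic. -/
lemma count_le {B T k H K : ℝ} (hk0 : 0 ≤ k) (hH0 : 0 ≤ H) (hK0 : 0 ≤ K) (hk : k ≤ B * T ^ 2)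
    (hH : 2 * H + 1 ≤ B * T ^ 2) (hK : 2 * K + 3 ≤ B * T ^ 2) :
    k * ((2 * H + 1) ^ 2 * k) ^ 3 * (2 * K + 3) ≤ B ^ 11 * T ^ 22 := by
  have hB : 0 ≤ B * T ^ 2 := hk0.trans hk
  calc k * ((2 * H + 1) ^ 2 * k) ^ 3 * (2 * K + 3)
      ≤ (B * T ^ 2) * ((B * T ^ 2) ^ 2 * (B * T ^ 2)) ^ 3 * (B * T ^ 2) := by gcongr
    _ = _ := by ring

/-- Cells become bad less often than they become good. -/
lemma bad_le_good {a a₀ s ε C₁ lk M N : ℝ} (ha₀ : 0 < a₀) (ha : a₀ / 2 ≤ a) (hs : 0 < s)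
    (hC₁ : 0 < C₁) (hN : 0 ≤ N) (hlk : lk ≤ s ^ (-(5 + ε))) (hM : M ≤ N)
    (h1 : N * (4 / a₀) * (2 / C₁) ≤ s ^ (ε / 8)) (h2 : 2 / C₁ ≤ s ^ (5 + ε - ε / 8)) :
    lk + M * (2 * √(s ^ (-(ε / 2))) / a) ≤ C₁ * s ^ (-(ε / 8)) := by
  have ha0 : 0 < a := by linarith
  have hsq : √(s ^ (-(ε / 2))) = s ^ (-(ε / 4)) := by
    rw [Real.sqrt_eq_rpow, ← Real.rpow_mul hs.le]
    congr 1; ring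
  have d1 : lk ≤ C₁ / 2 * s ^ (-(ε / 8)) := by
    refine hlk.trans ?_
    have : s ^ (-(ε / 8)) = s ^ (-(5 + ε)) * s ^ (5 + ε - ε / 8) := by
      rw [← Real.rpow_add hs]; congr 1; ring
    rw [this]
    have hp := Real.rpow_pos_of_pos hs (-(5 + ε))
    calc s ^ (-(5 + ε)) = C₁ / 2 * (s ^ (-(5 + ε)) * (2 / C₁)) := by field_simp
      _ ≤ _ := by gcongr
  have d2 : M * (2 * √(s ^ (-(ε / 2))) / a) ≤ C₁ / 2 * s ^ (-(ε / 8)) := by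
    rw [hsq]
    have hp := Real.rpow_pos_of_pos hs (-(ε / 4))
    have : s ^ (-(ε / 8)) = s ^ (-(ε / 4)) * s ^ (ε / 8) := by
      rw [← Real.rpow_add hs]; congr 1; ring
    rw [this]
    have d3 : 2 * s ^ (-(ε / 4)) / a ≤ 4 / a₀ * s ^ (-(ε / 4)) := by
      rw [div_le_iff₀ ha0]
      calc 2 * s ^ (-(ε / 4)) = 4 / a₀ * s ^ (-(ε / 4)) * (a₀ / 2) := by field_simp; norm_num
        _ ≤ _ := by gcongr
    calc _ ≤ N * (4 / a₀ * s ^ (-(ε / 4))) := by gcongr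
      _ = C₁ / 2 * (s ^ (-(ε / 4)) * (N * (4 / a₀) * (2 / C₁))) := by field_simp
      _ ≤ _ := by gcongr
  linarith

/-- The bound for the probability of failure. -/
lemma failure_le {a₀ l₀ l s L lk ε n h : ℝ} (ha₀ : 0 < a₀) (hl₀ : 0 < l₀) (hl : l₀ ≤ l)
    (hs : 1 ≤ s) (hL : L = Real.log s) (hε : 0 ≤ ε) (hlk : lk ≤ s ^ (-(5 + ε)))
    (hlk0 : 0 ≤ lk) (hn0 : 0 ≤ n) (hn : n ≤ 2 / a₀ * s) (hh0 : 0 ≤ h) (hh : L ^ 2 / a₀ - 2 ≤ h)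
    (hL3 : 3 / (l₀ / a₀) ≤ L) :
    n ^ 2 * (n ^ 2 * lk) + n ^ 2 * Real.exp (-(l * h)) ≤
      ((2 / a₀) ^ 4 + (2 / a₀) ^ 2 * Real.exp (2 * l₀)) * s⁻¹ := by
  have hs0 : 0 < s := by linarith
  have e1 : lk ≤ s ^ (-5 : ℝ) :=
    hlk.trans (Real.rpow_le_rpow_of_exponent_le hs (by linarith))
  have e2 : s ^ 4 * s ^ (-5 : ℝ) = s⁻¹ := by
    rw [← Real.rpow_natCast s 4, ← Real.rpow_add hs0, ← Real.rpow_neg_one]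
    norm_num
  have e3 : Real.exp (-(l * h)) ≤ Real.exp (2 * l₀) * Real.exp (-(3 * L)) := by
    rw [← Real.exp_add]
    refine Real.exp_le_exp.2 ?_
    have h1 : l₀ * h ≤ l * h := mul_le_mul_of_nonneg_right hl hh0
    have h2 : l₀ * (L ^ 2 / a₀ - 2) ≤ l₀ * h := mul_le_mul_of_nonneg_left hh hl₀.le
    have h3 : 3 * L ≤ l₀ * (L ^ 2 / a₀) := by
      rw [div_le_iff₀ (by positivity)] at hL3
      have hL0 : 0 ≤ L := hL ▸ Real.log_nonneg hs
      calc 3 * L ≤ L * (l₀ / a₀) * L := mul_le_mul_of_nonneg_right hL3 hL0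
        _ = _ := by ring
    linarith
  have e4 : s ^ 2 * Real.exp (-(3 * L)) = s⁻¹ := by
    rw [hL, show -(3 * Real.log s) = Real.log s * (-3 : ℝ) by ring, ← Real.rpow_def_of_pos hs0,
      ← Real.rpow_natCast s 2, ← Real.rpow_add hs0, ← Real.rpow_neg_one]
    norm_num
  calc n ^ 2 * (n ^ 2 * lk) + n ^ 2 * Real.exp (-(l * h))
      ≤ (2 / a₀ * s) ^ 2 * ((2 / a₀ * s) ^ 2 * s ^ (-5 : ℝ)) +
        (2 / a₀ * s) ^ 2 * (Real.exp (2 * l₀) * Real.exp (-(3 * L))) := by gcongr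
    _ = (2 / a₀) ^ 4 * (s ^ 4 * s ^ (-5 : ℝ)) +
        (2 / a₀) ^ 2 * Real.exp (2 * l₀) * (s ^ 2 * Real.exp (-(3 * L))) := by ring
    _ = _ := by rw [e2, e4]; ring

/-- The margin of robustness is small enough. -/
lemma margin_le {a a₀ s L ε : ℝ} (ha₀ : 0 < a₀) (ha : a₀ / 2 ≤ a) (hs : 1 ≤ s) (hε : 0 ≤ ε)
    (hL : 1 ≤ L ^ 2) (h5 : 512 / a₀ * L ^ 4 ≤ s ^ (ε / 2)) :
    4 * s ^ (-ε) * (4 * L ^ 2 + 4 * s ^ (-ε)) * (8 * L ^ 2) ≤ s ^ (-(ε / 2)) * a := by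
  have hs0 : 0 < s := by linarith
  have hp := Real.rpow_pos_of_pos hs0 (-ε)
  have hp1 : s ^ (-ε) ≤ 1 := Real.rpow_le_one_of_one_le_of_nonpos hs (by linarith)
  have e1 : s ^ (-(ε / 2)) = s ^ (-ε) * s ^ (ε / 2) := by
    rw [← Real.rpow_add hs0]; congr 1; ring
  calc 4 * s ^ (-ε) * (4 * L ^ 2 + 4 * s ^ (-ε)) * (8 * L ^ 2)
      ≤ 4 * s ^ (-ε) * (4 * L ^ 2 + 4 * L ^ 2) * (8 * L ^ 2) := by
        have : s ^ (-ε) ≤ L ^ 2 := hp1.trans hL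
        gcongr
    _ = s ^ (-ε) * (512 / a₀ * L ^ 4) * (a₀ / 2) := by field_simp; ring
    _ ≤ s ^ (-ε) * s ^ (ε / 2) * a := by gcongr
    _ = _ := by rw [e1]

lemma exists_nat_near {x : ℝ} (hx : 0 ≤ x) : ∃ m : ℕ, x + 1 ≤ m ∧ (m : ℝ) ≤ x + 2 := by
  refine ⟨⌈x⌉₊ + 1, ?_, ?_⟩
  · have := Nat.le_ceil x
    push_cast; linarith
  · have := (Nat.ceil_lt_add_one hx).le
    push_cast; linarith

/-- The coupling at a large scale `s`, with the inequalities which say that `s` is large. -/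
lemma exists_coupling_of_large {p₁ p₂ ε e q κ a₀ l₀ l₀' C₁ B s L : ℝ} {ν : Measure (Fin 3)}
    [IsProbabilityMeasure ν] (hp₁ : 0 < p₁) (hp : p₁ < p₂) (hp₂ : p₂ < 1) (hε : 0 < ε)
    (hν₁ : (1 - e) * ν.real {m | firstBlack m = true} = p₁)
    (hν₂ : (1 - e) * ν.real {m | secondBlack m = true} + e = p₂) (hν3 : ν.real {2} = q)
    (h0e : 0 < e) (h1e : 0 < 1 - e) (hq0 : 0 < q) (hq1 : q < 1) (hκ0 : 0 < κ)
    (hκq : κ * (-Real.log q) ≤ ε / 648) (ha₀ : a₀ = Real.exp (-((5 + ε) / κ))) (ha₀1 : a₀ ≤ 1)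
    (hl₀ : l₀ = (a₀ / 2) ^ 2 * (1 - e)) (hl₀' : l₀' = (a₀ / 2) ^ 2 * e)
    (hC₁ : C₁ = (Real.exp (-1) * (1 - Real.exp (-l₀')) / 81 * q) ^ 81)
    (hB : B = 64 / a₀ + κ + 8) (hL : L = Real.log s)
    (h1 : B ^ 11 * L ^ 22 * (4 / a₀) * (2 / C₁) ≤ s ^ (ε / 8))
    (h2 : 2 / C₁ ≤ s ^ (5 + ε - ε / 8)) (h3 : (12 + 3 * a₀) * L ^ 2 ≤ s) (h4 : 64 / a₀ ≤ s ^ ε)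
    (h5 : 512 / a₀ * L ^ 4 ≤ s ^ (ε / 2)) (h6 : 3 / (l₀ / a₀) ≤ L) (hL1 : 1 ≤ L)
    (hs9 : 9 * a₀ ≤ s) (hs1 : 1 ≤ s) :
    ∃ (Ω : Type) (_ : MeasurableSpace Ω) (P : Measure Ω) (X₁ X₂ : Ω → ColouredPoints s),
      IsProbabilityMeasure P ∧ IsColouredPoissonProcess p₁ P X₁ ∧
      IsColouredPoissonProcess p₂ P X₂ ∧
      P {ω | ¬ BlackPathsShadowed (X₁ ω) (X₂ ω) (4 * s ^ (-ε)) (L ^ 2)} ≤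
        ENNReal.ofReal (((2 / a₀) ^ 4 + (2 / a₀) ^ 2 * Real.exp (2 * l₀)) * s⁻¹) := by
  have hs : 0 < s := by linarith
  have ha₀0 : 0 < a₀ := ha₀ ▸ Real.exp_pos _
  have hl₀0 : 0 < l₀ := hl₀ ▸ by positivity
  have hl₀'0 : 0 < l₀' := hl₀' ▸ by positivity
  have hx : 0 < 1 - Real.exp (-l₀') := sub_pos.2 (Real.exp_lt_one_iff.2 (by linarith))
  have hC₁0 : 0 < C₁ := hC₁ ▸ by positivity
  have hB0 : 0 < B := hB ▸ by positivity
  have hL2 : 1 ≤ L ^ 2 := one_le_pow₀ hL1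
  have hLL2 : L ≤ L ^ 2 := le_self_pow₀ hL1 (by norm_num)
  obtain ⟨n, hn9, hn0, hna, hna'⟩ := exists_mesh ha₀0 hs9
  have : NeZero n := ⟨hn0.ne'⟩
  have hnR : (0 : ℝ) < n := by exact_mod_cast hn0
  obtain ⟨a, ha⟩ : ∃ a, a = s / n := ⟨_, rfl⟩
  rw [← ha] at hna hna'
  have ha0 : 0 < a := by linarith
  have hns : s / a₀ ≤ n := by
    rw [div_le_iff₀ ha₀0]
    rw [ha, div_le_iff₀ hnR] at hna
    linarith
  have hns' : (n : ℝ) ≤ 2 / a₀ * s := by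
    rw [div_mul_eq_mul_div, le_div_iff₀ ha₀0]
    rw [ha, le_div_iff₀ hnR] at hna'
    linarith
  obtain ⟨l, hlv⟩ : ∃ l : NNReal, (l : ℝ) = a ^ 2 * (1 - e) := ⟨⟨_, by positivity⟩, rfl⟩
  obtain ⟨l', hlv'⟩ : ∃ l' : NNReal, (l' : ℝ) = a ^ 2 * e := ⟨⟨_, by positivity⟩, rfl⟩
  have ha2 : (a₀ / 2) ^ 2 ≤ a ^ 2 := pow_le_pow_left₀ (by positivity) hna' 2
  have ha2' : a ^ 2 ≤ a₀ := by
    calc a ^ 2 ≤ a₀ ^ 2 := pow_le_pow_left₀ ha0.le hna 2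
      _ ≤ a₀ := pow_le_of_le_one ha₀0.le ha₀1 (by norm_num)
  have hll : l₀ ≤ l := by rw [hlv, hl₀]; gcongr
  have hll' : l₀' ≤ l' := by rw [hlv', hl₀']; gcongr
  have hla : (l : ℝ) ≤ a₀ := by
    rw [hlv]
    exact (mul_le_of_le_one_right (sq_nonneg a) (by linarith)).trans ha2'
  -- With `r = L ^ 2`, the block of radius `H` around a cell contains the discs of radius `6 * r`, a
  -- grid of `2 * K + 1` points of spacing `a / 16` covers the relevant part of a bisector, and
  -- nonempty cells occur within distance `r` if no `h` consecutive cells are empty.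
  obtain ⟨k₀, hk₀⟩ : ∃ k₀, k₀ = ⌈κ * Real.log s⌉₊ := ⟨_, rfl⟩
  have hk₀2 : (k₀ : ℝ) < κ * L + 1 := by
    rw [hk₀, hL]
    exact Nat.ceil_lt_add_one (mul_nonneg hκ0.le (Real.log_nonneg hs1))
  obtain ⟨H, hH1, hH2⟩ := exists_nat_near (x := 12 / a₀ * L ^ 2) (by positivity)
  obtain ⟨K, hK1, hK2⟩ := exists_nat_near (x := 32 / a₀ * L ^ 2) (by positivity)
  obtain ⟨h, hh1, hh2⟩ : ∃ h : ℕ, L ^ 2 / a₀ - 2 ≤ h ∧ (h : ℝ) + 1 ≤ L ^ 2 / a₀ := by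
    have hfl : 1 ≤ ⌊L ^ 2 / a₀⌋₊ := by
      rw [Nat.one_le_floor_iff, le_div_iff₀ ha₀0]; linarith
    have hfl1 : (⌊L ^ 2 / a₀⌋₊ : ℝ) ≤ L ^ 2 / a₀ := Nat.floor_le (by positivity)
    have hfl2 : L ^ 2 / a₀ < (⌊L ^ 2 / a₀⌋₊ : ℝ) + 1 := Nat.lt_floor_add_one _
    refine ⟨⌊L ^ 2 / a₀⌋₊ - 1, ?_, ?_⟩
    · rw [Nat.cast_sub hfl, Nat.cast_one]; linarith
    · rw [Nat.cast_sub hfl, Nat.cast_one]; linarith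
  have hdiv : ∀ x : ℝ, 0 ≤ x → x * L ^ 2 / a ≤ 2 * x / a₀ * L ^ 2 := by
    intro x hx
    rw [div_le_iff₀ ha0]
    calc x * L ^ 2 = 2 * x / a₀ * L ^ 2 * (a₀ / 2) := by field_simp
      _ ≤ 2 * x / a₀ * L ^ 2 * a := by gcongr
  have hlk : (l : ℝ) ^ k₀ ≤ s ^ (-(5 + ε)) :=
    hk₀ ▸ pow_ceil_log_le l.coe_nonneg hκ0 (by linarith) (ha₀ ▸ hla) hs1
  have hgood := le_goodReal_pow (l := l) (hla.trans ha₀1) hl₀'0 hll' hq0 hs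
    (hk₀ ▸ le_pow_ceil_log hq0 hq1 hκ0 hκq hs1)
  rw [← hC₁] at hgood
  have hκL : κ * L ≤ κ * L ^ 2 := mul_le_mul_of_nonneg_left hLL2 hκ0.le
  have hM := count_le k₀.cast_nonneg H.cast_nonneg K.cast_nonneg (B := B) (T := L) (k := k₀)
    (H := H) (K := K)
    (by
      have h0 : 0 ≤ 64 / a₀ * L ^ 2 := by positivity
      rw [hB, add_mul, add_mul]; linarith)
    (by
      have h64 : 64 / a₀ * L ^ 2 = 2 * (12 / a₀ * L ^ 2) + 40 / a₀ * L ^ 2 := by ring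
      have h40 : 0 ≤ 40 / a₀ * L ^ 2 := by positivity
      have h0 : 0 ≤ κ * L ^ 2 := by positivity
      rw [hB, add_mul, add_mul]; linarith)
    (by
      have h64 : 64 / a₀ * L ^ 2 = 2 * (32 / a₀ * L ^ 2) := by ring
      have h0 : 0 ≤ κ * L ^ 2 := by positivity
      rw [hB, add_mul, add_mul]; linarith)
  have hbad := bad_le_good ha₀0 hna' hs hC₁0 (by positivity) hlk hM h1 h2
  have hgpos : 0 < C₁ * s ^ (-(ε / 8)) := mul_pos hC₁0 (Real.rpow_pos_of_pos hs _)
  have hl'0 : 0 < 1 - Real.exp (-(l' : ℝ)) :=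
    sub_pos.2 (Real.exp_lt_one_iff.2 (by linarith))
  have hg0 : 0 < Real.exp (-(l : ℝ)) * (1 - Real.exp (-(l' : ℝ))) * q ^ k₀ / 81 := by positivity
  have hsa : L ^ 2 / a₀ * 12 + 3 * L ^ 2 ≤ s / a₀ := by
    rw [le_div_iff₀ ha₀0]
    refine le_trans (le_of_eq ?_) h3
    field_simp
  have hLa : 0 ≤ L ^ 2 / a₀ := by positivity
  have hcoup := exists_coupling hs hn9 (l := l) (l' := l') (ν := ν) (p₁ := p₁) (p₂ := p₂)
    ⟨hp₁.le, by linarith⟩ ⟨by linarith, hp₂.le⟩ (by rw [hlv, hlv', ← ha]; ring)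
    (by rw [hlv, mul_assoc, hν₁, ← ha]) (by rw [hlv, hlv', mul_assoc, ← mul_add, hν₂, ← ha])
    (r := L ^ 2) (η := s ^ (-(ε / 2))) (c := 4 * s ^ (-ε)) (K := K) (H := H) (h := h) (k₀ := k₀)
    ?_ ?_ ?_ ?_ (Real.rpow_nonneg hs.le _) (mul_nonneg (by norm_num) (Real.rpow_nonneg hs.le _))
    ?_ ?_ ?_ ?_ ?_
  · obtain ⟨Ω, hΩ, P, X₁, X₂, hP, hX₁, hX₂, hfail⟩ := hcoup
    refine ⟨Ω, hΩ, P, X₁, X₂, hP, hX₁, hX₂, hfail.trans ?_⟩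
    have hle := failure_le ha₀0 hl₀0 hll hs1 hL hε.le hlk (by positivity) hnR.le hns'
      h.cast_nonneg hh1 h6
    refine le_trans (le_of_eq ?_) (ENNReal.ofReal_le_ofReal hle)
    rw [ENNReal.ofReal_add (by positivity) (by positivity), ENNReal.ofReal_mul (by positivity),
      ENNReal.ofReal_mul (by positivity), ENNReal.ofReal_mul (by positivity),
      ENNReal.ofReal_pow l.coe_nonneg, ENNReal.ofReal_coe_nnreal,
      ENNReal.ofReal_pow hnR.le, ENNReal.ofReal_natCast, ← ENNReal.ofReal_pow (Real.exp_nonneg _),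
      ← Real.exp_nat_mul, Nat.cast_pow, mul_neg, mul_comm (h : ℝ)]
  · rw [← ha]
    calc ((h : ℝ) + 1) * a ≤ L ^ 2 / a₀ * a₀ := by gcongr
      _ = L ^ 2 := div_mul_cancel₀ _ ha₀0.ne'
  · rw [← ha]
    have := hdiv 6 (by norm_num)
    norm_num at this
    linarith
  · have h12 : 12 / a₀ * L ^ 2 = L ^ 2 / a₀ * 12 := by ring
    have : (H : ℝ) < n := by linarith
    exact_mod_cast this
  · have : (h : ℝ) ≤ n := by linarith
    exact_mod_cast this
  · rw [← ha]
    have hp := Real.rpow_pos_of_pos hs (-ε)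
    have h64 : s ^ (-ε) * (64 / a₀) ≤ 1 := by
      calc s ^ (-ε) * (64 / a₀) ≤ s ^ (-ε) * s ^ ε := by gcongr
        _ = 1 := by rw [← Real.rpow_add hs, neg_add_cancel, Real.rpow_zero]
    rw [mul_div_assoc', div_le_one ha₀0] at h64
    linarith
  · rw [← ha]
    exact margin_le ha₀0 hna' hs1 hε.le hL2 h5
  · rw [← ha]
    have := hdiv 16 (by norm_num)
    norm_num at this
    have e1 : L ^ 2 / (a / 16) = 16 * L ^ 2 / a := by field_simp
    linarith
  · rw [← ha, goodWeight_eq, hν3, ← ENNReal.ofReal_pow hg0.le]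
    refine le_trans (le_of_eq ?_) (ENNReal.ofReal_le_ofReal (hbad.trans hgood))
    rw [ENNReal.ofReal_add (by positivity) (by positivity), ENNReal.ofReal_mul (by positivity),
      ENNReal.ofReal_pow l.coe_nonneg, ENNReal.ofReal_coe_nnreal]
    congr 2
    rw [← ENNReal.ofReal_natCast]
    congr 1
    push_cast
    rfl
  · rw [goodWeight_eq, hν3]
    exact (ENNReal.ofReal_pos.2 hg0).ne'

/-- The coupling at all large scales. -/
theorem eventually_exists_coupling {p₁ p₂ ε : ℝ} (hp₁ : 0 < p₁) (hp : p₁ < p₂) (hp₂ : p₂ < 1)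
    (hε : 0 < ε) :
    ∃ C : ℝ, ∀ᶠ s : ℝ in atTop, ∃ (Ω : Type) (_ : MeasurableSpace Ω) (P : Measure Ω)
      (X₁ X₂ : Ω → ColouredPoints s), IsProbabilityMeasure P ∧ IsColouredPoissonProcess p₁ P X₁ ∧
      IsColouredPoissonProcess p₂ P X₂ ∧
      P {ω | ¬ BlackPathsShadowed (X₁ ω) (X₂ ω) (4 * s ^ (-ε)) (Real.log s ^ 2)} ≤
        ENNReal.ofReal (C * s⁻¹) := by
  obtain ⟨ν, hν, hν₁, hν₂, hν3⟩ := exists_markLaw_of_lt hp₁ hp hp₂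
  obtain ⟨e, he⟩ : ∃ e, e = (p₂ - p₁) / 2 := ⟨_, rfl⟩
  rw [← he] at hν₁ hν₂ hν3
  have h0e : 0 < e := by linarith
  have he2 : e < 1 / 2 := by linarith
  have h1e : 0 < 1 - e := by linarith
  obtain ⟨q, hq⟩ : ∃ q, q = e / (1 - e) := ⟨_, rfl⟩
  rw [← hq] at hν3
  have hq0 : 0 < q := hq ▸ div_pos h0e h1e
  have hq1 : q < 1 := by rw [hq, div_lt_one h1e]; linarith
  have hlogq : Real.log q < 0 := Real.log_neg hq0 hq1
  -- The number `κ log s` of points in a cell is so small that good cells have probability at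
  -- least `s ^ (-ε / 8)`, up to constants.
  obtain ⟨κ, hκ⟩ : ∃ κ, κ = ε / (648 * (1 - Real.log q)) := ⟨_, rfl⟩
  have hκ0 : 0 < κ := hκ ▸ div_pos hε (by linarith)
  have hκq : κ * (-Real.log q) ≤ ε / 648 := by
    rw [hκ, div_mul_eq_mul_div, div_le_div_iff₀ (by linarith) (by norm_num)]
    nlinarith
  -- The cells are so small that more than `κ log s` points in some cell are unlikely.
  obtain ⟨a₀, ha₀⟩ : ∃ a₀, a₀ = Real.exp (-((5 + ε) / κ)) := ⟨_, rfl⟩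
  have ha₀1 : a₀ ≤ 1 := by
    rw [ha₀, Real.exp_le_one_iff, neg_nonpos]
    positivity
  obtain ⟨C₁, hC₁⟩ : ∃ C₁, C₁ =
    (Real.exp (-1) * (1 - Real.exp (-((a₀ / 2) ^ 2 * e))) / 81 * q) ^ 81 := ⟨_, rfl⟩
  obtain ⟨B, hB⟩ : ∃ B, B = 64 / a₀ + κ + 8 := ⟨_, rfl⟩
  refine ⟨(2 / a₀) ^ 4 + (2 / a₀) ^ 2 * Real.exp (2 * ((a₀ / 2) ^ 2 * (1 - e))), ?_⟩
  have ev1 := eventually_log_pow_le (B ^ 11 * (4 / a₀) * (2 / C₁)) 22 (α := ε / 8) (by linarith)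
  have ev2 := eventually_log_pow_le (2 / C₁) 0 (α := 5 + ε - ε / 8) (by linarith)
  have ev3 := eventually_log_pow_le (12 + 3 * a₀) 2 (α := 1) one_pos
  have ev4 := eventually_log_pow_le (64 / a₀) 0 (α := ε) hε
  have ev5 := eventually_log_pow_le (512 / a₀) 4 (α := ε / 2) (by linarith)
  have ev6 := Real.tendsto_log_atTop.eventually_ge_atTop (3 / ((a₀ / 2) ^ 2 * (1 - e) / a₀))
  have ev7 := Real.tendsto_log_atTop.eventually_ge_atTop 1
  filter_upwards [ev1, ev2, ev3, ev4, ev5, ev6, ev7, eventually_ge_atTop (9 * a₀),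
    eventually_ge_atTop 1] with s h1 h2 h3 h4 h5 h6 hL1 hs9 hs1
  rw [pow_zero, mul_one] at h2 h4
  rw [Real.rpow_one] at h3
  rw [mul_right_comm, mul_right_comm (B ^ 11)] at h1
  exact exists_coupling_of_large hp₁ hp hp₂ hε hν₁ hν₂ hν3 h0e h1e hq0 hq1 hκ0 hκq ha₀ ha₀1 rfl rfl
    hC₁ hB rfl h1 h2 h3 h4 h5 h6 hL1 hs9 hs1

end VoronoiTorus

end

theorem theorem6p1 (p₁ p₂ ε : ℝ) (hp₁ : 0 < p₁) (hp : p₁ < p₂) (hp₂ : p₂ < 1) (hε : 0 < ε)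
    (δ : ℝ → ℝ) (hδ : ∀ s : ℝ, 0 < s → δ s ≤ s ^ (-ε)) :
    ∃ (Ω : ℝ → Type) (_ : ∀ s, MeasurableSpace (Ω s)) (P : ∀ s, Measure (Ω s))
      (X₁ X₂ : ∀ s, Ω s → VoronoiTorus.ColouredPoints s),
      (∀ s : ℝ, 0 < s → IsProbabilityMeasure (P s) ∧
        VoronoiTorus.IsColouredPoissonProcess p₁ (P s) (X₁ s) ∧
        VoronoiTorus.IsColouredPoissonProcess p₂ (P s) (X₂ s)) ∧
      Tendsto
        (fun s : ℝ => P s {ω | ¬ VoronoiTorus.BlackPathsShadowed (X₁ s ω) (X₂ s ω)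
          (4 * δ s) ((Real.log s) ^ 2)})
        atTop (𝓝 0) := by
  classical
  obtain ⟨C, hC⟩ := VoronoiTorus.eventually_exists_coupling hp₁ hp hp₂ hε
  have key : ∀ s : ℝ, ∃ (Ω : Type) (_ : MeasurableSpace Ω) (P : Measure Ω)
      (X₁ X₂ : Ω → VoronoiTorus.ColouredPoints s),
      (0 < s → IsProbabilityMeasure P ∧ VoronoiTorus.IsColouredPoissonProcess p₁ P X₁ ∧
        VoronoiTorus.IsColouredPoissonProcess p₂ P X₂) ∧
      ((∃ (Ω : Type) (_ : MeasurableSpace Ω) (P : Measure Ω)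
        (X₁ X₂ : Ω → VoronoiTorus.ColouredPoints s), IsProbabilityMeasure P ∧
          VoronoiTorus.IsColouredPoissonProcess p₁ P X₁ ∧
          VoronoiTorus.IsColouredPoissonProcess p₂ P X₂ ∧
          P {ω | ¬ VoronoiTorus.BlackPathsShadowed (X₁ ω) (X₂ ω) (4 * s ^ (-ε))
            (Real.log s ^ 2)} ≤ ENNReal.ofReal (C * s⁻¹)) →
        P {ω | ¬ VoronoiTorus.BlackPathsShadowed (X₁ ω) (X₂ ω) (4 * s ^ (-ε))
          (Real.log s ^ 2)} ≤ ENNReal.ofReal (C * s⁻¹)) := by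
    intro s
    by_cases h : ∃ (Ω : Type) (_ : MeasurableSpace Ω) (P : Measure Ω)
        (X₁ X₂ : Ω → VoronoiTorus.ColouredPoints s), IsProbabilityMeasure P ∧
          VoronoiTorus.IsColouredPoissonProcess p₁ P X₁ ∧
          VoronoiTorus.IsColouredPoissonProcess p₂ P X₂ ∧
          P {ω | ¬ VoronoiTorus.BlackPathsShadowed (X₁ ω) (X₂ ω) (4 * s ^ (-ε))
            (Real.log s ^ 2)} ≤ ENNReal.ofReal (C * s⁻¹)
    · obtain ⟨Ω, mΩ, P, X₁, X₂, hP, hX₁, hX₂, hfail⟩ := h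
      exact ⟨Ω, mΩ, P, X₁, X₂, fun _ => ⟨hP, hX₁, hX₂⟩, fun _ => hfail⟩
    by_cases hs : 0 < s
    · obtain ⟨Ω, mΩ, P, X₁, X₂, hX⟩ := VoronoiTorus.exists_processes hp₁ hp hp₂ hs
      exact ⟨Ω, mΩ, P, X₁, X₂, fun _ => hX, fun h' => absurd h' h⟩
    · exact ⟨Unit, inferInstance, 0, fun _ => ⟨∅, ∅, disjoint_bot_left⟩,
        fun _ => ⟨∅, ∅, disjoint_bot_left⟩, fun hs' => absurd hs' hs, fun h' => absurd h' h⟩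
  choose Ω mΩ P X₁ X₂ hX hfail using key
  refine ⟨Ω, mΩ, P, X₁, X₂, hX, ?_⟩
  have hlim : Tendsto (fun s : ℝ => ENNReal.ofReal (C * s⁻¹)) atTop (𝓝 0) := by
    have h := ENNReal.tendsto_ofReal (tendsto_inv_atTop_zero.const_mul C)
    rwa [mul_zero, ENNReal.ofReal_zero] at h
  refine tendsto_of_tendsto_of_tendsto_of_le_of_le' tendsto_const_nhds hlim
    (Eventually.of_forall fun _ => zero_le) ?_
  filter_upwards [hC, eventually_gt_atTop 0] with s hs hs0
  refine (measure_mono fun ω hω => ?_).trans (hfail s hs)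
  exact fun h => hω (h.mono (by linarith [hδ s hs0]) le_rfl)
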